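/- A transducer (Wang set) is a set of tiles $(w,e,s,n)$, i.e. transitions from state $w$ to state $e$ reading the letter $s$ and writing the letter $n$, written $w\xrightarrow{s|n}e$. A tiling by a Wang set $T$ is a map $f:\mathbb{Z}^2\to T$ such that $e(f(x,y))=w(f(x+1,y))$ and $n(f(x,y))=s(f(x,y+1))$ for all $x,y$. A tiling is periodic if it is invariant under some nonzero translation in $\mathbb{Z}^2$. $T$ is aperiodic if it has a tiling and none of its tilings is periodic. Let $\mathcal{T}_a$ be the transducer over the letters $\{0,1\}$ with states $a,b,c,d,e,f,g,h,i,j$ and the 14 transitions $$a\xrightarrow{1|0}b,\; f\xrightarrow{1|1}b,\; g\xrightarrow{1|1}a,\; e\xrightarrow{1|1}f,\; c\xrightarrow{1|0}d,\; b\xrightarrow{1|0}c,\; b\xrightarrow{1|1}g,$$ $$d\xrightarrow{1|1}e,\; i\xrightarrow{0|0}j,\; c\xrightarrow{0|0}i,\; d\xrightarrow{0|0}h,\; j\xrightarrow{0|0}a,\; h\xrightarrow{0|0}c,\; h\xrightarrow{0|1}g,$$ and let $\mathcal{T}_b$ be the transducer over $\{0,1\}$ with states $K,L,M,M',N,O,O',P,Q,R$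 and the 14 transitions $$P\xrightarrow{1|1}R,\; M'\xrightarrow{1|1}K,\; R\xrightarrow{1|1}M,\; Q\xrightarrow{0|0}O',\; N\xrightarrow{0|1}O,\; P\xrightarrow{0|1}Q,\; M\xrightarrow{0|1}N,$$ $$R\xrightarrow{0|0}L,\; K\xrightarrow{0|1}L,\; O\xrightarrow{0|0}R,\; O\xrightarrow{0|1}P,\; L\xrightarrow{0|1}M,\; O'\xrightarrow{0|0}R,\; R\xrightarrow{1|1}M'.$$ Let $\mathcal{T}_D=\mathcal{T}_a\cup\mathcal{T}_b$ (disjoint union of states), let $\phi=(1+\sqrt5)/2$, and let the Fibonacci word $abaababa\cdots$ be the fixed point of the morphism $a\mapsto ab$, $b\mapsto a$. For irrational $\alpha\in(0,1)$, a Sturmian word of slope $\alpha$ over $\{a,b\}$ is a right-infinite (indexed by $n\in\mathbb{N}$) or bi-infinite (indexed by $n\in\mathbb{Z}$) word for which there is a real $\rho$ such that either, for all $n$, its $n$-th letter is $a$ if $\lfloor\alpha(n+1)+\rho\rfloor-\lfloor\alpha n+\rho\rfloor=1$ and $b$ otherwise, or the same holds with $\lceil\cdot\rceil$ in place of $\lfloor\cdot\rfloor$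 (so $\alpha$ is the frequency of the letter $a$). Then: 1. The Wang set $\mathcal{T}_D$ is aperiodic. 2. The set of finite words $u=u_1\cdots u_m\in\{a,b\}^*$ such that the sequence $\mathcal{T}_{u_1},\dots,\mathcal{T}_{u_m}$ appears on $m$ consecutive rows (read upwards) of some tiling of the plane by $\mathcal{T}_D$ is exactly the set of factors of the Fibonacci word. It is also exactly the set of factors of right-infinite Sturmian words of slope $1/\phi$. 3. The set of bi-infinite words $w\in\{a,b\}^{\mathbb{Z}}$ for which there is a tiling $f$ of the plane by $\mathcal{T}_D$ such that, for every $y$, all the tiles of row $y$ belong to $\mathcal{T}_{w(y)}$, is exactly the set of bi-infinite Sturmian words of slope $1/\phi$. -/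

import Mathlib

/-! ### Wang sets -/

/-- A Wang tile with horizontal colors (transducer states) in `H` and vertical colors
(input and output letters) in `V`.  Seen as a transition of a transducer, the tile goes from the
state `w` to the state `e`, reads `s` and writes `n`. -/
@[ext]
structure WangTile (H V : Type*) where
  /-- west color -/
  w : H
  /-- east color -/
  e : H
  /-- south color -/
  s : V
  /-- north color -/
  n : V

/-- A Wang set over the colors `H`, `V` is a set of Wang tiles. -/
abbrev WangSet (H V : Type*) := Set (WangTile H V)

/-- Renaming of the horizontal colors (states). -/
def WangTile.rename {H H' V : Type*} (f : H → H') (t : WangTile H V) : WangTile H' V :=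
  ⟨f t.w, f t.e, t.s, t.n⟩

namespace WangSet

variable {H H' V : Type*}

/-- The set of tiles of `T` after renaming its states. -/
def rename (f : H → H') (T : WangSet H V) : WangSet H' V := WangTile.rename f '' T

/-- The union of two transducers: the states are first made disjoint. -/
def disjUnion (T : WangSet H V) (T' : WangSet H' V) : WangSet (H ⊕ H') V :=
  rename Sum.inl T ∪ rename Sum.inr T'

/-- `f` is a tiling of the plane `ℤ²` by `T`; `f x y` is the tile at position `(x, y)`. -/
def IsTiling (T : WangSet H V) (f : ℤ → ℤ → WangTile H V) : Prop :=
  (∀ x y, f x y ∈ T) ∧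
  (∀ x y, (f x y).e = (f (x + 1) y).w) ∧
  (∀ x y, (f x y).n = (f x (y + 1)).s)

end WangSet

/-- `f` is invariant under a nonzero translation. -/
def IsPeriodicTiling {H V : Type*} (f : ℤ → ℤ → WangTile H V) : Prop :=
  ∃ u v : ℤ, (u, v) ≠ (0, 0) ∧ ∀ x y, f x y = f (x + u) (y + v)

/-- A Wang set is aperiodic if it tiles the plane and none of its tilings is periodic. -/
def WangSet.IsAperiodic {H V : Type*} (T : WangSet H V) : Prop :=
  (∃ f, T.IsTiling f) ∧ ∀ f, T.IsTiling f → ¬ IsPeriodicTiling f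

/-! ### The transducers -/

/-- The states of the transducer `transducerA`. -/
inductive StateA
  | a | b | c | d | e | f | g | h | i | j
  deriving DecidableEq

/-- The states of the transducer `transducerB`. -/
inductive StateB
  | K | L | M | M' | N | O | O' | P | Q | R
  deriving DecidableEq

/-- The first component, with 14 transitions `⟨from, to, read, written⟩`. -/
def transducerA : WangSet StateA (Fin 2) :=
  { ⟨.a, .b, 1, 0⟩, ⟨.f, .b, 1, 1⟩, ⟨.g, .a, 1, 1⟩, ⟨.e, .f, 1, 1⟩,
    ⟨.c, .d, 1, 0⟩, ⟨.b, .c, 1, 0⟩, ⟨.b, .g, 1, 1⟩, ⟨.d, .e, 1, 1⟩,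
    ⟨.i, .j, 0, 0⟩, ⟨.c, .i, 0, 0⟩, ⟨.d, .h, 0, 0⟩, ⟨.j, .a, 0, 0⟩,
    ⟨.h, .c, 0, 0⟩, ⟨.h, .g, 0, 1⟩ }

/-- The second component, with 14 transitions `⟨from, to, read, written⟩`. -/
def transducerB : WangSet StateB (Fin 2) :=
  { ⟨.P, .R, 1, 1⟩, ⟨.M', .K, 1, 1⟩, ⟨.R, .M, 1, 1⟩, ⟨.Q, .O', 0, 0⟩,
    ⟨.N, .O, 0, 1⟩, ⟨.P, .Q, 0, 1⟩, ⟨.M, .N, 0, 1⟩, ⟨.R, .L, 0, 0⟩,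
    ⟨.K, .L, 0, 1⟩, ⟨.O, .R, 0, 0⟩, ⟨.O, .P, 0, 1⟩, ⟨.L, .M, 0, 1⟩,
    ⟨.O', .R, 0, 0⟩, ⟨.R, .M', 1, 1⟩ }

/-- The Wang set `T_D`, the union of the two transducers. -/
def transducerD : WangSet (StateA ⊕ StateB) (Fin 2) := transducerA.disjUnion transducerB

/-- The alphabet `{a, b}`. -/
inductive Letter
  | a | b
  deriving DecidableEq

/-- The component of `transducerD` named by a letter. -/
def component : Letter → WangSet (StateA ⊕ StateB) (Fin 2)
  | .a => transducerA.rename Sum.inl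
  | .b => transducerB.rename Sum.inr

/-- The sequence of transducers `T_{u[1]}, …, T_{u[m]}` appears on consecutive rows, read upwards
(the output of a transducer is the input of the next one), of a tiling of the plane by `T_D`. -/
def AppearsInTiling (u : List Letter) : Prop :=
  ∃ f, transducerD.IsTiling f ∧
    ∃ y : ℤ, ∀ (i : ℕ) (hi : i < u.length), ∀ x : ℤ, f x (y + i) ∈ component u[i]

/-- There is a tiling of the plane by `T_D` whose row `y` is a run of `T_{w y}`,
for all `y`. -/
def RepresentsTiling (w : ℤ → Letter) : Prop :=
  ∃ f, transducerD.IsTiling f ∧ ∀ x y : ℤ, f x y ∈ component (w y)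

/-! ### Words -/

/-- The finite word `u` is a factor of the right-infinite word `s`. -/
def IsFactor (u : List Letter) (s : ℕ → Letter) : Prop :=
  ∃ k : ℕ, ∀ (i : ℕ) (hi : i < u.length), u[i] = s (k + i)

/-- The morphism `a ↦ ab`, `b ↦ a` on finite words. -/
def fibMorphism (u : List Letter) : List Letter :=
  u.flatMap fun | .a => [.a, .b] | .b => [.a]

/-- The Fibonacci word `abaababa…`: its `n`-th letter is that of the `n`-th iterate of the
morphism on `a`, which has more than `n` letters (see `lt_length_iterate_fibMorphism`), so that
the default value of `getD` is not used. -/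
def fibWord (n : ℕ) : Letter := (fibMorphism^[n] [Letter.a]).getD n Letter.a

/-- The prefix of length `n` of a right-infinite word. -/
def prefixOf (s : ℕ → Letter) (n : ℕ) : List Letter := (List.range n).map s

/-- `s` is a fixed point of the morphism: the image of every prefix of `s` is a prefix of `s`. -/
def IsFibFixedPoint (s : ℕ → Letter) : Prop :=
  ∀ n, fibMorphism (prefixOf s n) = prefixOf s (fibMorphism (prefixOf s n)).length

theorem fibMorphism_append (u v : List Letter) :
    fibMorphism (u ++ v) = fibMorphism u ++ fibMorphism v := by
  simp [fibMorphism]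

theorem fibMorphism_prefix {u v : List Letter} (h : u <+: v) :
    fibMorphism u <+: fibMorphism v := by
  obtain ⟨t, rfl⟩ := h
  rw [fibMorphism_append]
  exact List.prefix_append _ _

theorem iterate_fibMorphism_prefix_succ (n : ℕ) :
    fibMorphism^[n] [Letter.a] <+: fibMorphism^[n + 1] [Letter.a] := by
  induction n with
  | zero => exact ⟨[Letter.b], rfl⟩
  | succ n ih =>
    rw [Function.iterate_succ_apply', Function.iterate_succ_apply' _ (n + 1)]
    exact fibMorphism_prefix ih

theorem iterate_fibMorphism_prefix {m n : ℕ} (h : m ≤ n) :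
    fibMorphism^[m] [Letter.a] <+: fibMorphism^[n] [Letter.a] := by
  induction n, h using Nat.le_induction with
  | base => exact List.prefix_refl _
  | succ n _ ih => exact ih.trans (iterate_fibMorphism_prefix_succ n)

theorem iterate_fibMorphism_head (n : ℕ) :
    ∃ t, fibMorphism^[n] [Letter.a] = Letter.a :: t := by
  obtain ⟨t, ht⟩ := iterate_fibMorphism_prefix (Nat.zero_le n)
  exact ⟨t, ht.symm⟩

theorem length_le_fibMorphism (u : List Letter) : u.length ≤ (fibMorphism u).length := by
  induction u with
  | nil => simp
  | cons x u ih =>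
    have : fibMorphism (x :: u) = fibMorphism [x] ++ fibMorphism u := by
      rw [← fibMorphism_append]; rfl
    rw [this, List.length_append, List.length_cons]
    have : 1 ≤ (fibMorphism [x]).length := by cases x <;> decide
    omega

theorem lt_length_iterate_fibMorphism (n : ℕ) : n < (fibMorphism^[n] [Letter.a]).length := by
  induction n with
  | zero => simp
  | succ n ih =>
    obtain ⟨t, ht⟩ := iterate_fibMorphism_head n
    rw [Function.iterate_succ_apply', ht]
    rw [ht] at ih
    have h : fibMorphism (Letter.a :: t) = [.a, .b] ++ fibMorphism t := rfl
    have := length_le_fibMorphism t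
    rw [h]
    simp only [List.length_append, List.length_cons, List.length_nil] at *
    omega

/-- A finite word is a prefix of `s` as soon as its letters are those of `s`. -/
theorem eq_prefixOf_iff (u : List Letter) (s : ℕ → Letter) :
    u = prefixOf s u.length ↔ ∀ (i : ℕ) (hi : i < u.length), u[i] = s i := by
  constructor
  · intro h i hi
    have h2 : u[i]? = (prefixOf s u.length)[i]? := by rw [← h]
    simpa [prefixOf, hi] using h2
  · intro h
    apply List.ext_getElem
    · simp [prefixOf]
    · intro i h1 _
      simp [prefixOf, h i h1]

theorem eq_prefixOf_of_prefix {u v : List Letter} {s : ℕ → Letter}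
    (huv : u <+: v) (h : v = prefixOf s v.length) : u = prefixOf s u.length := by
  rw [eq_prefixOf_iff] at h ⊢
  intro i hi
  rw [← h i (lt_of_lt_of_le hi huv.length_le)]
  exact huv.getElem hi

theorem iterate_fibMorphism_eq_prefixOf (m : ℕ) :
    fibMorphism^[m] [Letter.a] = prefixOf fibWord (fibMorphism^[m] [Letter.a]).length := by
  rw [eq_prefixOf_iff]
  intro i hi
  have h1 := lt_length_iterate_fibMorphism i
  have e : fibWord i = (fibMorphism^[i] [Letter.a])[i] := by
    simp [fibWord, h1]
  rw [e]
  rcases le_total m i with h | h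
  · exact (iterate_fibMorphism_prefix h).getElem hi
  · exact ((iterate_fibMorphism_prefix h).getElem h1).symm

theorem prefixOf_prefix (s : ℕ → Letter) {m n : ℕ} (h : m ≤ n) :
    prefixOf s m <+: prefixOf s n := by
  obtain ⟨k, rfl⟩ := Nat.exists_eq_add_of_le h
  rw [prefixOf, prefixOf, List.range_add, List.map_append]
  exact List.prefix_append _ _

/-- The Fibonacci word is a fixed point of the morphism. -/
theorem isFibFixedPoint_fibWord : IsFibFixedPoint fibWord := by
  intro n
  have h : prefixOf fibWord n <+: fibMorphism^[n] [Letter.a] := by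
    rw [iterate_fibMorphism_eq_prefixOf n]
    exact prefixOf_prefix _ (lt_length_iterate_fibMorphism n).le
  have h2 := fibMorphism_prefix h
  rw [← Function.iterate_succ_apply' fibMorphism] at h2
  exact eq_prefixOf_of_prefix h2 (iterate_fibMorphism_eq_prefixOf (n + 1))

/-- The Fibonacci word is the only fixed point of the morphism. -/
theorem IsFibFixedPoint.eq_fibWord {s : ℕ → Letter} (hs : IsFibFixedPoint s) : s = fibWord := by
  have h0 : s 0 = Letter.a := by
    have h := (eq_prefixOf_iff _ _).1 (hs 1)
    have e : prefixOf s 1 = [s 0] := rfl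
    rw [e] at h
    have hx : ∀ x : Letter, (∀ (i : ℕ) (hi : i < (fibMorphism [x]).length),
        (fibMorphism [x])[i] = s i) → s 0 = Letter.a := by
      intro x hx
      cases x
      · exact (hx 0 (by decide)).symm
      · exact (hx 0 (by decide)).symm
    exact hx _ h
  have key : ∀ m, fibMorphism^[m] [Letter.a]
      = prefixOf s (fibMorphism^[m] [Letter.a]).length := by
    intro m
    induction m with
    | zero =>
      have e : prefixOf s 1 = [s 0] := rfl
      simp [e, h0]
    | succ m ih =>
      have := hs (fibMorphism^[m] [Letter.a]).length
      rw [← ih] at this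
      rwa [Function.iterate_succ_apply']
  funext i
  have h1 := lt_length_iterate_fibMorphism i
  rw [← (eq_prefixOf_iff _ _).1 (key i) i h1,
    ← (eq_prefixOf_iff _ _).1 (iterate_fibMorphism_eq_prefixOf i) i h1]

/-! ### Sturmian words -/

/-- The lower mechanical word of slope `α` and intercept `ρ`: its `n`-th letter is `a` if
`⌊α (n + 1) + ρ⌋ - ⌊α n + ρ⌋ = 1`, and `b` if it is `0` (no other value occurs if `0 ≤ α ≤ 1`).
Thus `α` is the frequency of the letter `a`. -/
noncomputable def lowerMechanical (α ρ : ℝ) (n : ℤ) : Letter :=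
  if ⌊α * (n + 1) + ρ⌋ - ⌊α * n + ρ⌋ = 1 then Letter.a else Letter.b

/-- The upper mechanical word of slope `α` and intercept `ρ`. -/
noncomputable def upperMechanical (α ρ : ℝ) (n : ℤ) : Letter :=
  if ⌈α * (n + 1) + ρ⌉ - ⌈α * n + ρ⌉ = 1 then Letter.a else Letter.b

/-- Bi-infinite Sturmian words of slope `α`. -/
def IsBiSturmian (α : ℝ) (w : ℤ → Letter) : Prop :=
  Irrational α ∧ 0 < α ∧ α < 1 ∧
    ∃ ρ : ℝ, (∀ n, w n = lowerMechanical α ρ n) ∨ (∀ n, w n = upperMechanical α ρ n)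

/-- Right-infinite Sturmian words of slope `α`. -/
def IsSturmian (α : ℝ) (s : ℕ → Letter) : Prop :=
  Irrational α ∧ 0 < α ∧ α < 1 ∧
    ∃ ρ : ℝ, (∀ n : ℕ, s n = lowerMechanical α ρ n) ∨ (∀ n : ℕ, s n = upperMechanical α ρ n)

/-! ### Marker runs

The composites of the transducers along the singular Fibonacci words all have the same shape: they
are described by bi-infinite concatenations of five kinds of blocks which carry typed points
(pairs `D` and triples `T` of equal letters) on the row that is read and on the row that is
written. -/

/-! Let `sing` be the singular Fibonacci words `b`, `aa`, `bab`, `aabaa`, …, with `sing (m + 3) =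
sing (m + 1) ++ sing m ++ sing (m + 1)`. The composite of the transducers along `sing m` has a
description that does not depend on `m` except through two lengths `L = fib (m + 5)` and `S = fib (m
+ 4)` and the parity of `m`: its rows are constant apart from isolated pairs and triples of the
other letter, and these pairs and triples are placed by a bi-infinite concatenation of five kinds of
blocks (`Run L S`).

The core is a renormalisation. If runs of scales `(L, S)`, `(S, L - S)`, `(L, S)` lie on top of each
other and `3/2 < L/S < 5/3`, then the blocks group uniquely into blocks of a run of scale `(2 * L +
S, L + S)` with the same outer rows (`Triple.comp`, `Triple.ins_comp`, `Triple.outs_comp`).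
Conversely every run of that scale splits into three (`Run.lower`, `Run.middle`, `Run.upper`). Two
such triples cannot share an outer run (`Triple.hi_ne_lo`). A reflection that exchanges the two rows
halves the case analysis.

The base is finite computation: `bb`, `aaa` and `babab` have no bi-infinite run, the composites `aa`
and `bab` are runs, and so is `b` when it lies between two `aa`. By induction the word of components
of any tiling is, for every `m`, a concatenation of `sing (m + 1)` alternating with `sing m` or
`sing (m + 2)` (`Level.succ`). So each of its factors lies in a singular word, hence in the
Fibonacci word. In the other direction `Run.chain` tiles a strip along every `sing m`, and
compactness gives a tiling for every bi-infinite word whose factors are Fibonacci factors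
(`exists_isStack`).

It remains to identify these bi-infinite words. The Fibonacci word is a mechanical word of slope
`1/φ` (`fibWord_eq`), its factors are those of all mechanical words of that slope by density of `ℤ +
ℤ/φ`, and balance of the factors makes a word mechanical (`exists_mechanical_of_balanced`).

For aperiodicity, a period that is not horizontal makes the word of components periodic, against the
irrational slope. A horizontal period leaves finitely many possible rows, so two rows agree, and
stacking copies of the strip between them gives a tiling with a periodic word of components. -/

/-- The five kinds of blocks of a run. -/
inductive Blk
  | outD | inD | outT | inT | both
  deriving DecidableEq

namespace Blk

/-- The length of a block. -/
def len (L S : ℤ) : Blk → ℤ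
  | outD => L
  | inD => L
  | outT => L + S
  | inT => L + S
  | both => 2 * L

/-- Exchange of the roles of the two rows. -/
def swap : Blk → Blk
  | outD => inD
  | inD => outD
  | outT => inT
  | inT => outT
  | both => both

@[simp] theorem swap_swap (b : Blk) : b.swap.swap = b := by cases b <;> rfl

@[simp] theorem len_swap (L S : ℤ) (b : Blk) : b.swap.len L S = b.len L S := by cases b <;> rfl

theorem swap_injective {b b' : Blk} (h : b.swap = b'.swap) : b = b' := by
  rw [← swap_swap b, h, swap_swap]

theorem len_pos {L S : ℤ} (hS : 0 < S) (hL : S < L) (b : Blk) : 0 < b.len L S := by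
  cases b <;> simp only [len] <;> omega

end Blk

/-- A set of typed points on a row. -/
@[ext]
structure Pts where
  /-- the positions of the pairs -/
  D : ℤ → Prop
  /-- the positions of the triples -/
  T : ℤ → Prop

/-- Translation of a set of points. -/
def Pts.shift (P : Pts) (k : ℤ) : Pts := ⟨fun t => P.D (t - k), fun t => P.T (t - k)⟩

/-- A bi-infinite concatenation of blocks; `At b c` says that a block `b` starts at `c`. -/
@[ext]
structure Run (L S : ℤ) where
  /-- a block of the given kind starts at the given position -/
  At : Blk → ℤ → Prop
  next : ∀ {b c}, At b c → ∃ b', At b' (c + b.len L S)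
  prev : ∀ {b c}, At b c → ∃ b', At b' (c - b'.len L S)
  disj : ∀ {b c b' c'}, At b c → At b' c' → c ≤ c' → c' < c + b.len L S → c' = c ∧ b' = b
  nonempty : ∃ b c, At b c

namespace Run

variable {L S : ℤ} (R : Run L S)

/-- The points on the row that is read. -/
def ins : Pts :=
  ⟨fun t => R.At .inD (t - L) ∨ R.At .both (t - (L + S)), fun t => R.At .inT (t - L)⟩

/-- The points on the row that is written. -/
def outs : Pts :=
  ⟨fun t => R.At .outD (t - S) ∨ R.At .both (t - L), fun t => R.At .outT (t - 2 * S)⟩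

variable {R}

theorem At.congr {b : Blk} {c c' : ℤ} (h : R.At b c) (e : c = c') : R.At b c' := e ▸ h

theorem At.trichotomy {b b' : Blk} {c c' : ℤ} (h : R.At b c) (h' : R.At b' c') :
    (c' = c ∧ b' = b) ∨ c + b.len L S ≤ c' ∨ c' + b'.len L S ≤ c := by
  rcases le_total c c' with hc | hc
  · rcases lt_or_ge c' (c + b.len L S) with hlt | hge
    · exact Or.inl (R.disj h h' hc hlt)
    · exact Or.inr (Or.inl hge)
  · rcases lt_or_ge c (c' + b'.len L S) with hlt | hge
    · obtain ⟨e1, e2⟩ := R.disj h' h hc hlt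
      exact Or.inl ⟨e1.symm, e2.symm⟩
    · exact Or.inr (Or.inr hge)

theorem At.clash {b b' : Blk} {c c' : ℤ} (h : R.At b c) (h' : R.At b' c') (hb : b' ≠ b)
    (h1 : c ≤ c') (h2 : c' < c + b.len L S) : False :=
  hb (R.disj h h' h1 h2).2

theorem At.next_cases {b : Blk} {c : ℤ} (h : R.At b c) :
    R.At .outD (c + b.len L S) ∨ R.At .inD (c + b.len L S) ∨ R.At .outT (c + b.len L S) ∨
      R.At .inT (c + b.len L S) ∨ R.At .both (c + b.len L S) := by
  obtain ⟨b', h'⟩ := R.next h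
  cases b' <;> simp [h']

theorem At.prev_cases {b : Blk} {c : ℤ} (h : R.At b c) :
    R.At .outD (c - L) ∨ R.At .inD (c - L) ∨ R.At .outT (c - (L + S)) ∨
      R.At .inT (c - (L + S)) ∨ R.At .both (c - 2 * L) := by
  obtain ⟨b', h'⟩ := R.prev h
  cases b' <;> simp only [Blk.len] at h' <;> simp [h']

/-- Every position is covered by a block. -/
theorem cover (R : Run L S) (hS : 0 < S) (hL : S < L) (t : ℤ) :
    ∃ b c, R.At b c ∧ c ≤ t ∧ t < c + b.len L S := by
  have fwd : ∀ n : ℕ, ∀ b c, R.At b c → c ≤ t → t - c ≤ n →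
      ∃ b c, R.At b c ∧ c ≤ t ∧ t < c + b.len L S := by
    intro n
    induction n with
    | zero =>
      intro b c h h1 h2
      have := b.len_pos hS hL
      exact ⟨b, c, h, h1, by push_cast at h2; omega⟩
    | succ n ih =>
      intro b c h h1 h2
      have := b.len_pos hS hL
      rcases lt_or_ge t (c + b.len L S) with h3 | h3
      · exact ⟨b, c, h, h1, h3⟩
      · obtain ⟨b', h'⟩ := R.next h
        exact ih b' _ h' h3 (by push_cast at h2; omega)
  have bwd : ∀ n : ℕ, ∀ b c, R.At b c → c - t ≤ n → ∃ b c, R.At b c ∧ c ≤ t := by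
    intro n
    induction n with
    | zero =>
      intro b c h h2
      exact ⟨b, c, h, by push_cast at h2; omega⟩
    | succ n ih =>
      intro b c h h2
      obtain ⟨b', h'⟩ := R.prev h
      have := b'.len_pos hS hL
      exact ih b' _ h' (by push_cast at h2; omega)
  obtain ⟨b, c, h⟩ := R.nonempty
  obtain ⟨b, c, h, hc⟩ := bwd (c - t).toNat b c h (by omega)
  exact fwd (t - c).toNat b c h hc (by omega)

/-- The distances between the starts of blocks. -/
theorem At.sep {b b' : Blk} {c c' : ℤ} (hS : 0 < S) (hL : S < L) (hL2 : L < 2 * S)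
    (h : R.At b c) (h' : R.At b' c') (hlt : c < c') :
    c' = c + b.len L S ∨ c' = c + b.len L S + L ∨ c' = c + b.len L S + (L + S) ∨
      c' = c + b.len L S + 2 * L ∨ c' = c + b.len L S + (2 * L + S) ∨
      c + b.len L S + 3 * L ≤ c' := by
  have hcut : ∀ {b c}, R.At b c → c < c' →
      ∃ b1 u, R.At b1 u ∧ u ≤ c' ∧ u = c + b.len L S := by
    intro b c h hlt
    rcases h.trichotomy h' with ⟨h1, -⟩ | h1 | h1
    · omega
    · obtain ⟨b1, h2⟩ := R.next h
      exact ⟨b1, _, h2, h1, rfl⟩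
    · have := b'.len_pos hS hL
      omega
  have hstep : ∀ {b c}, R.At b c → c < c' →
      ∃ b1 u, R.At b1 u ∧ u ≤ c' ∧ (u = c + L ∨ u = c + L + S ∨ u = c + 2 * L) := by
    intro b c h hlt
    obtain ⟨b1, u, h1, h2, h3⟩ := hcut h hlt
    refine ⟨b1, u, h1, h2, ?_⟩
    cases b <;> simp only [Blk.len] at h3 <;> omega
  obtain ⟨b1, u1, k1, l1, e1⟩ := hcut h hlt
  rcases eq_or_lt_of_le l1 with l1 | l1
  · omega
  obtain ⟨b2, u2, k2, l2, e2⟩ := hstep k1 l1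
  rcases eq_or_lt_of_le l2 with l2 | l2
  · omega
  obtain ⟨b3, u3, k3, l3, e3⟩ := hstep k2 l2
  -- Two blocks of length `L + S` already fall in the last case: `L < 2 * S` gives `3 * L < 2 * (L +
  -- S)`.
  rcases eq_or_lt_of_le l3 with l3 | l3
  · omega
  obtain ⟨b4, u4, k4, l4, e4⟩ := hstep k3 l3
  omega

/-- Translation of a run. -/
def shift (R : Run L S) (k : ℤ) : Run L S where
  At b c := R.At b (c - k)
  next {b c} h := by
    obtain ⟨b', h'⟩ := R.next h
    exact ⟨b', h'.congr (by ring)⟩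
  prev {b c} h := by
    obtain ⟨b', h'⟩ := R.prev h
    exact ⟨b', h'.congr (by ring)⟩
  disj {b c b' c'} h h' h1 h2 := by
    have := R.disj h h' (by omega) (by omega)
    exact ⟨by omega, this.2⟩
  nonempty := by
    obtain ⟨b, c, h⟩ := R.nonempty
    exact ⟨b, c + k, h.congr (by ring)⟩

theorem ins_shift (R : Run L S) (k : ℤ) : (R.shift k).ins = R.ins.shift k := by
  simp only [ins, shift, Pts.shift, sub_right_comm]

theorem outs_shift (R : Run L S) (k : ℤ) : (R.shift k).outs = R.outs.shift k := by
  simp only [outs, shift, Pts.shift, sub_right_comm]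

/-- The mirror image of a run, with the two rows exchanged. -/
def rev (R : Run L S) (hS : 0 < S) (hL : S < L) (k : ℤ) : Run L S where
  At b t := R.At b.swap (k - t - b.len L S)
  next {b c} h := by
    obtain ⟨b', h'⟩ := R.prev h
    refine ⟨b'.swap, ?_⟩
    rw [Blk.swap_swap, Blk.len_swap]
    exact h'.congr (by ring)
  prev {b c} h := by
    obtain ⟨b', h'⟩ := R.next h
    refine ⟨b'.swap, ?_⟩
    rw [Blk.swap_swap, Blk.len_swap]
    refine h'.congr ?_
    rw [Blk.len_swap]
    ring
  disj {b c b' c'} h h' h1 h2 := by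
    have e1 := b.len_pos hS hL
    have e2 := b'.len_pos hS hL
    rcases h.trichotomy h' with h3 | h3 | h3
    · have h4 := Blk.swap_injective h3.2
      refine ⟨?_, h4⟩
      have := h3.1
      rw [h4] at this
      omega
    · rw [Blk.len_swap] at h3
      omega
    · rw [Blk.len_swap] at h3
      omega
  nonempty := by
    obtain ⟨b, c, h⟩ := R.nonempty
    refine ⟨b.swap, k - c - b.len L S, ?_⟩
    rw [Blk.swap_swap, Blk.len_swap]
    exact h.congr (by ring)

/-- In every kind of block, the offset of the written point plus the offset of the read point in the
swapped block is the length of the block plus `S`. Hence one reflection, `t ↦ S + k - t`, serves all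
kinds at once. -/
theorem ins_rev (R : Run L S) (hS : 0 < S) (hL : S < L) (k : ℤ) :
    (R.rev hS hL k).ins = ⟨fun t => R.outs.D (S + k - t), fun t => R.outs.T (S + k - t)⟩ := by
  have e1 : ∀ t, k - (t - L) - L = S + k - t - S := by intro t; ring
  have e2 : ∀ t, k - (t - (L + S)) - 2 * L = S + k - t - L := by intro t; ring
  have e3 : ∀ t, k - (t - L) - (L + S) = S + k - t - 2 * S := by intro t; ring
  simp only [ins, outs, rev, Blk.swap, Blk.len, e1, e2, e3]

theorem outs_rev (R : Run L S) (hS : 0 < S) (hL : S < L) (k : ℤ) :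
    (R.rev hS hL k).outs = ⟨fun t => R.ins.D (S + k - t), fun t => R.ins.T (S + k - t)⟩ := by
  have e1 : ∀ t, k - (t - S) - L = S + k - t - L := by intro t; ring
  have e2 : ∀ t, k - (t - L) - 2 * L = S + k - t - (L + S) := by intro t; ring
  have e3 : ∀ t, k - (t - 2 * S) - (L + S) = S + k - t - L := by intro t; ring
  simp only [ins, outs, rev, Blk.swap, Blk.len, e1, e2, e3]

/-! ### Words of blocks -/

end Run

/-- The length of a word of blocks. -/
def wordLen (L S : ℤ) : List Blk → ℤ
  | [] => 0
  | b :: w => b.len L S + wordLen L S w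

/-- The block `x` occurs in a word of blocks at distance `d` from its beginning. -/
def Occ (L S : ℤ) (x : Blk) : List Blk → ℤ → Prop
  | [], _ => False
  | y :: w, d => (y = x ∧ d = 0) ∨ Occ L S x w (d - y.len L S)

namespace Occ

variable {L S : ℤ}

theorem bounds (hS : 0 < S) (hL : S < L) {x : Blk} {w : List Blk} {d : ℤ} (h : Occ L S x w d) :
    0 ≤ d ∧ d + x.len L S ≤ wordLen L S w := by
  have wl : ∀ w, 0 ≤ wordLen L S w := by
    intro w
    induction w with
    | nil => exact le_rfl
    | cons b w ih =>
      have := b.len_pos hS hL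
      simp only [wordLen]
      omega
  induction w generalizing d with
  | nil => exact h.elim
  | cons y w ih =>
    have := y.len_pos hS hL
    have := wl w
    simp only [wordLen]
    rcases h with ⟨rfl, rfl⟩ | h
    · omega
    · have := ih h
      omega

theorem next {x : Blk} {w : List Blk} {d : ℤ} (h : Occ L S x w d) :
    (∃ y, Occ L S y w (d + x.len L S)) ∨ d + x.len L S = wordLen L S w := by
  induction w generalizing d with
  | nil => exact h.elim
  | cons y w ih =>
    rcases h with ⟨rfl, rfl⟩ | h
    · cases w with
      | nil => right; simp [wordLen]
      | cons z w =>
        left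
        exact ⟨z, Or.inr (Or.inl ⟨rfl, by ring⟩)⟩
    · rcases ih h with ⟨z, hz⟩ | h1
      · left
        refine ⟨z, Or.inr ?_⟩
        convert hz using 1
        ring
      · right
        simp only [wordLen]
        omega

theorem prev {x : Blk} {w : List Blk} {d : ℤ} (h : Occ L S x w d) :
    (∃ y, Occ L S y w (d - y.len L S)) ∨ d = 0 := by
  induction w generalizing d with
  | nil => exact h.elim
  | cons y w ih =>
    rcases h with ⟨rfl, rfl⟩ | h
    · exact Or.inr rfl
    · left
      rcases ih h with ⟨z, hz⟩ | h1
      · refine ⟨z, Or.inr ?_⟩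
        convert hz using 1
        ring
      · exact ⟨y, Or.inl ⟨rfl, h1⟩⟩

theorem last {w : List Blk} (hw : w ≠ []) : ∃ y, Occ L S y w (wordLen L S w - y.len L S) := by
  induction w with
  | nil => exact (hw rfl).elim
  | cons y w ih =>
    cases w with
    | nil => exact ⟨y, Or.inl ⟨rfl, by simp [wordLen]⟩⟩
    | cons z w =>
      obtain ⟨t, ht⟩ := ih (by simp)
      refine ⟨t, Or.inr ?_⟩
      convert ht using 1
      simp only [wordLen]
      ring

theorem disj (hS : 0 < S) (hL : S < L) {x y : Blk} {w : List Blk} {d e : ℤ} (h : Occ L S x w d)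
    (h' : Occ L S y w e) (h1 : d ≤ e) (h2 : e < d + x.len L S) : e = d ∧ y = x := by
  induction w generalizing d e with
  | nil => exact h.elim
  | cons z w ih =>
    have hz := z.len_pos hS hL
    rcases h with ⟨rfl, rfl⟩ | h <;> rcases h' with ⟨rfl, rfl⟩ | h'
    · exact ⟨rfl, rfl⟩
    · have := (h'.bounds hS hL).1
      omega
    · have := (h.bounds hS hL).1
      omega
    · have := ih h h' (by omega) (by omega)
      exact ⟨by omega, this.2⟩

end Occ

namespace Run

variable {L S L' S' : ℤ}

/-- The word `w` of blocks starts at position `c` of a run. -/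
def Word (R : Run L S) : List Blk → ℤ → Prop
  | [], _ => True
  | b :: w, c => R.At b c ∧ R.Word w (c + b.len L S)

/-- The positions of the blocks obtained by substituting words for the blocks of a run. -/
def SubAt (R' : Run L' S') (L S : ℤ) (σ : Blk → List Blk) (o : ℤ) (x : Blk) (p : ℤ) : Prop :=
  ∃ b c, R'.At b c ∧ Occ L S x (σ b) (p - c - o)

/-- The run obtained by substituting words for the blocks of a run. -/
def sub (R' : Run L' S') (hS : 0 < S) (hL : S < L) (σ : Blk → List Blk) (o : ℤ)
    (hσ : ∀ b, wordLen L S (σ b) = b.len L' S') (hne : ∀ b, σ b ≠ []) : Run L S where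
  At := R'.SubAt L S σ o
  next := by
    rintro x p ⟨b, c, h, h1⟩
    rcases h1.next with ⟨y, hy⟩ | h2
    · exact ⟨y, b, c, h, by convert hy using 1; ring⟩
    · obtain ⟨b', h'⟩ := R'.next h
      cases e : σ b' with
      | nil => exact (hne b' e).elim
      | cons z w =>
        refine ⟨z, b', _, h', ?_⟩
        rw [e]
        refine Or.inl ⟨rfl, ?_⟩
        rw [← hσ b]
        omega
  prev := by
    rintro x p ⟨b, c, h, h1⟩
    rcases h1.prev with ⟨y, hy⟩ | h2
    · exact ⟨y, b, c, h, by convert hy using 1; ring⟩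
    · obtain ⟨b', h'⟩ := R'.prev h
      obtain ⟨y, hy⟩ := Occ.last (L := L) (S := S) (hne b')
      refine ⟨y, b', _, h', ?_⟩
      convert hy using 1
      rw [hσ b']
      omega
  disj := by
    rintro x p x' p' ⟨b, c, h, h1⟩ ⟨b', c', h', h1'⟩ hp hp'
    have e := h1.bounds hS hL
    have e' := h1'.bounds hS hL
    have hx := x.len_pos hS hL
    have hx' := x'.len_pos hS hL
    rw [hσ] at e e'
    rcases h.trichotomy h' with ⟨rfl, rfl⟩ | h2 | h2
    · have := h1.disj hS hL h1' (by omega) (by omega)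
      exact ⟨by omega, this.2⟩
    · omega
    · omega
  nonempty := by
    obtain ⟨b, c, h⟩ := R'.nonempty
    obtain ⟨y, hy⟩ := Occ.last (L := L) (S := S) (hne b)
    refine ⟨y, c + o + (wordLen L S (σ b) - y.len L S), b, c, h, ?_⟩
    convert hy using 1
    ring

theorem Word.at_of_occ {R : Run L S} {x : Blk} {w : List Blk} {c d : ℤ} (h : R.Word w c)
    (hx : Occ L S x w d) : R.At x (c + d) := by
  induction w generalizing c d with
  | nil => exact hx.elim
  | cons y w ih =>
    rcases hx with ⟨rfl, rfl⟩ | hx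
    · exact h.1.congr (by ring)
    · exact (ih h.2 hx).congr (by ring)

theorem Word.occ_of_mem {R : Run L S} {x : Blk} {w : List Blk} {c p : ℤ} (h : R.Word w c)
    (hx : R.At x p) (h1 : c ≤ p) (h2 : p < c + wordLen L S w) : Occ L S x w (p - c) := by
  induction w generalizing c with
  | nil => simp only [wordLen] at h2; omega
  | cons y w ih =>
    rcases lt_or_ge p (c + y.len L S) with h3 | h3
    · obtain ⟨rfl, rfl⟩ := R.disj h.1 hx h1 h3
      exact Or.inl ⟨rfl, by ring⟩
    · refine Or.inr ?_
      have := ih h.2 h3 (by simp only [wordLen] at h2; omega)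
      convert this using 1
      ring

/-- A run that contains the images of the blocks of `R'` is the substituted run. -/
theorem at_iff_subAt {R : Run L S} {R' : Run L' S'} (hS' : 0 < S') (hL' : S' < L')
    {σ : Blk → List Blk} {o : ℤ} (hσ : ∀ b, wordLen L S (σ b) = b.len L' S')
    (h : ∀ b c, R'.At b c → R.Word (σ b) (c + o)) (x : Blk) (p : ℤ) :
    R.At x p ↔ R'.SubAt L S σ o x p := by
  constructor
  · intro hx
    obtain ⟨b, c, hb, h1, h2⟩ := R'.cover hS' hL' (p - o)
    refine ⟨b, c, hb, ?_⟩
    have := (h b c hb).occ_of_mem hx (by omega) (by rw [hσ]; omega)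
    convert this using 1
    ring
  · rintro ⟨b, c, hb, h1⟩
    exact ((h b c hb).at_of_occ h1).congr (by ring)

end Run

/-! ### Composition of three runs -/

/-- Three runs on top of each other, whose scales are consecutive. -/
structure Triple (L S : ℤ) where
  /-- the lower run -/
  lo : Run L S
  /-- the run in the middle -/
  mid : Run S (L - S)
  /-- the upper run -/
  hi : Run L S
  lo_mid : lo.outs = mid.ins
  mid_hi : mid.outs = hi.ins
  ratio₁ : 3 * S < 2 * L
  ratio₂ : 3 * L < 5 * S

namespace Triple

variable {L S : ℤ} (T : Triple L S)

/-- The mirror image of a triple. -/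
def rev : Triple L S where
  lo := T.hi.rev (by have := T.ratio₁; have := T.ratio₂; omega)
    -- With this constant the middle run, whose small scale is `L - S`, is reflected by `t ↦ S - t`,
    -- as the two outer runs are.
    (by have := T.ratio₁; have := T.ratio₂; omega) 0
  mid := T.mid.rev (by have := T.ratio₁; have := T.ratio₂; omega)
    (by have := T.ratio₁; have := T.ratio₂; omega) (2 * S - L)
  hi := T.lo.rev (by have := T.ratio₁; have := T.ratio₂; omega)
    (by have := T.ratio₁; have := T.ratio₂; omega) 0
  lo_mid := by
    rw [Run.outs_rev, Run.ins_rev, T.mid_hi]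
    have e : ∀ t : ℤ, L - S + (2 * S - L) - t = S + 0 - t := by intro t; ring
    simp only [e]
  mid_hi := by
    rw [Run.outs_rev, Run.ins_rev, T.lo_mid]
    have e : ∀ t : ℤ, L - S + (2 * S - L) - t = S + 0 - t := by intro t; ring
    simp only [e]
  ratio₁ := T.ratio₁
  ratio₂ := T.ratio₂

variable {T}

/-- The arithmetic core of the composition: each forbidden configuration below yields a distance in
the lower run that the bounds on `L / S` keep out of this list. -/
theorem far {b b' : Blk} {c c' : ℤ} (h : T.lo.At b c) (h' : T.lo.At b' c') :
    (c' = c ∧ b' = b) ∨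
    (c' = c + b.len L S ∨ c' = c + b.len L S + L ∨ c' = c + b.len L S + (L + S) ∨
      c' = c + b.len L S + 2 * L ∨ c' = c + b.len L S + (2 * L + S) ∨
      c + b.len L S + 3 * L ≤ c') ∨
    (c = c' + b'.len L S ∨ c = c' + b'.len L S + L ∨ c = c' + b'.len L S + (L + S) ∨
      c = c' + b'.len L S + 2 * L ∨ c = c' + b'.len L S + (2 * L + S) ∨
      c' + b'.len L S + 3 * L ≤ c) := by
  have := T.ratio₁
  have := T.ratio₂
  have hb := b.len_pos (L := L) (S := S) (by omega) (by omega)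
  have hb' := b'.len_pos (L := L) (S := S) (by omega) (by omega)
  rcases h.trichotomy h' with h1 | h1 | h1
  · exact Or.inl h1
  · exact Or.inr (Or.inl (h.sep (by omega) (by omega) (by omega) h' (by omega)))
  · exact Or.inr (Or.inr (h'.sep (by omega) (by omega) (by omega) h (by omega)))

/-- The shared row is looked at from both sides: a point read by the middle run is written by a
block of the lower run, and conversely. This lemma and the five after it are the dictionary between
the two runs. -/
theorem lo_of_inD {c : ℤ} (h : T.mid.At .inD c) : T.lo.At .outD c ∨ T.lo.At .both (c + S - L) := by
  have h1 : T.lo.outs.D (c + S) := by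
    rw [T.lo_mid]
    exact Or.inl (h.congr (by ring))
  exact h1.imp (fun h => h.congr (by ring)) (fun h => h.congr (by ring))

theorem lo_of_both {c : ℤ} (h : T.mid.At .both c) :
    T.lo.At .outD (c + L - S) ∨ T.lo.At .both c := by
  have h1 : T.lo.outs.D (c + L) := by
    rw [T.lo_mid]
    exact Or.inr (h.congr (by ring))
  exact h1.imp (fun h => h.congr (by ring)) (fun h => h.congr (by ring))

theorem lo_of_inT {c : ℤ} (h : T.mid.At .inT c) : T.lo.At .outT (c - S) := by
  have h1 : T.lo.outs.T (c + S) := by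
    rw [T.lo_mid]
    exact h.congr (by ring)
  exact Run.At.congr h1 (by ring)

theorem mid_of_outD {c : ℤ} (h : T.lo.At .outD c) :
    T.mid.At .inD c ∨ T.mid.At .both (c + S - L) := by
  have h1 : T.mid.ins.D (c + S) := by
    rw [← T.lo_mid]
    exact Or.inl (h.congr (by ring))
  exact h1.imp (fun h => h.congr (by ring)) (fun h => h.congr (by ring))

theorem mid_of_both {c : ℤ} (h : T.lo.At .both c) :
    T.mid.At .inD (c + L - S) ∨ T.mid.At .both c := by
  have h1 : T.mid.ins.D (c + L) := by
    rw [← T.lo_mid]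
    exact Or.inr (h.congr (by ring))
  exact h1.imp (fun h => h.congr (by ring)) (fun h => h.congr (by ring))

theorem mid_of_outT {c : ℤ} (h : T.lo.At .outT c) : T.mid.At .inT (c + S) := by
  have h1 : T.mid.ins.T (c + 2 * S) := by
    rw [← T.lo_mid]
    exact h.congr (by ring)
  exact Run.At.congr h1 (by ring)

/-- The two points would be at distance `S`, while pairs written by the lower run are at distance at
least `L`. The next two lemmas hold for the same kind of reason. -/
theorem not_inD_inD {c : ℤ} (h : T.mid.At .inD c) (h' : T.mid.At .inD (c + S)) : False := by
  have := T.ratio₁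
  have := T.ratio₂
  rcases lo_of_inD h with a | a <;> rcases lo_of_inD h' with b | b <;>
  · have s := far a b
    simp only [Blk.len, reduceCtorEq, and_false, and_true, false_or] at s
    omega

theorem not_inD_inT {c : ℤ} (h : T.mid.At .inD c) (h' : T.mid.At .inT (c + S)) : False := by
  have := T.ratio₁
  have := T.ratio₂
  have b := lo_of_inT h'
  rcases lo_of_inD h with a | a <;>
  · have s := far a b
    simp only [Blk.len, reduceCtorEq, and_false, false_or] at s
    omega

theorem not_inT_inT {c : ℤ} (h : T.mid.At .inT c) (h' : T.mid.At .inT (c + L)) : False := by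
  have := T.ratio₁
  have := T.ratio₂
  have s := far (lo_of_inT h) (lo_of_inT h')
  simp only [Blk.len, and_true] at s
  omega

/-- Mirror image of `not_inD_inD`: what the lower row forbids for reading blocks, the upper row
forbids for writing blocks in the opposite order. -/
theorem not_outD_outD {c : ℤ} (h : T.mid.At .outD c) (h' : T.mid.At .outD (c + S)) : False :=
  T.rev.not_inD_inD (c := S - L - c - S)
    (h'.congr (by simp only [Blk.len]; ring)) (h.congr (by simp only [Blk.len]; ring))

theorem not_outT_outD {c : ℤ} (h : T.mid.At .outT c) (h' : T.mid.At .outD (c + L)) : False :=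
  T.rev.not_inD_inT (c := 2 * S - L - c - L - S)
    (h'.congr (by simp only [Blk.len]; ring)) (h.congr (by simp only [Blk.len]; ring))

theorem not_outT_outT {c : ℤ} (h : T.mid.At .outT c) (h' : T.mid.At .outT (c + L)) : False :=
  T.rev.not_inT_inT (c := 2 * S - L - c - L - L)
    (h'.congr (by simp only [Blk.len]; ring)) (h.congr (by simp only [Blk.len]; ring))

/-- A block of the middle run with a point on the lower row starts at `c`. -/
def InAt (T : Triple L S) (c : ℤ) : Prop :=
  T.mid.At .inD c ∨ T.mid.At .inT c ∨ T.mid.At .both c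

/-- The three exclusions for `outD` and `outT` allow at most two consecutive blocks that only write,
and then `outD` comes before `outT`. So the gap before the next reading block is `0`, `S`, `L` or `S
+ L`. -/
theorem next_inAt {b : Blk} {c c' : ℤ} (h : T.mid.At b c) (e : c' = c + b.len S (L - S)) :
    T.InAt c' ∨ (T.mid.At .outD c' ∧ T.InAt (c' + S)) ∨ (T.mid.At .outT c' ∧ T.InAt (c' + L)) ∨
      (T.mid.At .outD c' ∧ T.mid.At .outT (c' + S) ∧ T.InAt (c' + S + L)) := by
  subst e
  generalize hc : c + b.len S (L - S) = c'
  have key := h.next_cases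
  rw [hc] at key
  have hT : ∀ {u}, T.mid.At .outT u → T.InAt (u + L) := by
    intro u hu
    have e : u + Blk.outT.len S (L - S) = u + L := by simp only [Blk.len]; ring
    rcases hu.next_cases with k | k | k | k | k <;> rw [e] at k
    · exact (not_outT_outD hu k).elim
    · exact Or.inl k
    · exact (not_outT_outT hu k).elim
    · exact Or.inr (Or.inl k)
    · exact Or.inr (Or.inr k)
  rcases key with k | k | k | k | k
  · rcases k.next_cases with k2 | k2 | k2 | k2 | k2 <;> simp only [Blk.len] at k2
    · exact (not_outD_outD k k2).elim
    · exact Or.inr (Or.inl ⟨k, Or.inl k2⟩)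
    · exact Or.inr (Or.inr (Or.inr ⟨k, k2, hT k2⟩))
    · exact Or.inr (Or.inl ⟨k, Or.inr (Or.inl k2)⟩)
    · exact Or.inr (Or.inl ⟨k, Or.inr (Or.inr k2)⟩)
  · exact Or.inl (Or.inl k)
  · exact Or.inr (Or.inr (Or.inl ⟨k, hT k⟩))
  · exact Or.inl (Or.inr (Or.inl k))
  · exact Or.inl (Or.inr (Or.inr k))

theorem prev_inAt {b : Blk} {c : ℤ} (h : T.mid.At b c) :
    ∃ u, (T.mid.At .inD (u - S) ∨ T.mid.At .inT (u - L) ∨ T.mid.At .both (u - 2 * S)) ∧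
      (c = u ∨ c = u + S ∨ c = u + L ∨ c = u + L + S) := by
  have e1 : S + (L - S) = L := by ring
  have hD : ∀ {u}, T.mid.At .outD u →
      (T.mid.At .inD (u - S) ∨ T.mid.At .inT (u - L) ∨ T.mid.At .both (u - 2 * S)) := by
    intro u hu
    rcases hu.prev_cases with k | k | k | k | k <;> (try rw [e1] at k)
    · exact (not_outD_outD k (hu.congr (by ring))).elim
    · exact Or.inl k
    · exact (not_outT_outD k (hu.congr (by ring))).elim
    · exact Or.inr (Or.inl k)
    · exact Or.inr (Or.inr k)
  rcases h.prev_cases with k | k | k | k | k <;> (try rw [e1] at k)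
  · exact ⟨c - S, hD k, by omega⟩
  · exact ⟨c, Or.inl k, by omega⟩
  · rcases k.prev_cases with k2 | k2 | k2 | k2 | k2 <;> (try rw [e1] at k2)
    · exact ⟨c - L - S, hD k2, by omega⟩
    · exact ⟨c - L, Or.inl k2, by omega⟩
    · exact (not_outT_outT k2 (k.congr (by ring))).elim
    · exact ⟨c - L, Or.inr (Or.inl k2), by omega⟩
    · exact ⟨c - L, Or.inr (Or.inr k2), by omega⟩
  · exact ⟨c, Or.inr (Or.inl k), by omega⟩
  · exact ⟨c, Or.inr (Or.inr k), by omega⟩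

/-- The next point read by the middle run would be at a distance from the point of `both` that no
two blocks of the lower run realise when `3/2 < L/S < 5/3`. -/
theorem mid_not_both {c : ℤ} (h : T.mid.At .both c) : False := by
  have := T.ratio₁
  have := T.ratio₂
  have key : ∀ u, T.InAt u →
      u = c + 2 * S ∨ u = c + 2 * S + S ∨ u = c + 2 * S + L ∨ u = c + 2 * S + S + L → False := by
    intro u hu hcu
    rcases hu with hu | hu | hu
    · rcases lo_of_both h with a | a <;> rcases lo_of_inD hu with b | b <;>
      · have s := far a b
        simp only [Blk.len, reduceCtorEq, and_false, and_true, false_or] at s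
        omega
    · have b := lo_of_inT hu
      rcases lo_of_both h with a | a <;>
      · have s := far a b
        simp only [Blk.len, reduceCtorEq, and_false, false_or] at s
        omega
    · rcases lo_of_both h with a | a <;> rcases lo_of_both hu with b | b <;>
      · have s := far a b
        simp only [Blk.len, reduceCtorEq, and_false, and_true, false_or] at s
        omega
  rcases next_inAt h rfl with k | ⟨-, k⟩ | ⟨-, k⟩ | ⟨-, -, k⟩ <;> simp only [Blk.len] at k
  · exact key _ k (by omega)
  · exact key _ k (by omega)
  · exact key _ k (by omega)
  · exact key _ k (by omega)

/-- The alternative, a lower `both`, is at an impossible distance from the lower block that belongs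
to the previous reading block. -/
theorem lo_outD_of_inD {c : ℤ} (h : T.mid.At .inD c) : T.lo.At .outD c := by
  have := T.ratio₁
  have := T.ratio₂
  rcases lo_of_inD h with k | k
  · exact k
  exfalso
  obtain ⟨u, hu, hc⟩ := prev_inAt h
  rcases hu with hu | hu | hu
  · rcases lo_of_inD hu with a | a <;>
    · have s := far a k
      simp only [Blk.len, reduceCtorEq, and_false, and_true, false_or] at s
      omega
  · have s := far (lo_of_inT hu) k
    simp only [Blk.len, reduceCtorEq, and_false, false_or] at s
    omega
  · exact mid_not_both hu

/-- Its written point would be read by a middle `inD`, and this requires a lower `outD` starting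
inside the very same `both`. -/
theorem lo_not_both {c : ℤ} (h : T.lo.At .both c) : False := by
  have := T.ratio₁
  have := T.ratio₂
  rcases mid_of_both h with k | k
  · have s := far h (lo_outD_of_inD k)
    simp only [Blk.len, reduceCtorEq, and_false, false_or] at s
    omega
  · exact mid_not_both k

/-- Of the four gaps in `next_inAt`, only `L` is compatible with the distances in the lower run, and
only with a triple as the next point. -/
theorem after_inD {c : ℤ} (h : T.mid.At .inD c) :
    T.mid.At .outT (c + S) ∧ T.mid.At .inT (c + S + L) := by
  have := T.ratio₁
  have := T.ratio₂
  have a := lo_outD_of_inD h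
  have key : ∀ u, T.InAt u → u = c + S ∨ u = c + S + S ∨ u = c + S + L ∨ u = c + S + S + L →
      u = c + S + L ∧ T.mid.At .inT u := by
    intro u hu hcu
    rcases hu with hu | hu | hu
    · have s := far a (lo_outD_of_inD hu)
      simp only [Blk.len, and_true] at s
      omega
    · refine ⟨?_, hu⟩
      have s := far a (lo_of_inT hu)
      simp only [Blk.len, reduceCtorEq, and_false, false_or] at s
      omega
    · exact (mid_not_both hu).elim
  rcases next_inAt h rfl with k | ⟨-, k⟩ | ⟨k0, k⟩ | ⟨-, -, k⟩ <;> simp only [Blk.len] at k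
  · obtain ⟨h1, -⟩ := key _ k (by omega)
    omega
  · obtain ⟨h1, -⟩ := key _ k (by omega)
    omega
  · exact ⟨k0, (key _ k (by omega)).2⟩
  · obtain ⟨h1, -⟩ := key _ k (by omega)
    omega

/-- The gap to the next reading block decides its kind: gaps `0` and `L` force `inD`, gap `S` forces
`inT`, and only gap `S + L` leaves both. These branches are the source of the five composed blocks.
-/
theorem after_inT {c : ℤ} (h : T.mid.At .inT c) :
    T.mid.At .inD (c + L) ∨
    (T.mid.At .outT (c + L) ∧ T.mid.At .inD (c + L + L)) ∨
    (T.mid.At .outD (c + L) ∧ T.mid.At .outT (c + L + S) ∧ T.mid.At .inD (c + L + S + L)) ∨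
    (T.mid.At .outD (c + L) ∧ T.mid.At .inT (c + L + S)) ∨
    (T.mid.At .outD (c + L) ∧ T.mid.At .outT (c + L + S) ∧ T.mid.At .inT (c + L + S + L)) := by
  have := T.ratio₁
  have := T.ratio₂
  have a := lo_of_inT h
  have key : ∀ u, T.InAt u → u = c + L ∨ u = c + L + S ∨ u = c + L + L ∨ u = c + L + S + L →
      (T.mid.At .inD u ∧ u ≠ c + L + S) ∨
        (T.mid.At .inT u ∧ (u = c + L + S ∨ u = c + L + S + L)) := by
    intro u hu hcu
    rcases hu with hu | hu | hu
    · refine Or.inl ⟨hu, ?_⟩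
      have s := far a (lo_outD_of_inD hu)
      simp only [Blk.len, reduceCtorEq, and_false, false_or] at s
      omega
    · refine Or.inr ⟨hu, ?_⟩
      have s := far a (lo_of_inT hu)
      simp only [Blk.len, and_true] at s
      omega
    · exact (mid_not_both hu).elim
  have e : c + Blk.inT.len S (L - S) = c + L := by simp only [Blk.len]; ring
  rcases next_inAt h rfl with k | ⟨k0, k⟩ | ⟨k0, k⟩ | ⟨k0, k1, k⟩ <;> rw [e] at k <;>
    (try rw [e] at k0) <;> (try rw [e] at k1)
  · rcases key _ k (by omega) with ⟨k2, -⟩ | ⟨-, k3⟩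
    · exact Or.inl k2
    · omega
  · rcases key _ k (by omega) with ⟨-, k3⟩ | ⟨k2, -⟩
    · omega
    · exact Or.inr (Or.inr (Or.inr (Or.inl ⟨k0, k2⟩)))
  · rcases key _ k (by omega) with ⟨k2, -⟩ | ⟨-, k3⟩
    · exact Or.inr (Or.inl ⟨k0, k2⟩)
    · omega
  · rcases key _ k (by omega) with ⟨k2, -⟩ | ⟨k2, -⟩
    · exact Or.inr (Or.inr (Or.inl ⟨k0, k1, k2⟩))
    · exact Or.inr (Or.inr (Or.inr (Or.inr ⟨k0, k1, k2⟩)))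

theorem before_outD {c : ℤ} (h : T.mid.At .outD c) :
    T.mid.At .inT (c - L) ∧ T.mid.At .outT (c - L - L) := by
  have h' : T.rev.mid.At .inD (2 * S - L - c - S) := h.congr (by simp only [Blk.len]; ring)
  obtain ⟨h1, h2⟩ := T.rev.after_inD h'
  exact ⟨Run.At.congr h1 (by simp only [Blk.len]; ring),
    Run.At.congr h2 (by simp only [Blk.len]; ring)⟩

/-- What may precede a block `outT`. -/
theorem before_outT {c : ℤ} (h : T.mid.At .outT c) :
    T.mid.At .outD (c - S) ∨
    (T.mid.At .inT (c - L) ∧ T.mid.At .outD (c - L - S)) ∨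
    T.mid.At .inD (c - S) := by
  have h' : T.rev.mid.At .inT (2 * S - L - c - L) := h.congr (by simp only [Blk.len]; ring)
  rcases T.rev.after_inT h' with k | ⟨k1, k2⟩ | ⟨k1, -⟩ | ⟨k1, -⟩ | ⟨k1, -⟩
  · exact Or.inl (Run.At.congr k (by simp only [Blk.len]; ring))
  · exact Or.inr (Or.inl ⟨Run.At.congr k1 (by simp only [Blk.len]; ring),
      Run.At.congr k2 (by simp only [Blk.len]; ring)⟩)
  all_goals exact Or.inr (Or.inr (Run.At.congr k1 (by simp only [Blk.len]; ring)))

end Triple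

/-! ### Recognition of the composed blocks -/

/-- The words of the lower run which replace the blocks of a composed run. -/
def loWord : Blk → List Blk
  | .outD => [.outT, .outD]
  | .inD => [.outT, .inD]
  | .outT => [.outT, .outT, .outD]
  | .inT => [.outT, .inT, .outD]
  | .both => [.outT, .outT, .inD, .outD]

/-- The words of the middle run which replace the blocks of a composed run. -/
def midWord : Blk → List Blk
  | .outD => [.outT, .inT, .inD]
  | .inD => [.outT, .inT, .outD]
  | .outT => [.outT, .inT, .outD, .inT, .inD]
  | .inT => [.outT, .inT, .outD, .outT, .inD]
  | .both => [.outT, .inT, .outD, .inT, .outT, .inD]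

/-- The words of the upper run which replace the blocks of a composed run. -/
def hiWord : Blk → List Blk
  | .outD => [.inT, .outD]
  | .inD => [.inT, .inD]
  | .outT => [.inT, .inD, .outT]
  | .inT => [.inT, .inD, .inT]
  | .both => [.inT, .inD, .outD, .inT]

theorem wordLen_loWord (L S : ℤ) (b : Blk) :
    wordLen L S (loWord b) = b.len (2 * L + S) (L + S) := by
  cases b <;> simp only [loWord, wordLen, Blk.len] <;> ring

theorem wordLen_midWord (L S : ℤ) (b : Blk) :
    wordLen S (L - S) (midWord b) = b.len (2 * L + S) (L + S) := by
  cases b <;> simp only [midWord, wordLen, Blk.len] <;> ring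

theorem wordLen_hiWord (L S : ℤ) (b : Blk) :
    wordLen L S (hiWord b) = b.len (2 * L + S) (L + S) := by
  cases b <;> simp only [hiWord, wordLen, Blk.len] <;> ring

namespace Run

variable {L S : ℤ}

theorem word_append {R : Run L S} {u v : List Blk} {c : ℤ} :
    R.Word (u ++ v) c ↔ R.Word u c ∧ R.Word v (c + wordLen L S u) := by
  induction u generalizing c with
  | nil => simp [Word, wordLen]
  | cons b u ih => simp only [List.cons_append, Word, ih, wordLen, and_assoc, add_assoc]

theorem word_rev {R : Run L S} {hS : 0 < S} {hL : S < L} {k : ℤ} {w : List Blk} {c : ℤ} :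
    (R.rev hS hL k).Word w c ↔ R.Word (w.reverse.map Blk.swap) (k - c - wordLen L S w) := by
  have hlen : ∀ w, wordLen L S (w.reverse.map Blk.swap) = wordLen L S w := by
    have happ : ∀ u v, wordLen L S (u ++ v) = wordLen L S u + wordLen L S v := by
      intro u v
      induction u with
      | nil => simp [wordLen]
      | cons b u ih => simp only [List.cons_append, wordLen, ih]; ring
    intro w
    induction w with
    | nil => rfl
    | cons b w ih =>
      simp only [List.reverse_cons, List.map_append, List.map_cons, List.map_nil, happ, ih,
        wordLen, Blk.len_swap]
      ring
  induction w generalizing c with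
  | nil => exact Iff.rfl
  | cons b w ih =>
    simp only [List.reverse_cons, List.map_append, List.map_cons, List.map_nil, word_append, hlen]
    simp only [Word, ih, and_true, wordLen]
    have e1 : k - (c + b.len L S) - wordLen L S w = k - c - (b.len L S + wordLen L S w) := by ring
    have e2 : k - c - (b.len L S + wordLen L S w) + wordLen L S w = k - c - b.len L S := by ring
    rw [e1, e2, and_comm]
    exact Iff.rfl

theorem Word.prefix_or {R : Run L S} {w w' : List Blk} {c : ℤ} (hS : 0 < S) (hL : S < L)
    (h : R.Word w c) (h' : R.Word w' c) : w <+: w' ∨ w' <+: w := by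
  induction w generalizing c w' with
  | nil => exact Or.inl (List.nil_prefix)
  | cons b w ih =>
    cases w' with
    | nil => exact Or.inr (List.nil_prefix)
    | cons b' w' =>
      have hb := b.len_pos hS hL
      obtain ⟨-, rfl⟩ := R.disj h.1 h'.1 le_rfl (by omega)
      rcases ih h.2 h'.2 with k | k
      · exact Or.inl (List.cons_prefix_cons.2 ⟨rfl, k⟩)
      · exact Or.inr (List.cons_prefix_cons.2 ⟨rfl, k⟩)

end Run

namespace Triple

variable {L S : ℤ} {T : Triple L S}

theorem lo_next {u v : ℤ} (h : T.lo.At .outT u) (e : v = u + (L + S)) :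
    T.lo.At .outD v ∨ T.lo.At .inD v ∨ T.lo.At .outT v ∨ T.lo.At .inT v := by
  subst e
  rcases h.next_cases with k | k | k | k | k
  · exact Or.inl k
  · exact Or.inr (Or.inl k)
  · exact Or.inr (Or.inr (Or.inl k))
  · exact Or.inr (Or.inr (Or.inr k))
  · exact (lo_not_both k).elim

theorem mid_inD_of_outD {c : ℤ} (h : T.lo.At .outD c) : T.mid.At .inD c := by
  rcases mid_of_outD h with k | k
  · exact k
  · exact (mid_not_both k).elim

/-- The coding of the middle and lower runs from a factor `outT inT` of the middle run on. -/
theorem exists_code {p : ℤ} (h1 : T.mid.At .outT p) (h2 : T.mid.At .inT (p + L)) :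
    ∃ b, T.mid.Word (midWord b ++ [.outT, .inT]) p ∧ T.lo.Word (loWord b) (p + L - S) := by
  have := T.ratio₁
  have := T.ratio₂
  have l1 : T.lo.At .outT (p + L - S) := lo_of_inT h2
  rcases after_inT h2 with k | ⟨k1, k2⟩ | ⟨k1, k2, k3⟩ | ⟨k1, k2⟩ | ⟨k1, k2, k3⟩
  · obtain ⟨m1, m2⟩ := after_inD k
    refine ⟨.outD, ?_, ?_⟩
    · exact ⟨h1, h2.congr (by simp only [Blk.len]; ring), k.congr (by simp only [Blk.len]; ring),
        m1.congr (by simp only [Blk.len]; ring), m2.congr (by simp only [Blk.len]; ring), trivial⟩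
    · exact ⟨l1, (lo_outD_of_inD k).congr (by simp only [Blk.len]; ring), trivial⟩
  -- Every possible predecessor of this second `outT` overlaps the initial factor `outT inT`.
  · exfalso
    rcases before_outT k1 with m | ⟨-, m⟩ | m
    · exact h2.clash m (by decide) (by omega) (by simp only [Blk.len]; omega)
    · exact h1.clash m (by decide) (by omega) (by simp only [Blk.len]; omega)
    · exact h2.clash m (by decide) (by omega) (by simp only [Blk.len]; omega)
  · obtain ⟨m1, m2⟩ := after_inD k3
    have l3 := lo_outD_of_inD k3
    refine ⟨.inT, ?_, ?_⟩
    · exact ⟨h1, h2.congr (by simp only [Blk.len]; ring), k1.congr (by simp only [Blk.len]; ring),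
        k2.congr (by simp only [Blk.len]; ring), k3.congr (by simp only [Blk.len]; ring),
        m1.congr (by simp only [Blk.len]; ring), m2.congr (by simp only [Blk.len]; ring), trivial⟩
    -- A lower block that writes a point would show up in the middle run. So the missing lower block
    -- only reads, and the known position of the block after it decides between `inD` and `inT`.
    · have l2 : T.lo.At .inT (p + 2 * L) := by
        rcases lo_next l1 (v := p + 2 * L) (by ring) with n | n | n | n
        · exact (k1.clash (mid_inD_of_outD n) (by decide) (by omega)
            (by simp only [Blk.len]; omega)).elim
        · have s := far n l3
          simp only [Blk.len, reduceCtorEq, and_false, false_or] at s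
          omega
        · exact (k2.clash (mid_of_outT n) (by decide) (by omega)
            (by simp only [Blk.len]; omega)).elim
        · exact n
      exact ⟨l1, l2.congr (by simp only [Blk.len]; ring), l3.congr (by simp only [Blk.len]; ring),
        trivial⟩
  · have l2 := lo_of_inT k2
    rcases after_inT k2 with n | ⟨n1, n2⟩ | n
    · obtain ⟨m1, m2⟩ := after_inD n
      refine ⟨.outT, ?_, ?_⟩
      · exact ⟨h1, h2.congr (by simp only [Blk.len]; ring),
          k1.congr (by simp only [Blk.len]; ring), k2.congr (by simp only [Blk.len]; ring),
          n.congr (by simp only [Blk.len]; ring), m1.congr (by simp only [Blk.len]; ring),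
          m2.congr (by simp only [Blk.len]; ring), trivial⟩
      · exact ⟨l1, l2.congr (by simp only [Blk.len]; ring),
          (lo_outD_of_inD n).congr (by simp only [Blk.len]; ring), trivial⟩
    · obtain ⟨m1, m2⟩ := after_inD n2
      have l4 := lo_outD_of_inD n2
      refine ⟨.both, ?_, ?_⟩
      · exact ⟨h1, h2.congr (by simp only [Blk.len]; ring),
          k1.congr (by simp only [Blk.len]; ring), k2.congr (by simp only [Blk.len]; ring),
          n1.congr (by simp only [Blk.len]; ring), n2.congr (by simp only [Blk.len]; ring),
          m1.congr (by simp only [Blk.len]; ring), m2.congr (by simp only [Blk.len]; ring),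
          trivial⟩
      · have l3 : T.lo.At .inD (p + 3 * L + S) := by
          rcases lo_next l2 (v := p + 3 * L + S) (by ring) with q | q | q | q
          · exact (n1.clash (mid_inD_of_outD q) (by decide) (by omega)
              (by simp only [Blk.len]; omega)).elim
          · exact q
          · exact (n1.clash (mid_of_outT q) (by decide) (by omega)
              (by simp only [Blk.len]; omega)).elim
          · have s := far q l4
            simp only [Blk.len, reduceCtorEq, and_false, false_or] at s
            omega
        exact ⟨l1, l2.congr (by simp only [Blk.len]; ring),
          l3.congr (by simp only [Blk.len]; ring), l4.congr (by simp only [Blk.len]; ring),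
          trivial⟩
    -- Each remaining case has an `outD` here. It must be preceded by `outT inT`, and that `outT`
    -- would start inside the block `inT` of `h2`.
    · exfalso
      have n1 : T.mid.At .outD (p + L + L + S + L) := by
        rcases n with ⟨n, -⟩ | ⟨n, -⟩ | ⟨n, -⟩ <;> exact n
      obtain ⟨-, m⟩ := before_outD n1
      exact h2.clash m (by decide) (by omega) (by simp only [Blk.len]; omega)
  · have l3 := lo_of_inT k3
    refine ⟨.inD, ?_, ?_⟩
    · exact ⟨h1, h2.congr (by simp only [Blk.len]; ring), k1.congr (by simp only [Blk.len]; ring),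
        k2.congr (by simp only [Blk.len]; ring), k3.congr (by simp only [Blk.len]; ring), trivial⟩
    · have l2 : T.lo.At .inD (p + 2 * L) := by
        rcases lo_next l1 (v := p + 2 * L) (by ring) with n | n | n | n
        · exact (k1.clash (mid_inD_of_outD n) (by decide) (by omega)
            (by simp only [Blk.len]; omega)).elim
        · exact n
        · exact (k2.clash (mid_of_outT n) (by decide) (by omega)
            (by simp only [Blk.len]; omega)).elim
        · have s := far n l3
          simp only [Blk.len, reduceCtorEq, and_false, false_or] at s
          omega
      exact ⟨l1, l2.congr (by simp only [Blk.len]; ring), trivial⟩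

variable (T)

/-- A block of the composed run, recognized on the middle run. -/
def CompAt (b : Blk) (c : ℤ) : Prop := T.mid.Word (midWord b ++ [.outT, .inT]) (c + S - L)

variable {T}

theorem CompAt.start {b : Blk} {c : ℤ} (h : T.CompAt b c) :
    T.mid.At .outT (c + S - L) ∧ T.mid.At .inT (c + S) := by
  have e : c + S - L + Blk.outT.len S (L - S) = c + S := by simp only [Blk.len]; ring
  cases b <;> exact ⟨h.1, h.2.1.congr e⟩

theorem compAt_of_start {c : ℤ} (h1 : T.mid.At .outT (c + S - L)) (h2 : T.mid.At .inT (c + S)) :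
    ∃ b, T.CompAt b c ∧ T.lo.Word (loWord b) c := by
  obtain ⟨b, h3, h4⟩ := exists_code h1 (h2.congr (by ring))
  refine ⟨b, h3, ?_⟩
  have e : c + S - L + L - S = c := by ring
  rwa [e] at h4

theorem CompAt.finish {b : Blk} {c : ℤ} (h : T.CompAt b c) :
    T.mid.At .outT (c + b.len (2 * L + S) (L + S) + S - L) ∧
      T.mid.At .inT (c + b.len (2 * L + S) (L + S) + S) := by
  cases b
  · obtain ⟨-, -, -, h1, h2, -⟩ := h
    exact ⟨h1.congr (by simp only [Blk.len]; ring), h2.congr (by simp only [Blk.len]; ring)⟩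
  · obtain ⟨-, -, -, h1, h2, -⟩ := h
    exact ⟨h1.congr (by simp only [Blk.len]; ring), h2.congr (by simp only [Blk.len]; ring)⟩
  · obtain ⟨-, -, -, -, -, h1, h2, -⟩ := h
    exact ⟨h1.congr (by simp only [Blk.len]; ring), h2.congr (by simp only [Blk.len]; ring)⟩
  · obtain ⟨-, -, -, -, -, h1, h2, -⟩ := h
    exact ⟨h1.congr (by simp only [Blk.len]; ring), h2.congr (by simp only [Blk.len]; ring)⟩
  · obtain ⟨-, -, -, -, -, -, h1, h2, -⟩ := h
    exact ⟨h1.congr (by simp only [Blk.len]; ring), h2.congr (by simp only [Blk.len]; ring)⟩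

/-- Reversing `midWord b ++ [outT, inT]` and swapping its blocks gives the window of `b.swap`. This
symmetry is the reason for including `outT inT` at the end of the window. -/
theorem rev_compAt {b : Blk} {c : ℤ} :
    T.rev.CompAt b c ↔ T.CompAt b.swap (-L - c - b.len (2 * L + S) (L + S)) := by
  have hw : ((midWord b ++ [Blk.outT, Blk.inT]).reverse.map Blk.swap) = midWord b.swap ++ [.outT, .inT] := by
    cases b <;> rfl
  have hl : wordLen S (L - S) (midWord b ++ [.outT, .inT]) =
      b.len (2 * L + S) (L + S) + 2 * L := by
    cases b <;> simp only [midWord, wordLen, List.cons_append, List.nil_append, Blk.len] <;> ring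
  have h := Run.word_rev (R := T.mid) (hS := by have := T.ratio₁; have := T.ratio₂; omega)
    (hL := by have := T.ratio₁; have := T.ratio₂; omega) (k := 2 * S - L)
    (w := midWord b ++ [.outT, .inT]) (c := c + S - L)
  rw [hw, hl] at h
  have e : 2 * S - L - (c + S - L) - (b.len (2 * L + S) (L + S) + 2 * L) =
      -L - c - b.len (2 * L + S) (L + S) + S - L := by ring
  rw [e] at h
  exact h

/-- The five windows form a prefix code. -/
theorem CompAt.unique {b b' : Blk} {c : ℤ} (h : T.CompAt b c) (h' : T.CompAt b' c) : b' = b := by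
  have key : ∀ b b' : Blk, (midWord b ++ [.outT, .inT] <+: midWord b' ++ [.outT, .inT] ∨
      midWord b' ++ [.outT, .inT] <+: midWord b ++ [.outT, .inT]) → b' = b := by
    intro b b'
    cases b <;> cases b' <;> decide
  exact key _ _ (Run.Word.prefix_or (by have := T.ratio₁; have := T.ratio₂; omega)
    (by have := T.ratio₁; have := T.ratio₂; omega) h h')

theorem CompAt.loWord {b : Blk} {c : ℤ} (h : T.CompAt b c) : T.lo.Word (loWord b) c := by
  obtain ⟨b', h1, h2⟩ := compAt_of_start h.start.1 h.start.2
  rwa [h.unique h1] at h2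

/-- A composed block starts only at a factor `outT inT` of the middle run. In the words `midWord b`,
an `outT` other than the first one occurs only in the cases `inT` and `both`, and there it is
followed by `inD`. -/
theorem CompAt.disj {b b' : Blk} {c c' : ℤ} (h : T.CompAt b c) (h' : T.CompAt b' c')
    (h1 : c ≤ c') (h2 : c' < c + b.len (2 * L + S) (L + S)) : c' = c ∧ b' = b := by
  have := T.ratio₁
  have := T.ratio₂
  suffices hc : c' = c by
    subst hc
    exact ⟨rfl, h.unique h'⟩
  have hw : T.mid.Word (midWord b) (c + S - L) := (Run.word_append.1 h).1
  obtain ⟨s1, s2⟩ := h'.start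
  have ho := hw.occ_of_mem s1 (by omega) (by rw [wordLen_midWord]; omega)
  have e : c' + S - L - (c + S - L) = c' - c := by ring
  rw [e] at ho
  have bad : ∀ d, c' - c = d → T.mid.At .inD (c + S + d) → c' = c := by
    intro d hd k
    exact (s2.clash (k.congr (by omega)) (by decide) le_rfl (by simp only [Blk.len]; omega)).elim
  cases b <;> simp only [midWord, Occ, reduceCtorEq, false_and, true_and, false_or, or_false,
    Blk.len] at ho
  · omega
  · omega
  · omega
  · rcases ho with ho | ho
    · omega
    · refine bad (2 * L + S) (by omega) ?_
      obtain ⟨-, -, -, -, k, -⟩ := hw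
      exact k.congr (by simp only [Blk.len]; ring)
  · rcases ho with ho | ho
    · omega
    · refine bad (3 * L + S) (by omega) ?_
      obtain ⟨-, -, -, -, -, k, -⟩ := hw
      exact k.congr (by simp only [Blk.len]; ring)

theorem exists_start : ∃ c, T.mid.At .outT (c + S - L) ∧ T.mid.At .inT (c + S) := by
  have hD : ∀ {c}, T.mid.At .inD c → ∃ c, T.mid.At .outT (c + S - L) ∧ T.mid.At .inT (c + S) := by
    intro c h
    obtain ⟨h1, h2⟩ := after_inD h
    exact ⟨c + L, h1.congr (by ring), h2.congr (by ring)⟩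
  have hO : ∀ {c}, T.mid.At .outD c → ∃ c, T.mid.At .outT (c + S - L) ∧ T.mid.At .inT (c + S) := by
    intro c h
    obtain ⟨h1, h2⟩ := before_outD h
    exact ⟨c - L - S, h2.congr (by ring), h1.congr (by ring)⟩
  have hI : ∀ {c}, T.InAt c → ∃ c, T.mid.At .outT (c + S - L) ∧ T.mid.At .inT (c + S) := by
    rintro c (h | h | h)
    · exact hD h
    · rcases after_inT h with k | ⟨-, k⟩ | ⟨k, -⟩ | ⟨k, -⟩ | ⟨k, -⟩
      · exact hD k
      · exact hD k
      · exact hO k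
      · exact hO k
      · exact hO k
    · exact (mid_not_both h).elim
  obtain ⟨b, c, h⟩ := T.mid.nonempty
  rcases next_inAt h rfl with k | ⟨-, k⟩ | ⟨-, k⟩ | ⟨-, -, k⟩ <;> exact hI k

variable (T)

/-- The composition of a triple of runs. -/
def comp : Run (2 * L + S) (L + S) where
  At := T.CompAt
  next h := by
    obtain ⟨b', h', -⟩ := compAt_of_start h.finish.1 h.finish.2
    exact ⟨b', h'⟩
  prev {b c} h := by
    obtain ⟨h1, h2⟩ := h.start
    -- The preceding composed block is the following one in the mirror image.
    have k1 : T.rev.mid.At .outT (-L - c + S - L) := h2.congr (by simp only [Blk.len]; ring)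
    have k2 : T.rev.mid.At .inT (-L - c + S) := h1.congr (by simp only [Blk.len]; ring)
    obtain ⟨b', h', -⟩ := compAt_of_start k1 k2
    rw [rev_compAt] at h'
    refine ⟨b'.swap, ?_⟩
    rw [Blk.len_swap]
    have e : -L - (-L - c) = c := by ring
    rwa [e] at h'
  disj := CompAt.disj
  nonempty := by
    obtain ⟨c, h1, h2⟩ := T.exists_start
    obtain ⟨b, h, -⟩ := compAt_of_start h1 h2
    exact ⟨b, c, h⟩

variable {T}

theorem lo_at_iff (x : Blk) (p : ℤ) : T.lo.At x p ↔ T.comp.SubAt L S loWord 0 x p := by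
  have := T.ratio₁
  have := T.ratio₂
  refine Run.at_iff_subAt (by omega) (by omega) (wordLen_loWord L S) ?_ x p
  intro b c h
  rw [add_zero]
  exact CompAt.loWord h

theorem lo_at_inD {p : ℤ} :
    T.lo.At .inD p ↔ T.comp.At .inD (p - (L + S)) ∨ T.comp.At .both (p - 2 * (L + S)) := by
  rw [lo_at_iff]
  constructor
  · rintro ⟨b, c, h, ho⟩
    cases b <;> simp only [loWord, Occ, reduceCtorEq, false_and, true_and, false_or, or_false,
      Blk.len] at ho
    · exact Or.inl (h.congr (by omega))
    · exact Or.inr (h.congr (by omega))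
  · rintro (h | h)
    · refine ⟨_, _, h, ?_⟩
      simp only [loWord, Occ, reduceCtorEq, false_and, true_and, false_or, or_false, Blk.len]
      ring
    · refine ⟨_, _, h, ?_⟩
      simp only [loWord, Occ, reduceCtorEq, false_and, true_and, false_or, or_false, Blk.len]
      ring

theorem lo_at_inT {p : ℤ} : T.lo.At .inT p ↔ T.comp.At .inT (p - (L + S)) := by
  rw [lo_at_iff]
  constructor
  · rintro ⟨b, c, h, ho⟩
    cases b <;> simp only [loWord, Occ, reduceCtorEq, false_and, true_and, false_or, or_false,
      Blk.len] at ho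
    exact h.congr (by omega)
  · intro h
    refine ⟨_, _, h, ?_⟩
    simp only [loWord, Occ, reduceCtorEq, false_and, true_and, false_or, or_false, Blk.len]
    ring

/-- The lower run has no block `both`, and its reading blocks come exactly from the composed blocks
`inD`, `both` and `inT`. The offsets in `loWord` then match the points of the composed blocks. -/
theorem ins_comp : T.comp.ins = T.lo.ins := by
  ext t
  · simp only [Run.ins]
    rw [lo_at_inD, or_iff_left (b := T.lo.At .both (t - (L + S))) lo_not_both]
    have e1 : t - L - (L + S) = t - (2 * L + S) := by ring
    have e2 : t - L - 2 * (L + S) = t - (2 * L + S + (L + S)) := by ring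
    rw [e1, e2]
  · simp only [Run.ins]
    rw [lo_at_inT]
    have e1 : t - L - (L + S) = t - (2 * L + S) := by ring
    rw [e1]

theorem comp_rev : T.rev.comp = T.comp.rev (by have := T.ratio₁; have := T.ratio₂; omega)
    (by have := T.ratio₁; have := T.ratio₂; omega) (-L) := by
  apply Run.ext
  funext b c
  exact propext rev_compAt

/-- This is `ins_comp` for the mirror image, since composition commutes with reflection. -/
theorem outs_comp : T.comp.outs = T.hi.outs := by
  have h := T.rev.ins_comp
  have hS : 0 < S := by have := T.ratio₁; have := T.ratio₂; omega
  have hL : S < L := by have := T.ratio₁; have := T.ratio₂; omega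
  rw [comp_rev, Run.ins_rev, show T.rev.lo = T.hi.rev hS hL 0 from rfl, Run.ins_rev] at h
  have e : ∀ t, T.comp.outs.D t = T.hi.outs.D t ∧ T.comp.outs.T t = T.hi.outs.T t := by
    intro t
    have h1 := congrFun (congrArg Pts.D h) (S - t)
    have h2 := congrFun (congrArg Pts.T h) (S - t)
    have e1 : L + S + -L - (S - t) = t := by ring
    have e2 : S + 0 - (S - t) = t := by ring
    simp only [e1, e2] at h1 h2
    exact ⟨h1, h2⟩
  ext t
  · rw [(e t).1]
  · rw [(e t).2]

/-! ### Consecutive blocks in the lower and upper runs -/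

theorem lo_inT_next {p : ℤ} (h : T.lo.At .inT p) : T.lo.At .outD (p + (L + S)) := by
  obtain ⟨-, -, k, -⟩ := CompAt.loWord (lo_at_inT.1 h)
  exact k.congr (by simp only [Blk.len]; ring)

theorem lo_inT_prev {p : ℤ} (h : T.lo.At .inT p) : T.lo.At .outT (p - (L + S)) :=
  (CompAt.loWord (lo_at_inT.1 h)).1

theorem lo_inD_prev {p : ℤ} (h : T.lo.At .inD p) : T.lo.At .outT (p - (L + S)) := by
  rcases lo_at_inD.1 h with k | k
  · exact (CompAt.loWord k).1
  · obtain ⟨-, m, -⟩ := CompAt.loWord k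
    exact m.congr (by simp only [Blk.len]; ring)

theorem lo_outD_next {p : ℤ} (h : T.lo.At .outD p) : T.lo.At .outT (p + L) := by
  obtain ⟨k, -⟩ := after_inD (mid_inD_of_outD h)
  have m := lo_of_inT (T := T) (c := p + S + L) (after_inD (mid_inD_of_outD h)).2
  exact m.congr (by ring)

theorem lo_exists_outT (T : Triple L S) : ∃ p, T.lo.At .outT p := by
  obtain ⟨c, -, h⟩ := T.exists_start
  exact ⟨_, lo_of_inT h⟩

theorem hi_outT_next {p : ℤ} (h : T.hi.At .outT p) : T.hi.At .inT (p + (L + S)) := by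
  have h' : T.rev.lo.At .inT (0 - p - (L + S)) := h.congr (by simp only [Blk.len]; ring)
  exact Run.At.congr (T.rev.lo_inT_prev h') (by simp only [Blk.len]; ring)

theorem hi_outD_next {p : ℤ} (h : T.hi.At .outD p) : T.hi.At .inT (p + L) := by
  have h' : T.rev.lo.At .inD (0 - p - L) := h.congr (by simp only [Blk.len]; ring)
  exact Run.At.congr (T.rev.lo_inD_prev h') (by simp only [Blk.len]; ring)

/-- Two triples cannot be put on top of each other. -/
theorem hi_ne_lo {T T' : Triple L S} (h : T.hi = T'.lo) : False := by
  have := T.ratio₁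
  have := T.ratio₂
  -- As an upper run, the common run has `inT` after each `outT` and after each `outD`; as a lower
  -- run, it has `outD` after `inT` and `outT` after `outD`. From `outT inT outD` the next block
  -- would be both `outT` and `inT`.
  obtain ⟨p, h1⟩ := T'.lo_exists_outT
  have h2 := T.hi_outT_next (h ▸ h1)
  have h3 := T'.lo_inT_next (h ▸ h2)
  have h4 := T'.lo_outD_next h3
  have h5 := T.hi_outD_next (h ▸ h3)
  rw [h] at h5
  exact h5.clash h4 (by decide) le_rfl (by simp only [Blk.len]; omega)

end Triple

namespace Run

variable {L S : ℤ}

/-! ### Decomposition of a run -/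

/-- The lower run of the decomposition of a run. -/
def lower (hS : 0 < S) (hL : S < L) (R : Run (2 * L + S) (L + S)) : Run L S :=
  R.sub hS hL loWord 0 (wordLen_loWord L S) (by intro b; cases b <;> simp [loWord])

/-- The middle run of the decomposition of a run. -/
def middle (hS : S < L) (hL : L < 2 * S) (R : Run (2 * L + S) (L + S)) : Run S (L - S) :=
  R.sub (by omega) (by omega) midWord (S - L) (wordLen_midWord L S)
    (by intro b; cases b <;> simp [midWord])

/-- The upper run of the decomposition of a run. -/
def upper (hS : 0 < S) (hL : S < L) (R : Run (2 * L + S) (L + S)) : Run L S :=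
  R.sub hS hL hiWord (-S) (wordLen_hiWord L S) (by intro b; cases b <;> simp [hiWord])

theorem subAt_congr {L' S' L₁ S₁ L₂ S₂ : ℤ} {R : Run L' S'} {σ₁ σ₂ : Blk → List Blk}
    {o₁ o₂ p₁ p₂ : ℤ} {x₁ x₂ : Blk}
    (h : ∀ b c, Occ L₁ S₁ x₁ (σ₁ b) (p₁ - c - o₁) ↔ Occ L₂ S₂ x₂ (σ₂ b) (p₂ - c - o₂)) :
    R.SubAt L₁ S₁ σ₁ o₁ x₁ p₁ ↔ R.SubAt L₂ S₂ σ₂ o₂ x₂ p₂ :=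
  exists_congr fun b => exists_congr fun c => and_congr_right fun _ => h b c

theorem not_subAt {L' S' : ℤ} {R : Run L' S'} {σ : Blk → List Blk} {o p : ℤ} {x : Blk}
    (h : ∀ b d, ¬ Occ L S x (σ b) d) : ¬ R.SubAt L S σ o x p := by
  rintro ⟨b, c, -, ho⟩
  exact h b _ ho

theorem loWord_not_both (b : Blk) (d : ℤ) : ¬ Occ L S .both (loWord b) d := by
  cases b <;> simp [loWord, Occ]

theorem midWord_not_both (b : Blk) (d : ℤ) : ¬ Occ L S .both (midWord b) d := by
  cases b <;> simp [midWord, Occ]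

theorem hiWord_not_both (b : Blk) (d : ℤ) : ¬ Occ L S .both (hiWord b) d := by
  cases b <;> simp [hiWord, Occ]

variable (hS : 0 < S) (hL : S < L) (hL2 : L < 2 * S) (R : Run (2 * L + S) (L + S))

/-- No image word contains `both`, and inside the image of each single block the two substitutions
place the shared points at the same offsets. So the comparison is local to one block of `R`. -/
theorem outs_lower : (R.lower hS hL).outs = (R.middle hL hL2).ins := by
  ext t
  · refine or_congr ?_ (iff_of_false (not_subAt loWord_not_both) (not_subAt midWord_not_both))
    refine subAt_congr fun b c => ?_
    cases b <;> simp only [loWord, midWord, Occ, reduceCtorEq, false_and, true_and, false_or,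
      or_false, Blk.len] <;> omega
  · refine subAt_congr fun b c => ?_
    cases b <;> simp only [loWord, midWord, Occ, reduceCtorEq, false_and, true_and, false_or,
      or_false, Blk.len] <;> omega

theorem outs_middle : (R.middle hL hL2).outs = (R.upper hS hL).ins := by
  ext t
  · refine or_congr ?_ (iff_of_false (not_subAt midWord_not_both) (not_subAt hiWord_not_both))
    refine subAt_congr fun b c => ?_
    cases b <;> simp only [hiWord, midWord, Occ, reduceCtorEq, false_and, true_and, false_or,
      or_false, Blk.len] <;> omega
  · refine subAt_congr fun b c => ?_
    cases b <;> simp only [hiWord, midWord, Occ, reduceCtorEq, false_and, true_and, false_or,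
      or_false, Blk.len] <;> omega

theorem ins_lower : (R.lower hS hL).ins = R.ins := by
  ext t
  · refine (or_iff_left (not_subAt loWord_not_both)).trans ⟨?_, ?_⟩
    · rintro ⟨b, c, h, ho⟩
      cases b <;> simp only [loWord, Occ, reduceCtorEq, false_and, true_and, false_or,
        or_false, Blk.len] at ho
      · exact Or.inl (h.congr (by omega))
      · exact Or.inr (h.congr (by omega))
    · rintro (h | h) <;> refine ⟨_, _, h, ?_⟩ <;> simp only [loWord, Occ, reduceCtorEq, false_and,
        true_and, false_or, or_false, Blk.len] <;> ring
  · refine ⟨?_, ?_⟩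
    · rintro ⟨b, c, h, ho⟩
      cases b <;> simp only [loWord, Occ, reduceCtorEq, false_and, true_and, false_or,
        or_false, Blk.len] at ho
      exact h.congr (by omega)
    · intro h
      refine ⟨_, _, h, ?_⟩
      simp only [loWord, Occ, reduceCtorEq, false_and, true_and, false_or, or_false, Blk.len]
      ring

theorem outs_upper : (R.upper hS hL).outs = R.outs := by
  ext t
  · refine (or_iff_left (not_subAt hiWord_not_both)).trans ⟨?_, ?_⟩
    · rintro ⟨b, c, h, ho⟩
      cases b <;> simp only [hiWord, Occ, reduceCtorEq, false_and, true_and, false_or,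
        or_false, Blk.len] at ho
      · exact Or.inl (h.congr (by omega))
      · exact Or.inr (h.congr (by omega))
    · rintro (h | h) <;> refine ⟨_, _, h, ?_⟩ <;> simp only [hiWord, Occ, reduceCtorEq, false_and,
        true_and, false_or, or_false, Blk.len] <;> ring
  · refine ⟨?_, ?_⟩
    · rintro ⟨b, c, h, ho⟩
      cases b <;> simp only [hiWord, Occ, reduceCtorEq, false_and, true_and, false_or,
        or_false, Blk.len] at ho
      exact h.congr (by omega)
    · intro h
      refine ⟨_, _, h, ?_⟩
      simp only [hiWord, Occ, reduceCtorEq, false_and, true_and, false_or, or_false, Blk.len]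
      ring

/-- The periodic run which consists of blocks `outD` only. -/
def periodic : Run L S where
  At b c := b = .outD ∧ L ∣ c
  next := by
    rintro _ c ⟨rfl, h⟩
    exact ⟨.outD, rfl, dvd_add h dvd_rfl⟩
  prev := by
    rintro _ c ⟨rfl, h⟩
    exact ⟨.outD, rfl, dvd_sub h dvd_rfl⟩
  disj := by
    rintro _ c _ c' ⟨rfl, h⟩ ⟨rfl, h'⟩ h1 h2
    simp only [Blk.len] at h2
    have h3 := Int.eq_zero_of_dvd_of_nonneg_of_lt (m := c' - c) (by omega) (by omega)
      (dvd_sub h' h)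
    exact ⟨by omega, rfl⟩
  nonempty := ⟨.outD, 0, rfl, dvd_zero _⟩

end Run

/-! ### Rows of letters and sets of points -/

/-- The point of type `T` if `τ` holds, and of type `D` otherwise. -/
def Pts.Mem (P : Pts) : Bool → ℤ → Prop
  | false => P.D
  | true => P.T

/-- The points are at distance at least `5` from each other. -/
def Pts.Sparse (P : Pts) : Prop :=
  ∀ τ τ' s t, P.Mem τ s → P.Mem τ' t → s ≤ t → t < s + 5 → s = t ∧ τ = τ'

/-- The positions of the letters `0` which are coded by a set of points. -/
def Pts.Zero (P : Pts) (t : ℤ) : Prop :=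
  P.D (t + 1) ∨ P.D (t + 2) ∨ P.T (t + 1) ∨ P.T (t + 2) ∨ P.T (t + 3)

/-- The positions of the letters `1` which are coded by a set of points. -/
def Pts.One (P : Pts) (t : ℤ) : Prop :=
  P.D (t + 1) ∨ P.D (t + 2) ∨ P.T t ∨ P.T (t + 1) ∨ P.T (t + 2)

namespace Pts

theorem Sparse.shift {P : Pts} (h : P.Sparse) (k : ℤ) : (P.shift k).Sparse := by
  have e : ∀ τ s, (P.shift k).Mem τ s ↔ P.Mem τ (s - k) := by
    intro τ s
    cases τ <;> exact Iff.rfl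
  intro τ τ' s t h1 h2 h3 h4
  rw [e] at h1 h2
  have := h τ τ' _ _ h1 h2 (by omega) (by omega)
  exact ⟨by omega, this.2⟩

/-- A point codes at least two adjacent letters. This rules out isolated letters on the rows next to
a component `b` in `exists_evenRows_B`. -/
theorem zero_neighbour {P : Pts} {t : ℤ} (h : P.Zero t) : P.Zero (t - 1) ∨ P.Zero (t + 1) := by
  have e1 : t - 1 + 2 = t + 1 := by ring
  have e2 : t + 1 + 1 = t + 2 := by ring
  have e3 : t - 1 + 3 = t + 2 := by ring
  have e4 : t + 1 + 2 = t + 3 := by ring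
  unfold Zero at *
  rw [e1, e2, e3, e4]
  tauto

theorem one_neighbour {P : Pts} {t : ℤ} (h : P.One t) : P.One (t - 1) ∨ P.One (t + 1) := by
  have e1 : t - 1 + 2 = t + 1 := by ring
  have e2 : t + 1 + 1 = t + 2 := by ring
  have e3 : t - 1 + 1 = t := by ring
  unfold One at *
  rw [e1, e2, e3]
  tauto

/-- Letters of different points never touch when the points are sparse, so a pair is a maximal run
of exactly two letters and a triple one of exactly three. With letters `0` the triple at `t` ends at
`t - 1`, with letters `1` it ends at `t`; pairs end at `t - 1` in both codings. -/
theorem Sparse.D_iff_zero {P : Pts} (h : P.Sparse) (t : ℤ) :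
    P.D t ↔ ¬ P.Zero (t - 3) ∧ P.Zero (t - 2) ∧ P.Zero (t - 1) ∧ ¬ P.Zero t := by
  unfold Zero
  have e1 : t - 3 + 1 = t - 2 := by ring
  have e2 : t - 3 + 2 = t - 1 := by ring
  have e3 : t - 3 + 3 = t := by ring
  have e4 : t - 2 + 1 = t - 1 := by ring
  have e5 : t - 2 + 2 = t := by ring
  have e6 : t - 2 + 3 = t + 1 := by ring
  have e7 : t - 1 + 1 = t := by ring
  have e8 : t - 1 + 2 = t + 1 := by ring
  have e9 : t - 1 + 3 = t + 2 := by ring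
  rw [e1, e2, e3, e4, e5, e6, e7, e8, e9]
  constructor
  · intro hd
    have l : ∀ τ s, P.Mem τ s → s ≤ t → t < s + 5 → s = t ∧ τ = false := fun τ s hs =>
      h τ false s t hs hd
    have r : ∀ τ s, P.Mem τ s → t ≤ s → s < t + 5 → t = s ∧ false = τ := fun τ s hs =>
      h false τ t s hd hs
    refine ⟨?_, by tauto, by tauto, ?_⟩
    · rintro (k | k | k | k | k)
      · have := l false _ k (by omega) (by omega); omega
      · have := l false _ k (by omega) (by omega); omega
      · have := l true _ k (by omega) (by omega); omega
      · have := l true _ k (by omega) (by omega); omega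
      · have := l true _ k (by omega) (by omega); simp at this
    · rintro (k | k | k | k | k)
      · have := r false _ k (by omega) (by omega); omega
      · have := r false _ k (by omega) (by omega); omega
      · have := r true _ k (by omega) (by omega); omega
      · have := r true _ k (by omega) (by omega); omega
      · have := r true _ k (by omega) (by omega); omega
  · tauto

theorem Sparse.T_iff_zero {P : Pts} (h : P.Sparse) (t : ℤ) :
    P.T t ↔ ¬ P.Zero (t - 4) ∧ P.Zero (t - 3) ∧ P.Zero (t - 2) ∧ P.Zero (t - 1) ∧ ¬ P.Zero t := by
  unfold Zero
  have e1 : t - 3 + 1 = t - 2 := by ring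
  have e2 : t - 3 + 2 = t - 1 := by ring
  have e3 : t - 3 + 3 = t := by ring
  have e4 : t - 2 + 1 = t - 1 := by ring
  have e5 : t - 2 + 2 = t := by ring
  have e6 : t - 2 + 3 = t + 1 := by ring
  have e7 : t - 1 + 1 = t := by ring
  have e8 : t - 1 + 2 = t + 1 := by ring
  have e9 : t - 1 + 3 = t + 2 := by ring
  have e10 : t - 4 + 1 = t - 3 := by ring
  have e11 : t - 4 + 2 = t - 2 := by ring
  have e12 : t - 4 + 3 = t - 1 := by ring
  rw [e1, e2, e3, e4, e5, e6, e7, e8, e9, e10, e11, e12]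
  constructor
  · intro hd
    have l : ∀ τ s, P.Mem τ s → s ≤ t → t < s + 5 → s = t ∧ τ = true := fun τ s hs =>
      h τ true s t hs hd
    have r : ∀ τ s, P.Mem τ s → t ≤ s → s < t + 5 → t = s ∧ true = τ := fun τ s hs =>
      h true τ t s hd hs
    refine ⟨?_, by tauto, by tauto, by tauto, ?_⟩
    · rintro (k | k | k | k | k)
      · have := l false _ k (by omega) (by omega); omega
      · have := l false _ k (by omega) (by omega); omega
      · have := l true _ k (by omega) (by omega); omega
      · have := l true _ k (by omega) (by omega); omega
      · have := l true _ k (by omega) (by omega); omega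
    · rintro (k | k | k | k | k)
      · have := r false _ k (by omega) (by omega); omega
      · have := r false _ k (by omega) (by omega); omega
      · have := r true _ k (by omega) (by omega); omega
      · have := r true _ k (by omega) (by omega); omega
      · have := r true _ k (by omega) (by omega); omega
  · rintro ⟨h1, h2, h3, h4, h5⟩
    -- Two pairs shifted by one would also produce three consecutive letters.
    have k : P.D t → P.D (t - 1) → False := by
      intro a b
      have := h false false _ _ b a (by omega) (by omega)
      omega
    tauto

theorem Sparse.D_iff_one {P : Pts} (h : P.Sparse) (t : ℤ) :
    P.D t ↔ ¬ P.One (t - 3) ∧ P.One (t - 2) ∧ P.One (t - 1) ∧ ¬ P.One t := by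
  unfold One
  have e1 : t - 3 + 1 = t - 2 := by ring
  have e2 : t - 3 + 2 = t - 1 := by ring
  have e4 : t - 2 + 1 = t - 1 := by ring
  have e5 : t - 2 + 2 = t := by ring
  have e7 : t - 1 + 1 = t := by ring
  have e8 : t - 1 + 2 = t + 1 := by ring
  rw [e1, e2, e4, e5, e7, e8]
  constructor
  · intro hd
    have l : ∀ τ s, P.Mem τ s → s ≤ t → t < s + 5 → s = t ∧ τ = false := fun τ s hs =>
      h τ false s t hs hd
    have r : ∀ τ s, P.Mem τ s → t ≤ s → s < t + 5 → t = s ∧ false = τ := fun τ s hs =>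
      h false τ t s hd hs
    refine ⟨?_, by tauto, by tauto, ?_⟩
    · rintro (k | k | k | k | k)
      · have := l false _ k (by omega) (by omega); omega
      · have := l false _ k (by omega) (by omega); omega
      · have := l true _ k (by omega) (by omega); omega
      · have := l true _ k (by omega) (by omega); omega
      · have := l true _ k (by omega) (by omega); omega
    · rintro (k | k | k | k | k)
      · have := r false _ k (by omega) (by omega); omega
      · have := r false _ k (by omega) (by omega); omega
      · have := r true _ k (by omega) (by omega); simp at this
      · have := r true _ k (by omega) (by omega); omega
      · have := r true _ k (by omega) (by omega); omega
  · tauto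

theorem Sparse.T_iff_one {P : Pts} (h : P.Sparse) (t : ℤ) :
    P.T t ↔ ¬ P.One (t - 3) ∧ P.One (t - 2) ∧ P.One (t - 1) ∧ P.One t ∧ ¬ P.One (t + 1) := by
  unfold One
  have e1 : t - 3 + 1 = t - 2 := by ring
  have e2 : t - 3 + 2 = t - 1 := by ring
  have e4 : t - 2 + 1 = t - 1 := by ring
  have e5 : t - 2 + 2 = t := by ring
  have e7 : t - 1 + 1 = t := by ring
  have e8 : t - 1 + 2 = t + 1 := by ring
  have e9 : t + 1 + 1 = t + 2 := by ring
  have e10 : t + 1 + 2 = t + 3 := by ring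
  rw [e1, e2, e4, e5, e7, e8, e9, e10]
  constructor
  · intro hd
    have l : ∀ τ s, P.Mem τ s → s ≤ t → t < s + 5 → s = t ∧ τ = true := fun τ s hs =>
      h τ true s t hs hd
    have r : ∀ τ s, P.Mem τ s → t ≤ s → s < t + 5 → t = s ∧ true = τ := fun τ s hs =>
      h true τ t s hd hs
    refine ⟨?_, by tauto, by tauto, by tauto, ?_⟩
    · rintro (k | k | k | k | k)
      · have := l false _ k (by omega) (by omega); omega
      · have := l false _ k (by omega) (by omega); omega
      · have := l true _ k (by omega) (by omega); omega
      · have := l true _ k (by omega) (by omega); omega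
      · have := l true _ k (by omega) (by omega); omega
    · rintro (k | k | k | k | k)
      · have := r false _ k (by omega) (by omega); omega
      · have := r false _ k (by omega) (by omega); omega
      · have := r true _ k (by omega) (by omega); omega
      · have := r true _ k (by omega) (by omega); omega
      · have := r true _ k (by omega) (by omega); omega
  · rintro ⟨h1, h2, h3, h4, h5⟩
    have k : P.D (t + 1) → P.D t → False := by
      intro a b
      have := h false false _ _ b a (by omega) (by omega)
      omega
    tauto

/-- A row determines its points. This is what turns equality of rows in a tiling into the equalities
of points required by `Triple`. -/
theorem Sparse.eq_of_zero {P Q : Pts} (hP : P.Sparse) (hQ : Q.Sparse)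
    (h : ∀ t, P.Zero t ↔ Q.Zero t) : P = Q := by
  ext t
  · rw [hP.D_iff_zero, hQ.D_iff_zero, h, h, h, h]
  · rw [hP.T_iff_zero, hQ.T_iff_zero, h, h, h, h, h]

theorem Sparse.eq_of_one {P Q : Pts} (hP : P.Sparse) (hQ : Q.Sparse)
    (h : ∀ t, P.One t ↔ Q.One t) : P = Q := by
  ext t
  · rw [hP.D_iff_one, hQ.D_iff_one, h, h, h, h]
  · rw [hP.T_iff_one, hQ.T_iff_one, h, h, h, h, h]

end Pts

namespace Run

variable {L S : ℤ} {R : Run L S}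

theorem mem_ins {τ : Bool} {t : ℤ} (h : R.ins.Mem τ t) :
    (R.At .inD (t - L) ∧ τ = false) ∨ (R.At .both (t - (L + S)) ∧ τ = false) ∨
      (R.At .inT (t - L) ∧ τ = true) := by
  cases τ
  · rcases h with h | h
    · exact Or.inl ⟨h, rfl⟩
    · exact Or.inr (Or.inl ⟨h, rfl⟩)
  · exact Or.inr (Or.inr ⟨h, rfl⟩)

theorem mem_outs {τ : Bool} {t : ℤ} (h : R.outs.Mem τ t) :
    (R.At .outD (t - S) ∧ τ = false) ∨ (R.At .both (t - L) ∧ τ = false) ∨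
      (R.At .outT (t - 2 * S) ∧ τ = true) := by
  cases τ
  · rcases h with h | h
    · exact Or.inl ⟨h, rfl⟩
    · exact Or.inr (Or.inl ⟨h, rfl⟩)
  · exact Or.inr (Or.inr ⟨h, rfl⟩)

theorem sparse_ins (hS : 0 < S) (hL : S < L) (h5 : 5 ≤ L) : R.ins.Sparse := by
  intro τ τ' s t h h' h1 h2
  rcases mem_ins h with ⟨a, rfl⟩ | ⟨a, rfl⟩ | ⟨a, rfl⟩ <;>
    rcases mem_ins h' with ⟨b, rfl⟩ | ⟨b, rfl⟩ | ⟨b, rfl⟩ <;>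
    have c := a.trichotomy b <;>
    simp only [Blk.len, reduceCtorEq, and_false, and_true, false_or] at c ⊢ <;> omega

theorem sparse_outs (hS : 0 < S) (hL : S < L) (h5 : 5 ≤ L) : R.outs.Sparse := by
  intro τ τ' s t h h' h1 h2
  rcases mem_outs h with ⟨a, rfl⟩ | ⟨a, rfl⟩ | ⟨a, rfl⟩ <;>
    rcases mem_outs h' with ⟨b, rfl⟩ | ⟨b, rfl⟩ | ⟨b, rfl⟩ <;>
    have c := a.trichotomy b <;>
    simp only [Blk.len, reduceCtorEq, and_false, and_true, false_or] at c ⊢ <;> omega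

end Run

/-! ### Letters read and written by a single block -/

namespace Blk

/-- The positions of the letters `0` in the word which is read by a block. -/
def InZero (L S : ℤ) : Blk → ℤ → Prop
  | inD, i => L - 2 ≤ i ∧ i < L
  | inT, i => L - 3 ≤ i ∧ i < L
  | both, i => L + S - 2 ≤ i ∧ i < L + S
  | _, _ => False

/-- The positions of the letters `1` in the word which is written by a block. -/
def OutOne (L S : ℤ) : Blk → ℤ → Prop
  | outD, i => S - 3 ≤ i ∧ i < S - 1
  | outT, i => 2 * S - 3 ≤ i ∧ i < 2 * S
  | both, i => L - 3 ≤ i ∧ i < L - 1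
  | _, _ => False

/-- The positions of the letters `1` in the word which is read by a block. -/
def InOne (L S : ℤ) : Blk → ℤ → Prop
  | inD, i => L - 2 ≤ i ∧ i < L
  | inT, i => L - 2 ≤ i ∧ i < L + 1
  | both, i => L + S - 2 ≤ i ∧ i < L + S
  | _, _ => False

/-- The positions of the letters `0` in the word which is written by a block. -/
def OutZero (L S : ℤ) : Blk → ℤ → Prop
  | outD, i => S - 1 ≤ i ∧ i < S + 1
  | outT, i => 2 * S - 2 ≤ i ∧ i < 2 * S + 1
  | both, i => L - 1 ≤ i ∧ i < L + 1
  | _, _ => False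

instance decidableInZero (L S : ℤ) : (b : Blk) → (i : ℤ) → Decidable (InZero L S b i)
  | outD, _ => instDecidableFalse
  | outT, _ => instDecidableFalse
  | inD, _ => instDecidableAnd
  | inT, _ => instDecidableAnd
  | both, _ => instDecidableAnd

instance decidableOutOne (L S : ℤ) : (b : Blk) → (i : ℤ) → Decidable (OutOne L S b i)
  | inD, _ => instDecidableFalse
  | inT, _ => instDecidableFalse
  | outD, _ => instDecidableAnd
  | outT, _ => instDecidableAnd
  | both, _ => instDecidableAnd

instance decidableInOne (L S : ℤ) : (b : Blk) → (i : ℤ) → Decidable (InOne L S b i)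
  | outD, _ => instDecidableFalse
  | outT, _ => instDecidableFalse
  | inD, _ => instDecidableAnd
  | inT, _ => instDecidableAnd
  | both, _ => instDecidableAnd

instance decidableOutZero (L S : ℤ) : (b : Blk) → (i : ℤ) → Decidable (OutZero L S b i)
  | inD, _ => instDecidableFalse
  | inT, _ => instDecidableFalse
  | outD, _ => instDecidableAnd
  | outT, _ => instDecidableAnd
  | both, _ => instDecidableAnd

/-- The letters read and written by a block, if `0` is the exceptional letter of the row that is
read and `1` that of the row that is written. -/
def oddWord (L S : ℤ) (b : Blk) : List (ℕ × ℕ) :=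
  (List.range (b.len L S).toNat).map fun i : ℕ =>
    (if b.InZero L S i then 0 else 1, if b.OutOne L S i then 1 else 0)

/-- The letters read and written by a block, if `1` is the exceptional letter of the row that is
read and `0` that of the row that is written. -/
def evenWord (L S : ℤ) (b : Blk) : List (ℕ × ℕ) :=
  (List.range (b.len L S).toNat).map fun i : ℕ =>
    (if b.InOne L S i then 1 else 0, if b.OutZero L S i then 0 else 1)

end Blk

namespace Run

variable {L S : ℤ} {R : Run L S} {b : Blk} {c t : ℤ}

/-- The letters coded by a point stay inside the block that carries it, so a row can be computed
block by block. The three lemmas after this one treat the other codings, with the shift by one on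
the written row. -/
theorem ins_zero_iff (hS : 2 < S) (hL : S < L) (h : R.At b c) (h1 : c ≤ t)
    (h2 : t < c + b.len L S) : R.ins.Zero t ↔ b.InZero L S (t - c) := by
  constructor
  · rintro ((k | k) | (k | k) | k | k | k) <;> have e := h.trichotomy k <;>
      cases b <;> simp only [Blk.len, Blk.InZero, reduceCtorEq, and_false, and_true, false_or]
        at e h2 ⊢ <;> omega
  · intro k
    cases b <;> simp only [Blk.InZero] at k
    · simp only [Pts.Zero, ins]
      rcases (by omega : t + 1 = c + L ∨ t + 2 = c + L) with e | e
      · exact Or.inl (Or.inl (h.congr (by omega)))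
      · exact Or.inr (Or.inl (Or.inl (h.congr (by omega))))
    · simp only [Pts.Zero, ins]
      rcases (by omega : t + 1 = c + L ∨ t + 2 = c + L ∨ t + 3 = c + L) with e | e | e
      · exact Or.inr (Or.inr (Or.inl (h.congr (by omega))))
      · exact Or.inr (Or.inr (Or.inr (Or.inl (h.congr (by omega)))))
      · exact Or.inr (Or.inr (Or.inr (Or.inr (h.congr (by omega)))))
    · simp only [Pts.Zero, ins]
      rcases (by omega : t + 1 = c + (L + S) ∨ t + 2 = c + (L + S)) with e | e
      · exact Or.inl (Or.inr (h.congr (by omega)))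
      · exact Or.inr (Or.inl (Or.inr (h.congr (by omega))))

theorem ins_one_iff (hS : 2 < S) (hL : S < L) (h : R.At b c) (h1 : c ≤ t)
    (h2 : t < c + b.len L S) : R.ins.One t ↔ b.InOne L S (t - c) := by
  constructor
  · rintro ((k | k) | (k | k) | k | k | k) <;> have e := h.trichotomy k <;>
      cases b <;> simp only [Blk.len, Blk.InOne, reduceCtorEq, and_false, and_true, false_or]
        at e h2 ⊢ <;> omega
  · intro k
    cases b <;> simp only [Blk.InOne] at k
    · simp only [Pts.One, ins]
      rcases (by omega : t + 1 = c + L ∨ t + 2 = c + L) with e | e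
      · exact Or.inl (Or.inl (h.congr (by omega)))
      · exact Or.inr (Or.inl (Or.inl (h.congr (by omega))))
    · simp only [Pts.One, ins]
      rcases (by omega : t = c + L ∨ t + 1 = c + L ∨ t + 2 = c + L) with e | e | e
      · exact Or.inr (Or.inr (Or.inl (h.congr (by omega))))
      · exact Or.inr (Or.inr (Or.inr (Or.inl (h.congr (by omega)))))
      · exact Or.inr (Or.inr (Or.inr (Or.inr (h.congr (by omega)))))
    · simp only [Pts.One, ins]
      rcases (by omega : t + 1 = c + (L + S) ∨ t + 2 = c + (L + S)) with e | e
      · exact Or.inl (Or.inr (h.congr (by omega)))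
      · exact Or.inr (Or.inl (Or.inr (h.congr (by omega))))

theorem outs_one_iff (hS : 2 < S) (hL : S < L) (h : R.At b c) (h1 : c ≤ t)
    (h2 : t < c + b.len L S) : (R.outs.shift (-1)).One t ↔ b.OutOne L S (t - c) := by
  constructor
  · rintro ((k | k) | (k | k) | k | k | k) <;> have e := h.trichotomy k <;>
      cases b <;> simp only [Blk.len, Blk.OutOne, reduceCtorEq, and_false, and_true, false_or]
        at e h2 ⊢ <;> omega
  · intro k
    cases b <;> simp only [Blk.OutOne] at k
    · simp only [Pts.One, Pts.shift, outs]
      rcases (by omega : t + 2 = c + S ∨ t + 3 = c + S) with e | e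
      · exact Or.inl (Or.inl (h.congr (by omega)))
      · exact Or.inr (Or.inl (Or.inl (h.congr (by omega))))
    · simp only [Pts.One, Pts.shift, outs]
      rcases (by omega : t + 1 = c + 2 * S ∨ t + 2 = c + 2 * S ∨ t + 3 = c + 2 * S) with e | e | e
      · exact Or.inr (Or.inr (Or.inl (h.congr (by omega))))
      · exact Or.inr (Or.inr (Or.inr (Or.inl (h.congr (by omega)))))
      · exact Or.inr (Or.inr (Or.inr (Or.inr (h.congr (by omega)))))
    · simp only [Pts.One, Pts.shift, outs]
      rcases (by omega : t + 2 = c + L ∨ t + 3 = c + L) with e | e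
      · exact Or.inl (Or.inr (h.congr (by omega)))
      · exact Or.inr (Or.inl (Or.inr (h.congr (by omega))))

theorem outs_zero_iff (hS : 2 < S) (hL : S + 1 < L) (h : R.At b c) (h1 : c ≤ t)
    (h2 : t < c + b.len L S) : (R.outs.shift 1).Zero t ↔ b.OutZero L S (t - c) := by
  constructor
  · rintro ((k | k) | (k | k) | k | k | k) <;> have e := h.trichotomy k <;>
      cases b <;> simp only [Blk.len, Blk.OutZero, reduceCtorEq, and_false, and_true, false_or]
        at e h2 ⊢ <;> omega
  · intro k
    cases b <;> simp only [Blk.OutZero] at k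
    · simp only [Pts.Zero, Pts.shift, outs]
      rcases (by omega : t = c + S ∨ t + 1 = c + S) with e | e
      · exact Or.inl (Or.inl (h.congr (by omega)))
      · exact Or.inr (Or.inl (Or.inl (h.congr (by omega))))
    · simp only [Pts.Zero, Pts.shift, outs]
      rcases (by omega : t = c + 2 * S ∨ t + 1 = c + 2 * S ∨ t + 2 = c + 2 * S) with e | e | e
      · exact Or.inr (Or.inr (Or.inl (h.congr (by omega))))
      · exact Or.inr (Or.inr (Or.inr (Or.inl (h.congr (by omega)))))
      · exact Or.inr (Or.inr (Or.inr (Or.inr (h.congr (by omega)))))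
    · simp only [Pts.Zero, Pts.shift, outs]
      rcases (by omega : t = c + L ∨ t + 1 = c + L) with e | e
      · exact Or.inl (Or.inr (h.congr (by omega)))
      · exact Or.inr (Or.inl (Or.inr (h.congr (by omega))))

end Run

/-! ### Labelled graphs -/

/-- An edge of a labelled graph: source, target, letter that is read, letter that is written. -/
abbrev Edge := ℕ × ℕ × Fin 2 × Fin 2

/-- A bi-infinite path of a labelled graph, with its two rows of labels. -/
def IsPath (E : List Edge) (q : ℤ → ℕ) (x z : ℤ → Fin 2) : Prop :=
  ∀ t, (q t, q (t + 1), x t, z t) ∈ E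

/-- The set of the sources of the edges, as a bit mask. -/
def srcMask (E : List Edge) : ℕ := E.foldl (fun m e => m ||| 1 <<< e.1) 0

/-- The set of the targets of the edges, as a bit mask. -/
def dstMask (E : List Edge) : ℕ := E.foldl (fun m e => m ||| 1 <<< e.2.1) 0

/-- Keep the edges which have a predecessor and a successor. -/
def trimOnce (E : List Edge) : List Edge :=
  E.filter fun e => (dstMask E).testBit e.1 && (srcMask E).testBit e.2.1

/-- Composition of labelled graphs. -/
def compose (K : ℕ) (E E' : List Edge) : List Edge :=
  E.flatMap fun e => E'.filterMap fun e' =>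
    if e.2.2.2 = e'.2.2.1 then some (e.1 * K + e'.1, e.2.1 * K + e'.2.1, e.2.2.1, e'.2.2.2) else none

theorem testBit_foldl_mask (f : Edge → ℕ) (E : List Edge) (m i : ℕ) :
    (E.foldl (fun m e => m ||| 1 <<< f e) m).testBit i = true ↔
      m.testBit i = true ∨ ∃ e ∈ E, f e = i := by
  induction E generalizing m with
  | nil => simp
  | cons e E ih =>
    rw [List.foldl_cons, ih]
    simp only [Nat.testBit_or, Nat.shiftLeft_eq, one_mul, Nat.testBit_two_pow, Bool.or_eq_true,
      decide_eq_true_eq, List.mem_cons, exists_eq_or_imp, or_assoc]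

theorem testBit_srcMask {E : List Edge} {i : ℕ} :
    (srcMask E).testBit i = true ↔ ∃ e ∈ E, e.1 = i := by
  rw [srcMask, testBit_foldl_mask]
  simp

theorem testBit_dstMask {E : List Edge} {i : ℕ} :
    (dstMask E).testBit i = true ↔ ∃ e ∈ E, e.2.1 = i := by
  rw [dstMask, testBit_foldl_mask]
  simp

namespace IsPath

variable {E E' : List Edge} {q q' : ℤ → ℕ} {x y z : ℤ → Fin 2}

/-- Each edge of a bi-infinite path has a predecessor and a successor, so trimming loses no path. A
graph that trims to nothing carries no path at all. -/
theorem trimOnce (h : IsPath E q x z) : IsPath (trimOnce E) q x z := by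
  intro t
  refine List.mem_filter.2 ⟨h t, ?_⟩
  rw [Bool.and_eq_true, testBit_dstMask, testBit_srcMask]
  refine ⟨⟨_, h (t - 1), ?_⟩, ⟨_, h (t + 1), rfl⟩⟩
  simp

theorem trim (h : IsPath E q x z) (n : ℕ) : IsPath (_root_.trimOnce^[n] E) q x z := by
  induction n with
  | zero => exact h
  | succ n ih =>
    rw [Function.iterate_succ_apply']
    exact ih.trimOnce

theorem compose (K : ℕ) (h : IsPath E q x y) (h' : IsPath E' q' y z) :
    IsPath (compose K E E') (fun t => q t * K + q' t) x z := by
  intro t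
  refine List.mem_flatMap.2 ⟨_, h t, List.mem_filterMap.2 ⟨_, h' t, ?_⟩⟩
  simp

theorem false_of_nil (h : IsPath [] q x z) : False := by
  have := h 0
  simp at this

end IsPath

/-! ### First visits to a marker state -/

/-- The words read and written from the state `s` up to the first visit of the state `J`; the
words which are not complete after `n` letters are marked by a final letter `2`. -/
def firstVisit (E : List Edge) (J : ℕ) : ℕ → ℕ → List (List (ℕ × ℕ))
  | 0, _ => [[(2, 2)]]
  | n + 1, s => E.flatMap fun e =>
      if e.1 = s then
        if e.2.1 = J then [[(e.2.2.1.val, e.2.2.2.val)]]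
        else (firstVisit E J n e.2.1).map ((e.2.2.1.val, e.2.2.2.val) :: ·)
      else []

/-- The word `w` is read and written from the position `t` up to the first visit of `J`. -/
def FirstVisit (J : ℕ) (q : ℤ → ℕ) (x z : ℤ → Fin 2) : List (ℕ × ℕ) → ℤ → Prop
  | [], _ => False
  | [p], t => ((x t).val, (z t).val) = p ∧ q (t + 1) = J
  | p :: w, t => ((x t).val, (z t).val) = p ∧ q (t + 1) ≠ J ∧ FirstVisit J q x z w (t + 1)

/-- The number `n` is fuel. The hypothesis `hn` says that no enumerated word was cut off, which
means that every path reaches `J` in time. -/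
theorem IsPath.exists_firstVisit {E : List Edge} {q : ℤ → ℕ} {x z : ℤ → Fin 2}
    (h : IsPath E q x z) (J n : ℕ) (t : ℤ) (hn : ∀ w ∈ firstVisit E J n (q t), (2, 2) ∉ w) :
    ∃ w ∈ firstVisit E J n (q t), FirstVisit J q x z w t := by
  induction n generalizing t with
  | zero => exact absurd (List.mem_singleton_self _) (hn _ (List.mem_singleton_self _))
  | succ n ih =>
    by_cases hJ : q (t + 1) = J
    · refine ⟨[((x t).val, (z t).val)], List.mem_flatMap.2 ⟨_, h t, ?_⟩, rfl, hJ⟩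
      simp [hJ]
    · have hsub : ∀ w ∈ firstVisit E J n (q (t + 1)),
          ((x t).val, (z t).val) :: w ∈ firstVisit E J (n + 1) (q t) := by
        intro w hw
        refine List.mem_flatMap.2 ⟨_, h t, ?_⟩
        simp [hJ, hw]
      obtain ⟨w, hw, hv⟩ := ih (t + 1) fun w hw h2 =>
        hn _ (hsub w hw) (List.mem_cons_of_mem _ h2)
      refine ⟨_, hsub w hw, ?_⟩
      cases w with
      | nil => exact hv.elim
      | cons p w => exact ⟨rfl, hJ, hv⟩

namespace FirstVisit

variable {J : ℕ} {q : ℤ → ℕ} {x z : ℤ → Fin 2}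

theorem end_eq {w : List (ℕ × ℕ)} {t : ℤ} (h : FirstVisit J q x z w t) : q (t + w.length) = J := by
  induction w generalizing t with
  | nil => exact h.elim
  | cons p w ih =>
    cases w with
    | nil => simpa using h.2
    | cons p' w =>
      rw [← ih h.2.2]
      congr 1
      push_cast [List.length_cons]
      ring

theorem ne_of_lt {w : List (ℕ × ℕ)} {t u : ℤ} (h : FirstVisit J q x z w t) (h1 : t < u)
    (h2 : u < t + w.length) : q u ≠ J := by
  induction w generalizing t with
  | nil => exact h.elim
  | cons p w ih =>
    cases w with
    | nil => simp only [List.length_cons, List.length_nil] at h2; push_cast at h2; omega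
    | cons p' w =>
      rcases eq_or_lt_of_le (by omega : t + 1 ≤ u) with rfl | h3
      · exact h.2.1
      · exact ih h.2.2 h3 (by simp only [List.length_cons] at h2 ⊢; push_cast at h2 ⊢; omega)

theorem length_pos {w : List (ℕ × ℕ)} {t : ℤ} (h : FirstVisit J q x z w t) : 0 < w.length := by
  cases w with
  | nil => exact h.elim
  | cons p w => simp

theorem letter {w : List (ℕ × ℕ)} {t : ℤ} (h : FirstVisit J q x z w t) {i : ℕ}
    (hi : i < w.length) : ((x (t + i)).val, (z (t + i)).val) = w[i] := by
  induction w generalizing t i with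
  | nil => exact h.elim
  | cons p w ih =>
    have hp : ((x t).val, (z t).val) = p := by
      cases w with
      | nil => exact h.1
      | cons p' w => exact h.1
    cases i with
    | zero => simpa using hp
    | succ i =>
      cases w with
      | nil => simp at hi
      | cons p' w =>
        have e : t + ((i + 1 : ℕ) : ℤ) = t + 1 + i := by push_cast; ring
        rw [e, ih h.2.2 (by simpa using hi)]
        rfl

theorem unique {w w' : List (ℕ × ℕ)} {t : ℤ} (h : FirstVisit J q x z w t)
    (h' : FirstVisit J q x z w' t) : w = w' := by
  have hl : w.length = w'.length := by
    have a := h.length_pos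
    have b := h'.length_pos
    rcases lt_trichotomy w.length w'.length with k | k | k
    · exact absurd h.end_eq (h'.ne_of_lt (by omega) (by omega))
    · exact k
    · exact absurd h'.end_eq (h.ne_of_lt (by omega) (by omega))
  refine List.ext_getElem hl fun i h1 h2 => ?_
  rw [← h.letter h1, ← h'.letter h2]

end FirstVisit

/-- The run whose blocks are the words between consecutive visits of a state. -/
def runOfPath {L S : ℤ} {E : List Edge} {q : ℤ → ℕ} {x z : ℤ → Fin 2} (J n : ℕ)
    (h : IsPath E q x z) (hn : ∀ e ∈ E, ∀ w ∈ firstVisit E J n e.1, (2, 2) ∉ w)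
    (wd : Blk → List (ℕ × ℕ)) (hwd : ∀ b, ((wd b).length : ℤ) = b.len L S)
    (inj : ∀ b b', wd b = wd b' → b' = b)
    (hJ : ∀ t, q t = J → ∃ b, FirstVisit J q x z (wd b) t) : Run L S where
  At b c := q c = J ∧ FirstVisit J q x z (wd b) c
  next {b c} hb := by
    have e := hb.2.end_eq
    rw [hwd] at e
    obtain ⟨b', h'⟩ := hJ _ e
    exact ⟨b', e, h'⟩
  prev {b c} hb := by
    have hbound : ∀ m : ℕ, ∀ s, ∀ w ∈ firstVisit E J m s, w.length ≤ m + 1 := by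
      intro m
      induction m with
      | zero => intro s w hw; simp [firstVisit] at hw; simp [hw]
      | succ m ih =>
        intro s w hw
        obtain ⟨e, -, he⟩ := List.mem_flatMap.1 hw
        split_ifs at he
        · simp at he; simp [he]
        · obtain ⟨v, hv, rfl⟩ := List.mem_map.1 he
          have := ih _ _ hv
          simp only [List.length_cons]
          omega
        · simp at he
    -- A first-visit word has at most `n + 1` letters, so starting `n + 2` steps before `c` gives a
    -- visit of `J` strictly before `c`. The last such visit starts the preceding block.
    obtain ⟨w, hw, hv⟩ := h.exists_firstVisit J n (c - (n + 2)) (hn _ (h _))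
    have hwl := hbound _ _ _ hw
    obtain ⟨u, ⟨hu1, hu2⟩, hu3⟩ := Int.exists_greatest_of_bdd (P := fun u => q u = J ∧ u < c)
      ⟨c, fun u hu => hu.2.le⟩ ⟨_, hv.end_eq, by omega⟩
    obtain ⟨b', h'⟩ := hJ u hu1
    have hend := h'.end_eq
    have hpos := h'.length_pos
    rcases lt_trichotomy (u + (wd b').length) c with k | k | k
    · have := hu3 _ ⟨hend, k⟩
      omega
    · refine ⟨b', ?_⟩
      rw [← hwd b']
      have e : c - ((wd b').length : ℤ) = u := by omega
      rw [e]
      exact ⟨hu1, h'⟩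
    · exact absurd hb.1 (h'.ne_of_lt hu2 k)
  disj {b c b' c'} hb hb' h1 h2 := by
    rw [← hwd b] at h2
    have e : c' = c := by
      by_contra hne
      exact hb.2.ne_of_lt (by omega) h2 hb'.1
    subst e
    exact ⟨rfl, inj _ _ (hb.2.unique hb'.2)⟩
  nonempty := by
    obtain ⟨w, -, hv⟩ := h.exists_firstVisit J n 0 (hn _ (h _))
    have e := hv.end_eq
    obtain ⟨b', h'⟩ := hJ _ e
    exact ⟨b', _, e, h'⟩

/-! ### The graphs of the transducers -/

/-- Numbering of the states of `transducerA`. -/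
def StateA.code : StateA → ℕ
  | .a => 0 | .b => 1 | .c => 2 | .d => 3 | .e => 4 | .f => 5 | .g => 6 | .h => 7 | .i => 8 | .j => 9

/-- Numbering of the states of `transducerB`. -/
def StateB.code : StateB → ℕ
  | .K => 0 | .L => 1 | .M => 2 | .M' => 3 | .N => 4 | .O => 5 | .O' => 6 | .P => 7 | .Q => 8 | .R => 9

/-- The edges of `transducerA`. -/
def edgesA : List Edge :=
  [(0, 1, 1, 0), (5, 1, 1, 1), (6, 0, 1, 1), (4, 5, 1, 1), (2, 3, 1, 0), (1, 2, 1, 0), (1, 6, 1, 1),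
    (3, 4, 1, 1), (8, 9, 0, 0), (2, 8, 0, 0), (3, 7, 0, 0), (9, 0, 0, 0), (7, 2, 0, 0), (7, 6, 0, 1)]

/-- The edges of `transducerB`. -/
def edgesB : List Edge :=
  [(7, 9, 1, 1), (3, 0, 1, 1), (9, 2, 1, 1), (8, 6, 0, 0), (4, 5, 0, 1), (7, 8, 0, 1), (2, 4, 0, 1),
    (9, 1, 0, 0), (0, 1, 0, 1), (5, 9, 0, 0), (5, 7, 0, 1), (1, 2, 0, 1), (6, 9, 0, 0), (9, 3, 1, 1)]

/-- Inverse of `StateA.code`. -/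
def StateA.ofCode : ℕ → StateA
  | 0 => .a | 1 => .b | 2 => .c | 3 => .d | 4 => .e | 5 => .f | 6 => .g | 7 => .h | 8 => .i | _ => .j

/-- Inverse of `StateB.code`. -/
def StateB.ofCode : ℕ → StateB
  | 0 => .K | 1 => .L | 2 => .M | 3 => .M' | 4 => .N | 5 => .O | 6 => .O' | 7 => .P | 8 => .Q | _ => .R

theorem mem_edgesA_of_mem {t : WangTile StateA (Fin 2)} (h : t ∈ transducerA) :
    (t.w.code, t.e.code, t.s, t.n) ∈ edgesA := by
  rcases h with rfl | rfl | rfl | rfl | rfl | rfl | rfl | rfl | rfl | rfl | rfl | rfl | rfl | rfl <;>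
    decide

theorem mem_edgesB_of_mem {t : WangTile StateB (Fin 2)} (h : t ∈ transducerB) :
    (t.w.code, t.e.code, t.s, t.n) ∈ edgesB := by
  rcases h with rfl | rfl | rfl | rfl | rfl | rfl | rfl | rfl | rfl | rfl | rfl | rfl | rfl | rfl <;>
    decide

theorem mem_transducerA_of_mem {e : Edge} (h : e ∈ edgesA) :
    (⟨.ofCode e.1, .ofCode e.2.1, e.2.2.1, e.2.2.2⟩ : WangTile StateA (Fin 2)) ∈ transducerA := by
  simp only [edgesA, List.mem_cons, List.not_mem_nil, or_false] at h
  rcases h with rfl | rfl | rfl | rfl | rfl | rfl | rfl | rfl | rfl | rfl | rfl | rfl | rfl | rfl <;>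
    simp [transducerA, StateA.ofCode]

theorem mem_transducerB_of_mem {e : Edge} (h : e ∈ edgesB) :
    (⟨.ofCode e.1, .ofCode e.2.1, e.2.2.1, e.2.2.2⟩ : WangTile StateB (Fin 2)) ∈ transducerB := by
  simp only [edgesB, List.mem_cons, List.not_mem_nil, or_false] at h
  rcases h with rfl | rfl | rfl | rfl | rfl | rfl | rfl | rfl | rfl | rfl | rfl | rfl | rfl | rfl <;>
    simp [transducerB, StateB.ofCode]

/-- The edges of the transducer named by a letter. -/
def edges : Letter → List Edge
  | .a => edgesA
  | .b => edgesB

/-- The row `z` can be written by the transducer named by `l` when it reads the row `x`. -/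
def RowRel (l : Letter) (x z : ℤ → Fin 2) : Prop := ∃ q, IsPath (edges l) q x z

/-- The graph of the composition `aa`. -/
def edgesAA : List Edge := trimOnce^[20] (compose 10 edgesA edgesA)

/-- The graph of the composition `ba`. -/
def edgesBA : List Edge := trimOnce^[20] (compose 10 edgesB edgesA)

/-- The graph of the composition `bab`. -/
def edgesBAB : List Edge := trimOnce^[60] (compose 10 edgesBA edgesB)

/-- Excluding `bb`, and below it `aaa` and `babab`, is all that is needed about forbidden words to
start the hierarchy; longer ones are excluded by `Triple.hi_ne_lo`. -/
theorem edgesBB_eq_nil : trimOnce^[60] (compose 10 edgesB edgesB) = [] := by decide +kernel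

theorem edgesAAA_eq_nil : trimOnce^[60] (compose 10 edgesAA edgesA) = [] := by decide +kernel

theorem edgesBABAB_eq_nil :
    trimOnce^[60] (compose 10 (compose 10 edgesBAB edgesA) edgesB) = [] := by decide +kernel

section

variable {x y z u v w : ℤ → Fin 2}

theorem exists_isPath_AA (h1 : RowRel .a x y) (h2 : RowRel .a y z) : ∃ q, IsPath edgesAA q x z := by
  obtain ⟨q1, h1⟩ := h1
  obtain ⟨q2, h2⟩ := h2
  exact ⟨_, (h1.compose 10 h2).trim 20⟩

theorem exists_isPath_BAB (h1 : RowRel .b x y) (h2 : RowRel .a y z) (h3 : RowRel .b z u) :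
    ∃ q, IsPath edgesBAB q x u := by
  obtain ⟨q1, h1⟩ := h1
  obtain ⟨q2, h2⟩ := h2
  obtain ⟨q3, h3⟩ := h3
  exact ⟨_, (((h1.compose 10 h2).trim 20).compose 10 h3).trim 60⟩

theorem not_rowRel_BB (h1 : RowRel .b x y) (h2 : RowRel .b y z) : False := by
  obtain ⟨q1, h1⟩ := h1
  obtain ⟨q2, h2⟩ := h2
  have h := (h1.compose 10 h2).trim 60
  rw [show trimOnce^[60] (compose 10 (edges .b) (edges .b)) = [] from edgesBB_eq_nil] at h
  exact h.false_of_nil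

theorem not_rowRel_AAA (h1 : RowRel .a x y) (h2 : RowRel .a y z) (h3 : RowRel .a z u) : False := by
  obtain ⟨q, h⟩ := exists_isPath_AA h1 h2
  obtain ⟨q3, h3⟩ := h3
  have h := (h.compose 10 h3).trim 60
  rw [show trimOnce^[60] (compose 10 edgesAA (edges .a)) = [] from edgesAAA_eq_nil] at h
  exact h.false_of_nil

theorem not_rowRel_BABAB (h1 : RowRel .b x y) (h2 : RowRel .a y z) (h3 : RowRel .b z u)
    (h4 : RowRel .a u v) (h5 : RowRel .b v w) : False := by
  obtain ⟨q, h⟩ := exists_isPath_BAB h1 h2 h3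
  obtain ⟨q4, h4⟩ := h4
  obtain ⟨q5, h5⟩ := h5
  have h := ((h.compose 10 h4).compose 10 h5).trim 60
  rw [show trimOnce^[60] (compose 10 (compose 10 edgesBAB (edges .a)) (edges .b)) = [] from
    edgesBABAB_eq_nil] at h
  exact h.false_of_nil

end

/-! ### Rows of the composites as runs -/

theorem Blk.length_oddWord {L S : ℤ} (hS : 0 < S) (hL : S < L) (b : Blk) :
    ((b.oddWord L S).length : ℤ) = b.len L S := by
  have := b.len_pos hS hL
  rw [oddWord, List.length_map, List.length_range]
  omega

theorem Blk.length_evenWord {L S : ℤ} (hS : 0 < S) (hL : S < L) (b : Blk) :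
    ((b.evenWord L S).length : ℤ) = b.len L S := by
  have := b.len_pos hS hL
  rw [evenWord, List.length_map, List.length_range]
  omega

/-- The rows `x`, `z` are read and written by the run `R`, with exceptional letters `0` and `1`. -/
def OddRows {L S : ℤ} (R : Run L S) (x z : ℤ → Fin 2) : Prop :=
  (∀ t, x t = 0 ↔ R.ins.Zero t) ∧ ∀ t, z t = 1 ↔ (R.outs.shift (-1)).One t

/-- The rows `x`, `z` are read and written by the run `R`, with exceptional letters `1` and `0`. -/
def EvenRows {L S : ℤ} (R : Run L S) (x z : ℤ → Fin 2) : Prop :=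
  (∀ t, x t = 1 ↔ R.ins.One t) ∧ ∀ t, z t = 0 ↔ (R.outs.shift 1).Zero t

section

variable {L S : ℤ} {R : Run L S} {x z : ℤ → Fin 2}

theorem oddRows_iff (hS : 2 < S) (hL : S < L) :
    OddRows R x z ↔ ∀ b c, R.At b c → ∀ i (hi : i < (b.oddWord L S).length),
      ((x (c + i)).val, (z (c + i)).val) = (b.oddWord L S)[i] := by
  have e0 : ∀ (f : Fin 2) (p : Prop) [Decidable p], f.val = (if p then 0 else 1) ↔ (f = 0 ↔ p) := by
    intro f p _
    fin_cases f <;> by_cases hp : p <;> simp [hp]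
  have e1 : ∀ (f : Fin 2) (p : Prop) [Decidable p], f.val = (if p then 1 else 0) ↔ (f = 1 ↔ p) := by
    intro f p _
    fin_cases f <;> by_cases hp : p <;> simp [hp]
  have key : ∀ b c, R.At b c → ∀ i : ℕ, (hi : i < (b.oddWord L S).length) →
      (((x (c + i)).val, (z (c + i)).val) = (b.oddWord L S)[i] ↔
        (x (c + i) = 0 ↔ R.ins.Zero (c + i)) ∧
          (z (c + i) = 1 ↔ (R.outs.shift (-1)).One (c + i))) := by
    intro b c h i hi
    have hl := b.length_oddWord (by omega : 0 < S) hL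
    rw [Run.ins_zero_iff hS hL h (by omega) (by omega),
      Run.outs_one_iff hS hL h (by omega) (by omega)]
    have e : c + (i : ℤ) - c = i := by ring
    simp only [Blk.oddWord, List.getElem_map, List.getElem_range, Prod.mk.injEq, e, e0, e1]
  constructor
  · intro h b c hb i hi
    exact (key b c hb i hi).2 ⟨h.1 _, h.2 _⟩
  · intro h
    have all : ∀ t, (x t = 0 ↔ R.ins.Zero t) ∧ (z t = 1 ↔ (R.outs.shift (-1)).One t) := by
      intro t
      obtain ⟨b, c, hb, h1, h2⟩ := R.cover (by omega) hL t
      have hl := b.length_oddWord (by omega : 0 < S) hL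
      have hi : (t - c).toNat < (b.oddWord L S).length := by omega
      have := (key b c hb _ hi).1 (h b c hb _ hi)
      rwa [show c + ((t - c).toNat : ℤ) = t by omega] at this
    exact ⟨fun t => (all t).1, fun t => (all t).2⟩

theorem evenRows_iff (hS : 2 < S) (hL : S + 1 < L) :
    EvenRows R x z ↔ ∀ b c, R.At b c → ∀ i (hi : i < (b.evenWord L S).length),
      ((x (c + i)).val, (z (c + i)).val) = (b.evenWord L S)[i] := by
  have hL' : S < L := by omega
  have e0 : ∀ (f : Fin 2) (p : Prop) [Decidable p], f.val = (if p then 0 else 1) ↔ (f = 0 ↔ p) := by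
    intro f p _
    fin_cases f <;> by_cases hp : p <;> simp [hp]
  have e1 : ∀ (f : Fin 2) (p : Prop) [Decidable p], f.val = (if p then 1 else 0) ↔ (f = 1 ↔ p) := by
    intro f p _
    fin_cases f <;> by_cases hp : p <;> simp [hp]
  have key : ∀ b c, R.At b c → ∀ i : ℕ, (hi : i < (b.evenWord L S).length) →
      (((x (c + i)).val, (z (c + i)).val) = (b.evenWord L S)[i] ↔
        (x (c + i) = 1 ↔ R.ins.One (c + i)) ∧
          (z (c + i) = 0 ↔ (R.outs.shift 1).Zero (c + i))) := by
    intro b c h i hi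
    have hl := b.length_evenWord (by omega : 0 < S) hL'
    rw [Run.ins_one_iff hS hL' h (by omega) (by omega),
      Run.outs_zero_iff hS hL h (by omega) (by omega)]
    have e : c + (i : ℤ) - c = i := by ring
    simp only [Blk.evenWord, List.getElem_map, List.getElem_range, Prod.mk.injEq, e, e0, e1]
  constructor
  · intro h b c hb i hi
    exact (key b c hb i hi).2 ⟨h.1 _, h.2 _⟩
  · intro h
    have all : ∀ t, (x t = 1 ↔ R.ins.One t) ∧ (z t = 0 ↔ (R.outs.shift 1).Zero t) := by
      intro t
      obtain ⟨b, c, hb, h1, h2⟩ := R.cover (by omega) hL' t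
      have hl := b.length_evenWord (by omega : 0 < S) hL'
      have hi : (t - c).toNat < (b.evenWord L S).length := by omega
      have := (key b c hb _ hi).1 (h b c hb _ hi)
      rwa [show c + ((t - c).toNat : ℤ) = t by omega] at this
    exact ⟨fun t => (all t).1, fun t => (all t).2⟩

end

/-! ### Finite computations on the composites `aa`, `bab` and `b` -/

/-- All blocks. -/
def Blk.all : List Blk := [.outD, .inD, .outT, .inT, .both]

theorem Blk.mem_all (b : Blk) : b ∈ Blk.all := by cases b <;> decide

theorem Blk.oddWord_injective :
    ∀ b b' : Blk, b.oddWord 8 5 = b'.oddWord 8 5 → b' = b := by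
  have h : ∀ b ∈ Blk.all, ∀ b' ∈ Blk.all, b.oddWord 8 5 = b'.oddWord 8 5 → b' = b := by
    decide +kernel
  exact fun b b' => h b b.mem_all b' b'.mem_all

theorem Blk.evenWord_injective_BAB :
    ∀ b b' : Blk, b.evenWord 13 8 = b'.evenWord 13 8 → b' = b := by
  have h : ∀ b ∈ Blk.all, ∀ b' ∈ Blk.all, b.evenWord 13 8 = b'.evenWord 13 8 → b' = b := by
    decide +kernel
  exact fun b b' => h b b.mem_all b' b'.mem_all

theorem Blk.evenWord_injective_B :
    ∀ b b' : Blk, b.evenWord 5 3 = b'.evenWord 5 3 → b' = b := by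
  have h : ∀ b ∈ Blk.all, ∀ b' ∈ Blk.all, b.evenWord 5 3 = b'.evenWord 5 3 → b' = b := by
    decide +kernel
  exact fun b b' => h b b.mem_all b' b'.mem_all

/-- State `29` stands for the pair `c`, `j`. The return words to this state are words of blocks of
scale `(8, 5)`, which identifies level `1` with runs. -/
theorem firstVisit_AA : ∀ w ∈ firstVisit edgesAA 29 20 29, ∃ b ∈ Blk.all, w = b.oddWord 8 5 := by
  decide +kernel

theorem firstVisit_AA_complete : ∀ e ∈ edgesAA, ∀ w ∈ firstVisit edgesAA 29 20 e.1, (2, 2) ∉ w := by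
  decide +kernel

/-- State `237` stands for the states `M`, `d`, `P` of the three layers. -/
theorem firstVisit_BAB :
    ∀ w ∈ firstVisit edgesBAB 237 30 237, ∃ b ∈ Blk.all, w = b.evenWord 13 8 := by
  decide +kernel

theorem firstVisit_BAB_complete :
    ∀ e ∈ edgesBAB, ∀ w ∈ firstVisit edgesBAB 237 30 e.1, (2, 2) ∉ w := by
  decide +kernel

theorem firstVisit_B_complete : ∀ e ∈ edgesB, ∀ w ∈ firstVisit edgesB 2 20 e.1, (2, 2) ∉ w := by
  decide +kernel

/-- Every word between two visits of the state `M` of `transducerB` is the word of a block, or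
there is an isolated `1` on the row that is read or an isolated `0` on the row that is written. -/
theorem firstVisit_B : ∀ w ∈ firstVisit edgesB 2 20 2, (∃ b ∈ Blk.all, w = b.evenWord 5 3) ∨
    (∃ i ∈ List.range (w.length - 1), Option.map Prod.fst w[i]? = some 0 ∧
      Option.map Prod.fst w[i + 1]? = some 1 ∧ (Option.map Prod.fst w[i + 2]?).getD 0 = 0) ∨
    (∃ i ∈ List.range (w.length - 2), Option.map Prod.snd w[i]? = some 1 ∧
      Option.map Prod.snd w[i + 1]? = some 0 ∧ Option.map Prod.snd w[i + 2]? = some 1) := by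
  decide +kernel

/-- Justifies the default letter `0` in `firstVisit_B`: the letter just after a return word is read
from the state `M`. -/
theorem edgesB_M : ∀ e ∈ edgesB, e.1 = 2 → e.2.2.1 = 0 := by
  decide +kernel

section

variable {x y z u : ℤ → Fin 2}

theorem exists_oddRows_AA (h1 : RowRel .a x y) (h2 : RowRel .a y z) :
    ∃ R : Run 8 5, OddRows R x z := by
  obtain ⟨q, h⟩ := exists_isPath_AA h1 h2
  have hlen := Blk.length_oddWord (L := 8) (S := 5) (by norm_num) (by norm_num)
  have hJ : ∀ t, q t = 29 → ∃ b : Blk, FirstVisit 29 q x z (b.oddWord 8 5) t := by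
    intro t ht
    obtain ⟨w, hw, hv⟩ := h.exists_firstVisit 29 20 t (firstVisit_AA_complete (q t, q (t + 1), x t, z t) (h t))
    rw [ht] at hw
    obtain ⟨b, -, rfl⟩ := firstVisit_AA w hw
    exact ⟨b, hv⟩
  refine ⟨runOfPath 29 20 h firstVisit_AA_complete (Blk.oddWord 8 5) hlen
    Blk.oddWord_injective hJ, ?_⟩
  rw [oddRows_iff (by norm_num) (by norm_num)]
  intro b c hb i hi
  exact hb.2.letter hi

theorem exists_evenRows_BAB (h1 : RowRel .b x y) (h2 : RowRel .a y z) (h3 : RowRel .b z u) :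
    ∃ R : Run 13 8, EvenRows R x u := by
  obtain ⟨q, h⟩ := exists_isPath_BAB h1 h2 h3
  have hlen := Blk.length_evenWord (L := 13) (S := 8) (by norm_num) (by norm_num)
  have hJ : ∀ t, q t = 237 → ∃ b : Blk, FirstVisit 237 q x u (b.evenWord 13 8) t := by
    intro t ht
    obtain ⟨w, hw, hv⟩ := h.exists_firstVisit 237 30 t (firstVisit_BAB_complete (q t, q (t + 1), x t, u t) (h t))
    rw [ht] at hw
    obtain ⟨b, -, rfl⟩ := firstVisit_BAB w hw
    exact ⟨b, hv⟩
  refine ⟨runOfPath 237 30 h firstVisit_BAB_complete (Blk.evenWord 13 8) hlen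
    Blk.evenWord_injective_BAB hJ, ?_⟩
  rw [evenRows_iff (by norm_num) (by norm_num)]
  intro b c hb i hi
  exact hb.2.letter hi

/-- The transducer `b` alone has return words that are no block, but each of them creates an
isolated letter. The hypotheses `hx` and `hz` exclude this; they hold when both neighbours are
composites `aa`. -/
theorem exists_evenRows_B (h1 : RowRel .b x z)
    (hx : ∀ t, x t = 1 → x (t - 1) = 1 ∨ x (t + 1) = 1)
    (hz : ∀ t, z t = 0 → z (t - 1) = 0 ∨ z (t + 1) = 0) : ∃ R : Run 5 3, EvenRows R x z := by
  obtain ⟨q, h⟩ := h1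
  have hlen := Blk.length_evenWord (L := 5) (S := 3) (by norm_num) (by norm_num)
  have hJ : ∀ t, q t = 2 → ∃ b : Blk, FirstVisit 2 q x z (b.evenWord 5 3) t := by
    intro t ht
    obtain ⟨w, hw, hv⟩ := h.exists_firstVisit 2 20 t (firstVisit_B_complete (q t, q (t + 1), x t, z t) (h t))
    rw [ht] at hw
    have letter : ∀ {i : ℕ} {p}, w[i]? = some p → ((x (t + i)).val, (z (t + i)).val) = p := by
      intro i p hp
      obtain ⟨hi, rfl⟩ := List.getElem?_eq_some_iff.1 hp
      exact hv.letter hi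
    rcases firstVisit_B w hw with ⟨b, -, rfl⟩ | ⟨i, hi, k1, k2, k3⟩ | ⟨i, hi, k1, k2, k3⟩
    · exact ⟨b, hv⟩
    · exfalso
      obtain ⟨p1, l1, m1⟩ := Option.map_eq_some_iff.1 k1
      obtain ⟨p2, l2, m2⟩ := Option.map_eq_some_iff.1 k2
      have n1 := congrArg Prod.fst (letter l1)
      have n2 := congrArg Prod.fst (letter l2)
      simp only [m1, m2] at n1 n2
      -- If the position lies past the end of the word, it is the first letter read from `M`, which
      -- is `0`.
      have n3 : x (t + ((i + 2 : ℕ) : ℤ)) = 0 := by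
        rcases lt_or_ge (i + 2) w.length with hlt | hge
        · have l3 : w[i + 2]? = some w[i + 2] := List.getElem?_eq_getElem hlt
          have n3 := congrArg Prod.fst (letter l3)
          rw [l3] at k3
          simp only [Option.map_some, Option.getD_some] at k3
          rw [k3] at n3
          exact Fin.ext n3
        · have hi' := List.mem_range.1 hi
          have e : t + ((i + 2 : ℕ) : ℤ) = t + w.length := by omega
          rw [e]
          exact edgesB_M _ (h (t + w.length)) hv.end_eq
      have a2 : x (t + ((i + 1 : ℕ) : ℤ)) = 1 := Fin.ext n2
      rcases hx _ a2 with e | e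
      · rw [show t + ((i + 1 : ℕ) : ℤ) - 1 = t + (i : ℤ) by push_cast; ring] at e
        rw [e] at n1
        simp at n1
      · rw [show t + ((i + 1 : ℕ) : ℤ) + 1 = t + ((i + 2 : ℕ) : ℤ) by push_cast; ring, n3] at e
        simp at e
    · exfalso
      obtain ⟨p1, l1, m1⟩ := Option.map_eq_some_iff.1 k1
      obtain ⟨p2, l2, m2⟩ := Option.map_eq_some_iff.1 k2
      obtain ⟨p3, l3, m3⟩ := Option.map_eq_some_iff.1 k3
      have n1 := congrArg Prod.snd (letter l1)
      have n2 := congrArg Prod.snd (letter l2)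
      have n3 := congrArg Prod.snd (letter l3)
      simp only [m1, m2, m3] at n1 n2 n3
      have a2 : z (t + ((i + 1 : ℕ) : ℤ)) = 0 := Fin.ext n2
      rcases hz _ a2 with e | e
      · rw [show t + ((i + 1 : ℕ) : ℤ) - 1 = t + (i : ℤ) by push_cast; ring] at e
        rw [e] at n1
        simp at n1
      · rw [show t + ((i + 1 : ℕ) : ℤ) + 1 = t + ((i + 2 : ℕ) : ℤ) by push_cast; ring] at e
        rw [e] at n3
        simp at n3
  refine ⟨runOfPath 2 20 h firstVisit_B_complete (Blk.evenWord 5 3) hlen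
    Blk.evenWord_injective_B hJ, ?_⟩
  rw [evenRows_iff (by norm_num) (by norm_num)]
  intro b c hb i hi
  exact hb.2.letter hi

end

/-! ### Tilings of a row from a run -/

/-- The sequences of states along the word `w`, from the state `s` to the state `J`. -/
def follow (E : List Edge) (J : ℕ) : List (ℕ × ℕ) → ℕ → List (List ℕ)
  | [], s => if s = J then [[]] else []
  | p :: w, s => E.flatMap fun e =>
      if e.1 = s ∧ e.2.2.1.val = p.1 ∧ e.2.2.2.val = p.2 then
        (follow E J w e.2.1).map (e.2.1 :: ·)
      else []

/-- The first sequence of states from `J` to `J` along the word `w`. -/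
def loopStates (E : List Edge) (J : ℕ) (w : List (ℕ × ℕ)) : List ℕ :=
  J :: (follow E J w J).headD []

/-- The word `w` labels a loop from `J` to `J`. -/
def IsLoop (E : List Edge) (J : ℕ) (w : List (ℕ × ℕ)) : Prop :=
  ∀ i ∈ List.range w.length, ∃ e ∈ E, e.1 = (loopStates E J w).getD i J ∧
    e.2.1 = (if i + 1 = w.length then J else (loopStates E J w).getD (i + 1) J) ∧
      e.2.2.1.val = (w.getD i (2, 2)).1 ∧ e.2.2.2.val = (w.getD i (2, 2)).2

instance (E : List Edge) (J : ℕ) (w : List (ℕ × ℕ)) : Decidable (IsLoop E J w) := by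
  unfold IsLoop
  infer_instance

theorem Run.exists_isPath {L S : ℤ} (R : Run L S) (hS : 0 < S) (hL : S < L) {x z : ℤ → Fin 2}
    (E : List Edge) (J : ℕ) (wd : Blk → List (ℕ × ℕ))
    (hwd : ∀ b, ((wd b).length : ℤ) = b.len L S) (hloop : ∀ b ∈ Blk.all, IsLoop E J (wd b))
    (h : ∀ b c, R.At b c → ∀ i (hi : i < (wd b).length),
      ((x (c + i)).val, (z (c + i)).val) = (wd b)[i]) : ∃ q, IsPath E q x z := by
  choose β γ hβ h1 h2 using R.cover hS hL
  refine ⟨fun t => (loopStates E J (wd (β t))).getD (t - γ t).toNat J, fun t => ?_⟩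
  have hq : ∀ b c t, R.At b c → c ≤ t → t < c + b.len L S →
      (loopStates E J (wd (β t))).getD (t - γ t).toNat J =
        (loopStates E J (wd b)).getD (t - c).toNat J := by
    intro b c t hb h3 h4
    have e : γ t = c ∧ β t = b := by
      have := h1 t
      have := h2 t
      rcases hb.trichotomy (hβ t) with k | k | k
      · exact k
      · omega
      · omega
    rw [e.1, e.2]
  have hlen := hwd (β t)
  have k1 := h1 t
  have k2 := h2 t
  have hi : (t - γ t).toNat < (wd (β t)).length := by omega
  obtain ⟨e, he, e1, e2, e3, e4⟩ := hloop (β t) (Blk.mem_all _) _ (List.mem_range.2 hi)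
  have hx := h _ _ (hβ t) _ hi
  rw [show γ t + ((t - γ t).toNat : ℤ) = t by omega] at hx
  rw [List.getD_eq_getElem _ _ hi, ← hx] at e3 e4
  have hnext : (loopStates E J (wd (β (t + 1)))).getD (t + 1 - γ (t + 1)).toNat J = e.2.1 := by
    rw [e2]
    split_ifs with hc
    · obtain ⟨b', hb'⟩ := R.next (hβ t)
      have := b'.len_pos hS hL
      rw [hq b' _ (t + 1) hb' (by omega) (by omega)]
      rw [show (t + 1 - (γ t + (β t).len L S)).toNat = 0 by omega]
      rfl
    · rw [hq (β t) (γ t) (t + 1) (hβ t) (by omega) (by omega)]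
      congr 1
      omega
  show ((loopStates E J (wd (β t))).getD (t - γ t).toNat J,
    (loopStates E J (wd (β (t + 1)))).getD (t + 1 - γ (t + 1)).toNat J, x t, z t) ∈ E
  rw [← e1, hnext, ← Fin.ext e3, ← Fin.ext e4]
  exact he

theorem isLoop_AA : ∀ b ∈ Blk.all, IsLoop edgesAA 29 (b.oddWord 8 5) := by decide +kernel

theorem isLoop_BAB : ∀ b ∈ Blk.all, IsLoop edgesBAB 237 (b.evenWord 13 8) := by decide +kernel

theorem isLoop_B : ∀ b ∈ Blk.all, IsLoop edgesB 2 (b.evenWord 5 3) := by decide +kernel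

theorem mem_of_mem_iterate_trimOnce {E : List Edge} {n : ℕ} {e : Edge} (h : e ∈ trimOnce^[n] E) :
    e ∈ E := by
  induction n with
  | zero => exact h
  | succ n ih =>
    rw [Function.iterate_succ_apply'] at h
    exact ih (List.mem_filter.1 h).1

theorem IsPath.of_trim {E : List Edge} {q : ℤ → ℕ} {x z : ℤ → Fin 2} {n : ℕ}
    (h : IsPath (_root_.trimOnce^[n] E) q x z) : IsPath E q x z :=
  fun t => mem_of_mem_iterate_trimOnce (h t)

/-- States of a composite are coded in base `K`, so quotient and remainder recover the two layers,
and the intermediate row is chosen letter by letter. -/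
theorem IsPath.of_compose {K : ℕ} {E E' : List Edge} {q : ℤ → ℕ} {x z : ℤ → Fin 2}
    (hK : ∀ e ∈ E', e.1 < K ∧ e.2.1 < K) (h : IsPath (_root_.compose K E E') q x z) :
    ∃ y, IsPath E (fun t => q t / K) x y ∧ IsPath E' (fun t => q t % K) y z := by
  have key : ∀ t, ∃ y, (q t / K, q (t + 1) / K, x t, y) ∈ E ∧
      (q t % K, q (t + 1) % K, y, z t) ∈ E' := by
    intro t
    obtain ⟨e, he, h1⟩ := List.mem_flatMap.1 (h t)
    obtain ⟨e', he', h2⟩ := List.mem_filterMap.1 h1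
    split_ifs at h2 with hc
    obtain ⟨k1, k2⟩ := hK e' he'
    simp only [Option.some.injEq, Prod.mk.injEq] at h2
    obtain ⟨a1, a2, a3, a4⟩ := h2
    have d : ∀ a b, b < K → (a * K + b) / K = a ∧ (a * K + b) % K = b := by
      intro a b hb
      have hpos : 0 < K := by omega
      rw [mul_comm]
      exact ⟨by rw [Nat.mul_add_div hpos, Nat.div_eq_of_lt hb, add_zero],
        by rw [Nat.mul_add_mod, Nat.mod_eq_of_lt hb]⟩
    refine ⟨e.2.2.2, ?_⟩
    rw [← a1, ← a2, ← a3, ← a4, (d _ _ k1).1, (d _ _ k2).1, (d _ _ k1).2, (d _ _ k2).2]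
    refine ⟨he, ?_⟩
    rw [hc]
    exact he'
  choose y hy using key
  exact ⟨y, fun t => (hy t).1, fun t => (hy t).2⟩

theorem edgesA_lt : ∀ e ∈ edgesA, e.1 < 10 ∧ e.2.1 < 10 := by decide

theorem edgesB_lt : ∀ e ∈ edgesB, e.1 < 10 ∧ e.2.1 < 10 := by decide

/-! ### Chains of rows -/

/-- The row `z` can be written from the row `x` by the transducers of the word `u`. -/
def Chain : List Letter → (ℤ → Fin 2) → (ℤ → Fin 2) → Prop
  | [], x, z => x = z
  | l :: u, x, z => ∃ y, RowRel l x y ∧ Chain u y z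

theorem Chain.append {u v : List Letter} {x y z : ℤ → Fin 2} (h : Chain u x y)
    (h' : Chain v y z) : Chain (u ++ v) x z := by
  induction u generalizing x with
  | nil => exact (h : x = y) ▸ h'
  | cons l u ih =>
    obtain ⟨y', h1, h2⟩ := h
    exact ⟨y', h1, ih h2⟩

/-- The singular words `b`, `aa`, `bab`, `aabaa`, … -/
def sing : ℕ → List Letter
  | 0 => [.b]
  | 1 => [.a, .a]
  | 2 => [.b, .a, .b]
  | m + 3 => sing (m + 1) ++ sing m ++ sing (m + 1)

section

variable {x z : ℤ → Fin 2}

theorem OddRows.chain {R : Run 8 5} (h : OddRows R x z) : Chain (sing 1) x z := by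
  rw [oddRows_iff (by norm_num) (by norm_num)] at h
  obtain ⟨q, hq⟩ := R.exists_isPath (by norm_num) (by norm_num) edgesAA 29 (Blk.oddWord 8 5)
    (Blk.length_oddWord (by norm_num) (by norm_num)) isLoop_AA h
  obtain ⟨y, h1, h2⟩ := (IsPath.of_trim hq).of_compose edgesA_lt
  exact ⟨y, ⟨_, h1⟩, z, ⟨_, h2⟩, rfl⟩

theorem EvenRows.chain_bab {R : Run 13 8} (h : EvenRows R x z) : Chain (sing 2) x z := by
  rw [evenRows_iff (by norm_num) (by norm_num)] at h
  obtain ⟨q, hq⟩ := R.exists_isPath (by norm_num) (by norm_num) edgesBAB 237 (Blk.evenWord 13 8)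
    (Blk.length_evenWord (by norm_num) (by norm_num)) isLoop_BAB h
  obtain ⟨y, h1, h2⟩ := (IsPath.of_trim hq).of_compose edgesB_lt
  obtain ⟨y', h3, h4⟩ := (IsPath.of_trim h1).of_compose edgesA_lt
  exact ⟨y', ⟨_, h3⟩, y, ⟨_, h4⟩, z, ⟨_, h2⟩, rfl⟩

theorem EvenRows.chain_b {R : Run 5 3} (h : EvenRows R x z) : Chain (sing 0) x z := by
  rw [evenRows_iff (by norm_num) (by norm_num)] at h
  obtain ⟨q, hq⟩ := R.exists_isPath (by norm_num) (by norm_num) edgesB 2 (Blk.evenWord 5 3)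
    (Blk.length_evenWord (by norm_num) (by norm_num)) isLoop_B h
  exact ⟨z, ⟨_, hq⟩, rfl⟩

end

/-! ### Rows and scales at an arbitrary level -/

open Classical in
/-- The row coded by a set of points, with exceptional letter `0` if `p` holds, `1` otherwise. -/
noncomputable def rowOf (p : Bool) (P : Pts) (t : ℤ) : Fin 2 :=
  if p then (if P.Zero t then 0 else 1) else (if P.One t then 1 else 0)

theorem rowOf_true {P : Pts} {t : ℤ} : rowOf true P t = 0 ↔ P.Zero t := by
  simp [rowOf]

theorem rowOf_false {P : Pts} {t : ℤ} : rowOf false P t = 1 ↔ P.One t := by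
  simp [rowOf]

theorem fin2_ext {f g : ℤ → Fin 2} (k : Fin 2) (h : ∀ t, f t = k ↔ g t = k) : f = g := by
  funext t
  have := h t
  generalize f t = a at *
  generalize g t = b at *
  fin_cases a <;> fin_cases b <;> fin_cases k <;> simp_all

/-- The offset of the points on the row that is written. -/
def offset (p : Bool) : ℤ := if p then -1 else 1

/-- The lengths of the longer blocks of the composites. -/
def scaleL (m : ℕ) : ℤ := Nat.fib (m + 5)

/-- The differences of the lengths of the blocks of the composites. -/
def scaleS (m : ℕ) : ℤ := Nat.fib (m + 4)

theorem scaleS_succ (m : ℕ) : scaleS (m + 1) = scaleL m := rfl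

theorem scaleL_succ (m : ℕ) : scaleL (m + 1) = scaleL m + scaleS m := by
  simp only [scaleL, scaleS]
  rw [show m + 1 + 5 = (m + 4) + 2 by ring, Nat.fib_add_two]
  push_cast
  ring

/-- The bounds start at level `1`: at level `0` the scales `5` and `3` give equality in the second
one. Level `1` suffices because the outer runs of the first composition are those of `sing 1`. -/
theorem scale_ratio (m : ℕ) : 3 * scaleS (m + 1) < 2 * scaleL (m + 1) ∧
    3 * scaleL (m + 1) < 5 * scaleS (m + 1) := by
  induction m using Nat.twoStepInduction with
  | zero => simp [scaleS, scaleL, Nat.fib_add_two]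
  | one => simp [scaleS, scaleL, Nat.fib_add_two]
  | more m ih _ =>
    have h1 := scaleL_succ (m + 2)
    have h2 := scaleL_succ (m + 1)
    have h3 := scaleS_succ (m + 2)
    have h4 := scaleS_succ (m + 1)
    simp only [add_assoc] at *
    norm_num at *
    omega

theorem scaleS_ge (m : ℕ) : 3 ≤ scaleS m := by
  have : Nat.fib 4 ≤ Nat.fib (m + 4) := Nat.fib_mono (by omega)
  simp only [Nat.fib_add_two, scaleS] at *
  norm_num at *
  omega

theorem scaleL_ge (m : ℕ) : 5 ≤ scaleL m := by
  have : Nat.fib 5 ≤ Nat.fib (m + 5) := Nat.fib_mono (by omega)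
  simp only [Nat.fib_add_two, scaleL] at *
  norm_num at *
  omega

theorem scale_lt (m : ℕ) : scaleS m < scaleL m ∧ scaleL m < 2 * scaleS m := by
  cases m with
  | zero => simp [scaleS, scaleL, Nat.fib_add_two]
  | succ m =>
    have := scale_ratio m
    have := scaleS_ge (m + 1)
    omega

/-- The parity of `m`. -/
def odd (m : ℕ) : Bool := m % 2 = 1

theorem odd_succ (m : ℕ) : odd (m + 1) = !odd m := by
  unfold odd
  rcases Nat.mod_two_eq_zero_or_one m with h | h <;> simp [Nat.add_mod, h]

theorem Pts.shift_shift (P : Pts) (j k : ℤ) : (P.shift j).shift k = P.shift (j + k) := by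
  simp only [Pts.shift, sub_sub, add_comm]

theorem Pts.shift_zero (P : Pts) : P.shift 0 = P := by
  simp only [Pts.shift, sub_zero]

theorem offset_not (p : Bool) : offset (!p) = - offset p := by
  cases p <;> rfl

/-- The rows of a run of level `m` bound a strip which is tiled by the word `sing m`. -/
theorem Run.chain (m : ℕ) : ∀ (L S : ℤ) (R : Run L S), L = scaleL m → S = scaleS m →
    Chain (sing m) (rowOf (odd m) R.ins) (rowOf (!odd m) (R.outs.shift (offset (odd m)))) := by
  induction m using Nat.strong_induction_on with
  | _ m ih =>
    intro L S R hL hS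
    match m, ih, hL, hS with
    | 0, _, hL, hS =>
      obtain rfl : L = 5 := hL
      obtain rfl : S = 3 := hS
      exact EvenRows.chain_b (R := R) ⟨fun t => rowOf_false, fun t => rowOf_true⟩
    | 1, _, hL, hS =>
      obtain rfl : L = 8 := hL
      obtain rfl : S = 5 := hS
      exact OddRows.chain (R := R) ⟨fun t => rowOf_true, fun t => rowOf_false⟩
    | 2, _, hL, hS =>
      obtain rfl : L = 13 := hL
      obtain rfl : S = 8 := hS
      exact EvenRows.chain_bab (R := R) ⟨fun t => rowOf_false, fun t => rowOf_true⟩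
    | m + 3, ih, hL, hS =>
      have hlt := scale_lt (m + 1)
      have hge := scaleS_ge (m + 1)
      have e1 := scaleL_succ (m + 2)
      have e2 := scaleL_succ (m + 1)
      have e3 := scaleS_succ (m + 2)
      have e4 := scaleS_succ (m + 1)
      have e5 := scaleL_succ m
      have e6 := scaleS_succ m
      simp only [add_assoc, Nat.reduceAdd] at e1 e2 e3 e4
      obtain ⟨l, hl⟩ : ∃ l, l = scaleL (m + 1) := ⟨_, rfl⟩
      obtain ⟨s, hs⟩ : ∃ s, s = scaleS (m + 1) := ⟨_, rfl⟩
      obtain rfl : L = 2 * l + s := by omega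
      obtain rfl : S = l + s := by omega
      have p1 : odd (m + 3) = odd (m + 1) := by rw [odd_succ (m + 2), odd_succ (m + 1), Bool.not_not]
      have p2 : odd m = !odd (m + 1) := by rw [odd_succ m, Bool.not_not]
      have h1 := ih (m + 1) (by omega) _ _ (R.lower (by omega) (by omega)) hl hs
      -- The two parities displace the written points by opposite amounts. Shifting the middle run
      -- once makes it fit the lower run, and then its own displacement brings the points back for
      -- the upper run.
      have h2 := ih m (by omega) _ _ ((R.middle (by omega) (by omega)).shift (offset (odd (m + 1))))
        (by omega) (by omega)
      have h3 := ih (m + 1) (by omega) _ _ (R.upper (by omega) (by omega)) hl hs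
      rw [R.ins_lower, R.outs_lower (by omega) (by omega) (by omega)] at h1
      rw [p2, Run.ins_shift, Run.outs_shift, Pts.shift_shift, offset_not, add_neg_cancel,
        Pts.shift_zero, Bool.not_not, R.outs_middle (by omega) (by omega) (by omega)] at h2
      rw [R.outs_upper] at h3
      rw [p1]
      exact (h1.append h2).append h3

/-! ### The hierarchy of singular words in a tiling -/

/-- The word `u` is read from the position `y` of the bi-infinite word `w`. -/
def ReadAt (w : ℤ → Letter) (y : ℤ) (u : List Letter) : Prop :=
  ∀ (i : ℕ) (hi : i < u.length), w (y + i) = u[i]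

theorem ReadAt.append {w : ℤ → Letter} {y : ℤ} {u v : List Letter} (h : ReadAt w y u)
    (h' : ReadAt w (y + u.length) v) : ReadAt w y (u ++ v) := by
  intro i hi
  rw [List.getElem_append]
  split_ifs with hc
  · exact h i hc
  · rw [← h' (i - u.length) (by rw [List.length_append] at hi; omega)]
    congr 1
    omega

theorem ReadAt.isInfix {w : ℤ → Letter} {y y' : ℤ} {u v : List Letter} (h : ReadAt w y u)
    (h' : ReadAt w y' v) (h1 : y' ≤ y) (h2 : y + u.length ≤ y' + v.length) : u <:+: v := by
  have e : u = (v.drop (y - y').toNat).take u.length := by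
    refine List.ext_getElem (by rw [List.length_take, List.length_drop]; omega) fun i hi _ => ?_
    rw [List.getElem_take, List.getElem_drop, ← h i hi, ← h' _ (by omega)]
    congr 1
    omega
  rw [e]
  exact (List.take_prefix _ _).isInfix.trans (List.drop_suffix _ _).isInfix

theorem Pts.Sparse.rowOf_injective {P Q : Pts} (hP : P.Sparse) (hQ : Q.Sparse) {p : Bool}
    (h : rowOf p P = rowOf p Q) : P = Q := by
  cases p
  · exact hP.eq_of_one hQ fun t => by rw [← rowOf_false, h, rowOf_false]
  · exact hP.eq_of_zero hQ fun t => by rw [← rowOf_true, h, rowOf_true]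

/-- The rows `r` form a tiling in which the component of the row `y` is named by `w y`. -/
def IsStack (w : ℤ → Letter) (r : ℤ → ℤ → Fin 2) : Prop :=
  ∀ y, RowRel (w y) (r y) (r (y + 1))

/-- From the position `y`, the word `sing m` is read and its rows are those of a run. -/
def Seg (w : ℤ → Letter) (r : ℤ → ℤ → Fin 2) (m : ℕ) (y : ℤ) : Prop :=
  ReadAt w y (sing m) ∧ ∃ (L S : ℤ) (R : Run L S), L = scaleL m ∧ S = scaleS m ∧
    r y = rowOf (odd m) R.ins ∧
    r (y + (sing m).length) = rowOf (!odd m) (R.outs.shift (offset (odd m)))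

variable {w : ℤ → Letter} {r : ℤ → ℤ → Fin 2}

/-- Three consecutive segments form a triple of runs, once the upper one is known. -/
theorem Triple.exists_of_rows {m : ℕ} {L S L' S' : ℤ} (R₁ : Run L S) (R₂ : Run L' S') (R₃ : Run L S)
    (hL : L = scaleL (m + 1)) (hS : S = scaleS (m + 1)) (hL' : L' = scaleL m) (hS' : S' = scaleS m)
    (h₁ : rowOf (!odd (m + 1)) (R₁.outs.shift (offset (odd (m + 1)))) = rowOf (odd m) R₂.ins)
    (h₂ : rowOf (!odd m) (R₂.outs.shift (offset (odd m))) = rowOf (odd (m + 1)) R₃.ins) :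
    ∃ T : Triple L S, T.lo = R₁ ∧ T.hi = R₃ := by
  have e5 := scaleL_succ m
  have e6 := scaleS_succ m
  have hlt := scale_lt m
  have hge := scaleS_ge m
  have hge' := scaleL_ge m
  have hr := scale_ratio m
  obtain rfl : L' = S := by omega
  obtain rfl : S' = L - L' := by omega
  have p : odd m = !odd (m + 1) := by rw [odd_succ m, Bool.not_not]
  rw [p] at h₁ h₂
  rw [Bool.not_not] at h₂
  -- Equal rows carry equal points, because both sets are sparse.
  have k₁ := ((R₁.sparse_outs (by omega) (by omega) (by omega)).shift _).rowOf_injective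
    (R₂.sparse_ins (by omega) (by omega) (by omega)) h₁
  have k₂ := ((R₂.sparse_outs (by omega) (by omega) (by omega)).shift _).rowOf_injective
    (R₃.sparse_ins (by omega) (by omega) (by omega)) h₂
  rw [offset_not] at k₂
  refine ⟨⟨R₁, R₂.shift (-offset (odd (m + 1))), R₃, ?_, ?_, by omega, by omega⟩, rfl, rfl⟩
  · rw [Run.ins_shift, ← k₁, Pts.shift_shift, add_neg_cancel, Pts.shift_zero]
  · rw [Run.outs_shift, k₂]

/-- Lifts `Triple.comp` from runs to rows of a tiling; the outer rows are kept because the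
composition preserves the outer points. -/
theorem Seg.comp {m : ℕ} {y y₁ y₂ : ℤ} (h₁ : Seg w r (m + 1) y) (h₂ : Seg w r m y₁)
    (h₃ : Seg w r (m + 1) y₂) (e₁ : y₁ = y + (sing (m + 1)).length)
    (e₂ : y₂ = y₁ + (sing m).length) : Seg w r (m + 3) y := by
  obtain ⟨w₁, L, S, R₁, hL, hS, a₁, b₁⟩ := h₁
  obtain ⟨w₂, L', S', R₂, hL', hS', a₂, b₂⟩ := h₂
  obtain ⟨w₃, L₃, S₃, R₃, hL₃, hS₃, a₃, b₃⟩ := h₃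
  obtain rfl : L₃ = L := by omega
  obtain rfl : S₃ = S := by omega
  subst e₁ e₂
  obtain ⟨T, rfl, rfl⟩ := Triple.exists_of_rows R₁ R₂ R₃ hL hS hL' hS' (by rw [← b₁, a₂])
    (by rw [← b₂, a₃])
  have p1 : odd (m + 3) = odd (m + 1) := by rw [odd_succ (m + 2), odd_succ (m + 1), Bool.not_not]
  have e1 := scaleL_succ (m + 2)
  have e2 := scaleL_succ (m + 1)
  have e3 := scaleS_succ (m + 2)
  have e4 := scaleS_succ (m + 1)
  simp only [add_assoc, Nat.reduceAdd] at e1 e2 e3 e4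
  refine ⟨(w₁.append w₂).append ?_, _, _, T.comp, by omega, by omega, ?_, ?_⟩
  · rw [List.length_append]
    push_cast
    rw [← add_assoc]
    exact w₃
  · rw [p1, T.ins_comp, a₁]
  · rw [p1, T.outs_comp, ← b₃]
    simp only [sing, List.length_append]
    congr 1
    push_cast
    ring

/-- The five segments contain two triples with the segment at `y₂` in common, as upper run of one
and lower run of the other. This contradicts `Triple.hi_ne_lo`. -/
theorem Seg.exclude {m : ℕ} {y y₁ y₂ y₃ y₄ : ℤ} (h₀ : Seg w r (m + 1) y) (h₁ : Seg w r m y₁)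
    (h₂ : Seg w r (m + 1) y₂) (h₃ : Seg w r m y₃) (h₄ : Seg w r (m + 1) y₄)
    (e₁ : y₁ = y + (sing (m + 1)).length) (e₂ : y₂ = y₁ + (sing m).length)
    (e₃ : y₃ = y₂ + (sing (m + 1)).length) (e₄ : y₄ = y₃ + (sing m).length) : False := by
  obtain ⟨-, L, S, R₀, hL, hS, -, b₀⟩ := h₀
  obtain ⟨-, L', S', R₁, hL', hS', a₁, b₁⟩ := h₁
  obtain ⟨-, L₂, S₂, R₂, hL₂, hS₂, a₂, b₂⟩ := h₂
  obtain ⟨-, L₃, S₃, R₃, hL₃, hS₃, a₃, b₃⟩ := h₃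
  obtain ⟨-, L₄, S₄, R₄, hL₄, hS₄, a₄, -⟩ := h₄
  obtain rfl : L₂ = L := by omega
  obtain rfl : S₂ = S := by omega
  obtain rfl : L₄ = L₂ := by omega
  obtain rfl : S₄ = S₂ := by omega
  subst e₁ e₂ e₃ e₄
  obtain ⟨T, rfl, rfl⟩ := Triple.exists_of_rows R₀ R₁ R₂ hL hS hL' hS' (by rw [← b₀, a₁])
    (by rw [← b₁, a₂])
  obtain ⟨T', hT, rfl⟩ := Triple.exists_of_rows T.hi R₃ R₄ hL hS hL₃ hS₃ (by rw [← b₂, a₃])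
    (by rw [← b₃, a₄])
  exact Triple.hi_ne_lo hT.symm

/-- The word is a concatenation of `sing (m + 1)` alternating with `sing m` or `sing (m + 2)`;
`A` is the set of the beginnings of the former. -/
structure Level (w : ℤ → Letter) (r : ℤ → ℤ → Fin 2) (m : ℕ) (A : ℤ → Prop) : Prop where
  nonempty : ∃ y, A y
  seg : ∀ y, A y → Seg w r (m + 1) y
  next : ∀ y, A y →
    (Seg w r m (y + (sing (m + 1)).length) ∧ A (y + (sing (m + 1)).length + (sing m).length)) ∨
    (Seg w r (m + 2) (y + (sing (m + 1)).length) ∧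
      A (y + (sing (m + 1)).length + (sing (m + 2)).length))
  prev : ∀ y, A y →
    (Seg w r m (y - (sing m).length) ∧ A (y - (sing m).length - (sing (m + 1)).length)) ∨
    (Seg w r (m + 2) (y - (sing (m + 2)).length) ∧
      A (y - (sing (m + 2)).length - (sing (m + 1)).length))

/-- By `Seg.exclude`, two gaps `sing m` are never consecutive. So each `sing (m + 1) ++ sing m ++
sing (m + 1)` can be merged into `sing (m + 3)`, after which the occurrences of `sing (m + 2)` are
separated by `sing (m + 1)` or `sing (m + 3)`. -/
theorem Level.succ {m : ℕ} {A : ℤ → Prop} (h : Level w r m A) :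
    Level w r (m + 1) fun y => Seg w r (m + 2) y ∧ A (y - (sing (m + 1)).length) ∧
      A (y + (sing (m + 2)).length) := by
  have v3 : ((sing (m + 3)).length : ℤ) =
      (sing (m + 1)).length + (sing m).length + (sing (m + 1)).length := by
    simp only [sing, List.length_append]
    push_cast
    ring
  have next' : ∀ y, A y → Seg w r m (y + (sing (m + 1)).length) →
      A (y + (sing (m + 1)).length + (sing m).length) →
      Seg w r (m + 2) (y + (sing (m + 1)).length + (sing m).length + (sing (m + 1)).length) ∧
      A (y + (sing (m + 1)).length + (sing m).length + (sing (m + 1)).length +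
        (sing (m + 2)).length) := by
    intro y h0 h1 h2
    rcases h.next _ h2 with ⟨h3, h4⟩ | h3
    · exact ((h.seg _ h0).exclude h1 (h.seg _ h2) h3 (h.seg _ h4) rfl rfl rfl rfl).elim
    · exact h3
  have back : ∀ {y y'}, A y → y = y' → A y' := fun h e => e ▸ h
  have backs : ∀ {k y y'}, Seg w r k y → y = y' → Seg w r k y' := fun h e => e ▸ h
  refine ⟨?_, fun y hy => hy.1, ?_, ?_⟩
  · obtain ⟨y, hy⟩ := h.nonempty
    rcases h.next y hy with ⟨h1, h2⟩ | ⟨h1, h2⟩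
    · obtain ⟨h3, h4⟩ := next' y hy h1 h2
      exact ⟨_, h3, back h2 (by ring), h4⟩
    · exact ⟨_, h1, back hy (by ring), h2⟩
  · rintro y ⟨-, -, hy⟩
    rcases h.next _ hy with ⟨h1, h2⟩ | ⟨h1, h2⟩
    · obtain ⟨h3, h4⟩ := next' _ hy h1 h2
      refine Or.inr ⟨(h.seg _ hy).comp h1 (h.seg _ h2) rfl rfl, ?_⟩
      exact ⟨backs h3 (by rw [v3]; ring), back h2 (by rw [v3]; ring), back h4 (by rw [v3]; ring)⟩
    · exact Or.inl ⟨h.seg _ hy, h1, back hy (by ring), h2⟩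
  · rintro y ⟨-, hy, -⟩
    rcases h.prev _ hy with ⟨h1, h2⟩ | ⟨h1, h2⟩
    · refine Or.inr ⟨backs ((h.seg _ h2).comp h1 (h.seg _ hy) (by ring) (by ring))
        (by rw [v3]; ring), ?_⟩
      rcases h.prev _ h2 with ⟨h3, h4⟩ | ⟨h3, h4⟩
      · exact ((h.seg _ h4).exclude h3 (h.seg _ h2) h1 (h.seg _ hy) (by ring) (by ring) (by ring)
          (by ring)).elim
      · exact ⟨backs h3 (by rw [v3]; ring), back h4 (by rw [v3]; ring), back h2 (by rw [v3]; ring)⟩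
    · exact Or.inl ⟨h.seg _ hy, backs h1 (by ring), back h2 (by ring), back hy (by ring)⟩

theorem OddRows.rows_eq {L S : ℤ} {R : Run L S} {x z : ℤ → Fin 2} (h : OddRows R x z) :
    x = rowOf true R.ins ∧ z = rowOf false (R.outs.shift (-1)) :=
  ⟨fin2_ext 0 fun t => by rw [h.1, rowOf_true], fin2_ext 1 fun t => by rw [h.2, rowOf_false]⟩

theorem EvenRows.rows_eq {L S : ℤ} {R : Run L S} {x z : ℤ → Fin 2} (h : EvenRows R x z) :
    x = rowOf false R.ins ∧ z = rowOf true (R.outs.shift 1) :=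
  ⟨fin2_ext 1 fun t => by rw [h.1, rowOf_false], fin2_ext 0 fun t => by rw [h.2, rowOf_true]⟩

namespace IsStack

variable (hr : IsStack w r)

include hr

theorem rel {y y' : ℤ} {l : Letter} (e : w y = l) (h : y' = y + 1) : RowRel l (r y) (r y') := by
  rw [← e, h]
  exact hr y

theorem seg_one {y : ℤ} (h0 : w y = .a) (h1 : w (y + 1) = .a) : Seg w r 1 y := by
  obtain ⟨R, hR⟩ := exists_oddRows_AA (hr.rel h0 rfl) (hr.rel h1 rfl)
  refine ⟨?_, 8, 5, R, rfl, rfl, hR.rows_eq.1, ?_⟩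
  · intro i hi
    match i, hi with
    | 0, _ => simpa [sing] using h0
    | 1, _ => simpa [sing] using h1
  · have := hR.rows_eq.2
    rw [add_assoc] at this
    exact this

theorem seg_two {y : ℤ} (h0 : w y = .b) (h1 : w (y + 1) = .a) (h2 : w (y + 2) = .b) :
    Seg w r 2 y := by
  obtain ⟨R, hR⟩ := exists_evenRows_BAB (hr.rel h0 rfl) (hr.rel (y' := y + 2) h1 (by ring))
    (hr.rel h2 (by rfl : y + 2 + 1 = y + 2 + 1))
  refine ⟨?_, 13, 8, R, rfl, rfl, hR.rows_eq.1, ?_⟩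
  · intro i hi
    match i, hi with
    | 0, _ => simpa [sing] using h0
    | 1, _ => simpa [sing] using h1
    | 2, _ => simpa [sing] using h2
  · have := hR.rows_eq.2
    rw [add_assoc] at this
    exact this

/-- The neighbouring segments `aa` provide rows made of pairs and triples, which is the input that
`exists_evenRows_B` needs. -/
theorem seg_zero {y : ℤ} (h : w y = .b) (h1 : Seg w r 1 (y - 2)) (h2 : Seg w r 1 (y + 1)) :
    Seg w r 0 y := by
  obtain ⟨-, L, S, R, -, -, -, hR⟩ := h1
  obtain ⟨-, L', S', R', -, -, hR', -⟩ := h2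
  have hx : r y = rowOf false (R.outs.shift (-1)) := by
    rw [show y = y - 2 + ((sing 1).length : ℤ) by simp [sing]]
    exact hR
  have hz : r (y + 1) = rowOf true R'.ins := hR'
  obtain ⟨R'', hR''⟩ := exists_evenRows_B (hr.rel h rfl)
    (fun t ht => by
      rw [hx] at ht ⊢
      simp only [rowOf_false] at ht ⊢
      exact Pts.one_neighbour ht)
    (fun t ht => by
      rw [hz] at ht ⊢
      simp only [rowOf_true] at ht ⊢
      exact Pts.zero_neighbour ht)
  refine ⟨?_, 5, 3, R'', rfl, rfl, hR''.rows_eq.1, hR''.rows_eq.2⟩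
  intro i hi
  match i, hi with
  | 0, _ => simpa [sing] using h

/-- Without `bb`, `aaa` and `babab`, two successive occurrences of `aa` are separated by `b` or by
`bab`. -/
theorem level_zero : Level w r 0 fun y => w y = .a ∧ w (y + 1) = .a := by
  have cases : ∀ y, w y = .a ∨ w y = .b := fun y => by cases w y <;> simp
  have bb : ∀ y, w y = .b → w (y + 1) = .a := by
    intro y h0
    refine (cases _).resolve_right fun h1 => ?_
    exact not_rowRel_BB (hr.rel h0 rfl) (hr.rel h1 rfl)
  have aaa : ∀ y, w y = .a → w (y + 1) = .a → w (y + 2) = .b := by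
    intro y h0 h1
    refine (cases _).resolve_left fun h2 => ?_
    exact not_rowRel_AAA (hr.rel h0 rfl) (hr.rel (y' := y + 2) h1 (by ring)) (hr.rel h2 rfl)
  have babab : ∀ y, w y = .b → w (y + 1) = .a → w (y + 2) = .b → w (y + 3) = .a →
      w (y + 4) = .a := by
    intro y h0 h1 h2 h3
    refine (cases _).resolve_right fun h4 => ?_
    exact not_rowRel_BABAB (hr.rel h0 rfl) (hr.rel (y' := y + 2) h1 (by ring))
      (hr.rel (y' := y + 3) h2 (by ring)) (hr.rel (y' := y + 4) h3 (by ring)) (hr.rel h4 rfl)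
  have congr : ∀ {y y' l}, w y = l → y = y' → w y' = l := fun h e => e ▸ h
  have next : ∀ y, w y = .a → w (y + 1) = .a → w (y + 2) = .b ∧ w (y + 3) = .a ∧
      (w (y + 4) = .a ∨ (w (y + 4) = .b ∧ w (y + 5) = .a ∧ w (y + 6) = .a)) := by
    intro y h0 h1
    have h2 := aaa y h0 h1
    have h3 := congr (y' := y + 3) (bb _ h2) (by ring)
    refine ⟨h2, h3, (cases _).imp id fun h4 => ?_⟩
    have h5 := congr (y' := y + 5) (bb _ h4) (by ring)
    refine ⟨h4, h5, ?_⟩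
    exact congr (babab (y + 2) h2 (congr h3 (by ring)) (congr h4 (by ring)) (congr h5 (by ring)))
      (by ring)
  have prev : ∀ y, w y = .a → w (y + 1) = .a → w (y - 1) = .b ∧ w (y - 2) = .a ∧
      (w (y - 3) = .a ∨ (w (y - 3) = .b ∧ w (y - 4) = .a ∧ w (y - 5) = .a)) := by
    intro y h0 h1
    have h2 : w (y - 1) = .b := by
      refine (cases _).resolve_left fun h2 => ?_
      have := aaa _ h2 (congr h0 (by ring))
      rw [show y - 1 + 2 = y + 1 by ring, h1] at this
      simp at this
    have h3 : ∀ z, w z = .b → w (z - 1) = .a := by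
      intro z hz
      refine (cases _).resolve_right fun h3 => ?_
      have := bb _ h3
      rw [sub_add_cancel, hz] at this
      simp at this
    have h4 : w (y - 2) = .a := congr (h3 _ h2) (by ring)
    refine ⟨h2, h4, (cases _).imp id fun h5 => ?_⟩
    have h6 : w (y - 4) = .a := congr (h3 _ h5) (by ring)
    refine ⟨h5, h6, (cases _).resolve_right fun h7 => ?_⟩
    have := babab _ h7 (congr h6 (by ring)) (congr h5 (by ring)) (congr h4 (by ring))
    rw [show y - 5 + 4 = y - 1 by ring, h2] at this
    simp at this
  have one : ∀ {y y'}, w y = .a → w (y + 1) = .a → y = y' → Seg w r 1 y' := fun h h' e =>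
    e ▸ hr.seg_one h h'
  have l0 : ((sing 0).length : ℤ) = 1 := rfl
  have l1 : ((sing (0 + 1)).length : ℤ) = 2 := rfl
  have l2 : ((sing (0 + 2)).length : ℤ) = 3 := rfl
  refine ⟨?_, fun y hy => hr.seg_one hy.1 hy.2, ?_, ?_⟩
  · have key : ∀ y, w y = .b → ∃ y, w y = .a ∧ w (y + 1) = .a := by
      intro y h0
      have h1 := bb y h0
      rcases cases (y + 2) with h2 | h2
      · exact ⟨y + 1, h1, congr h2 (by ring)⟩
      · have h3 := congr (y' := y + 3) (bb _ h2) (by ring)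
        exact ⟨y + 3, h3, congr (babab y h0 h1 h2 h3) (by ring)⟩
    rcases cases 0 with h0 | h0
    · rcases cases 1 with h1 | h1
      · exact ⟨0, h0, h1⟩
      · exact key _ h1
    · exact key _ h0
  · rintro y ⟨h0, h1⟩
    obtain ⟨h2, h3, h4 | ⟨h4, h5, h6⟩⟩ := next y h0 h1
    · rw [l0, l1]
      refine Or.inl ⟨hr.seg_zero h2 (one h0 h1 (by ring)) (one h3 (congr h4 (by ring)) (by ring)),
        congr h3 (by ring), congr h4 (by ring)⟩
    · rw [l1, l2]
      exact Or.inr ⟨hr.seg_two h2 (congr h3 (by ring)) (congr h4 (by ring)), congr h5 (by ring),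
        congr h6 (by ring)⟩
  · rintro y ⟨h0, h1⟩
    obtain ⟨h2, h3, h4 | ⟨h4, h5, h6⟩⟩ := prev y h0 h1
    · rw [l0, l1]
      exact Or.inl ⟨hr.seg_zero h2 (one h4 (congr h3 (by ring)) (by ring))
        (one h0 h1 (by ring)), congr h4 (by ring), congr h3 (by ring)⟩
    · rw [l1, l2]
      exact Or.inr ⟨hr.seg_two h4 (congr h3 (by ring)) (congr h2 (by ring)), congr h6 (by ring),
        congr h5 (by ring)⟩

theorem exists_level (m : ℕ) : ∃ A, Level w r m A := by
  induction m with
  | zero => exact ⟨_, hr.level_zero⟩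
  | succ m ih =>
    obtain ⟨A, hA⟩ := ih
    exact ⟨_, hA.succ⟩

end IsStack

theorem lt_length_sing (m : ℕ) : m < 2 * (sing m).length := by
  induction m using Nat.strong_induction_on with
  | _ m ih =>
    match m, ih with
    | 0, _ => simp [sing]
    | 1, _ => simp [sing]
    | 2, _ => simp [sing]
    | m + 3, ih =>
      have := ih (m + 1) (by omega)
      have := ih m (by omega)
      simp only [sing, List.length_append]
      omega

theorem Level.isInfix {m : ℕ} {A : ℤ → Prop} (h : Level w r m A) {y : ℤ} {u : List Letter}
    (hu : ReadAt w y u) (hm : 2 * u.length ≤ m) : u <:+: sing (m + 5) := by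
  have l0 := lt_length_sing m
  have l1 := lt_length_sing (m + 1)
  have l2 := lt_length_sing (m + 2)
  have below : ∀ n : ℕ, ∀ z, A z → z - y ≤ n → ∃ z, A z ∧ z ≤ y := by
    intro n
    induction n with
    | zero => exact fun z hz hn => ⟨z, hz, by omega⟩
    | succ n ih =>
      intro z hz hn
      rcases h.prev z hz with ⟨-, k⟩ | ⟨-, k⟩
      · exact ih _ k (by omega)
      · exact ih _ k (by omega)
  obtain ⟨z₀, hz₀⟩ := h.nonempty
  obtain ⟨z, ⟨hz, hzy⟩, hmax⟩ := Int.exists_greatest_of_bdd (P := fun z => A z ∧ z ≤ y)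
    ⟨y, fun z hz => hz.2⟩ (below (z₀ - y).toNat z₀ hz₀ (by omega))
  have h3 : sing (m + 3) = sing (m + 1) ++ sing m ++ sing (m + 1) := rfl
  have h5 : sing (m + 5) = sing (m + 3) ++ sing (m + 2) ++ sing (m + 3) := rfl
  rcases h.next z hz with ⟨k1, k2⟩ | ⟨k1, k2⟩
  · have hlt : y < z + (sing (m + 1)).length + (sing m).length := by
      by_contra hc
      have := hmax _ ⟨k2, by omega⟩
      omega
    have hread := ((h.seg z hz).1.append k1.1).append (v := sing (m + 1)) (by
      rw [List.length_append]
      push_cast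
      rw [← add_assoc]
      exact (h.seg _ k2).1)
    refine (hu.isInfix hread hzy ?_).trans ?_
    · simp only [List.length_append]
      push_cast
      omega
    · rw [h5, h3]
      exact ⟨[], sing (m + 2) ++ (sing (m + 1) ++ sing m ++ sing (m + 1)), by simp⟩
  · have hlt : y < z + (sing (m + 1)).length + (sing (m + 2)).length := by
      by_contra hc
      have := hmax _ ⟨k2, by omega⟩
      omega
    have hread := ((h.seg z hz).1.append k1.1).append (v := sing (m + 1)) (by
      rw [List.length_append]
      push_cast
      rw [← add_assoc]
      exact (h.seg _ k2).1)
    refine (hu.isInfix hread hzy ?_).trans ?_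
    · simp only [List.length_append]
      push_cast
      omega
    · rw [h5, h3]
      exact ⟨sing (m + 1) ++ sing m, sing m ++ sing (m + 1), by simp⟩

/-- Every factor of the word of components of a tiling is a factor of a singular word. -/
theorem IsStack.exists_isInfix_sing (hr : IsStack w r) {y : ℤ} {u : List Letter}
    (hu : ReadAt w y u) : ∃ m, u <:+: sing m := by
  obtain ⟨A, hA⟩ := hr.exists_level (2 * u.length)
  exact ⟨_, hA.isInfix hu le_rfl⟩

/-! ### Singular words and the Fibonacci word -/

theorem fibMorphism_iterate_succ (n : ℕ) :
    fibMorphism^[n + 2] [Letter.a] = fibMorphism^[n + 1] [Letter.a] ++ fibMorphism^[n] [Letter.a] := by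
  induction n with
  | zero => rfl
  | succ n ih =>
    rw [Function.iterate_succ_apply' fibMorphism (n + 2), ih, fibMorphism_append,
      ← Function.iterate_succ_apply' fibMorphism (n + 1), ← Function.iterate_succ_apply' fibMorphism n,
      ih]

/-- The first letter of the singular words. -/
def singHead (m : ℕ) : Letter := if odd m then .a else .b

theorem singHead_succ_succ (m : ℕ) : singHead (m + 2) = singHead m := by
  rw [singHead, singHead, odd_succ (m + 1), odd_succ m, Bool.not_not]

theorem sing_eq (m : ℕ) : ∃ g, sing m = singHead m :: g ∧
    fibMorphism^[m] [Letter.a] = g ++ [singHead (m + 1)] := by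
  induction m using Nat.strong_induction_on with
  | _ m ih =>
    match m, ih with
    | 0, _ => exact ⟨[], rfl, rfl⟩
    | 1, _ => exact ⟨[.a], rfl, rfl⟩
    | 2, _ => exact ⟨[.a, .b], rfl, rfl⟩
    | m + 3, ih =>
      obtain ⟨g₁, h₁, k₁⟩ := ih (m + 1) (by omega)
      obtain ⟨g₀, h₀, k₀⟩ := ih m (by omega)
      refine ⟨fibMorphism^[m + 1] [Letter.a] ++ fibMorphism^[m] [Letter.a] ++ g₁, ?_, ?_⟩
      · rw [sing, h₁, h₀, k₁, k₀, singHead_succ_succ (m + 1), singHead_succ_succ m]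
        simp
      · rw [fibMorphism_iterate_succ (m + 1), fibMorphism_iterate_succ m, List.append_assoc,
          List.append_assoc, List.append_assoc, singHead_succ_succ (m + 2)]
        congr 2

theorem isFactor_iff_isInfix {u : List Letter} {s : ℕ → Letter} :
    IsFactor u s ↔ ∃ n, u <:+: prefixOf s n := by
  constructor
  · rintro ⟨k, h⟩
    refine ⟨k + u.length, prefixOf s k, [], ?_⟩
    refine List.ext_getElem (by simp [prefixOf]) fun i h1 h2 => ?_
    simp only [List.append_nil, List.getElem_append, prefixOf, List.length_map, List.length_range,
      List.getElem_map, List.getElem_range]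
    split_ifs with hc
    · rfl
    · rw [h]
      congr 1
      omega
  · rintro ⟨n, v, v', h⟩
    refine ⟨v.length, fun i hi => ?_⟩
    have h1 : (v ++ u ++ v')[v.length + i]? = (prefixOf s n)[v.length + i]? := by rw [h]
    have h2 := congrArg List.length h
    simp only [List.length_append, prefixOf, List.length_map, List.length_range] at h2
    rw [List.append_assoc, List.getElem?_append_right (by omega), List.getElem?_append_left (by omega),
      List.getElem?_eq_getElem (by omega), List.getElem?_eq_getElem (by simp [prefixOf]; omega)] at h1
    simpa [prefixOf] using h1

theorem isFactor_fibWord_of_isInfix_sing {u : List Letter} {m : ℕ} (h : u <:+: sing m) :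
    IsFactor u fibWord := by
  rw [isFactor_iff_isInfix]
  obtain ⟨g₀, h₀, k₀⟩ := sing_eq m
  obtain ⟨g₁, -, k₁⟩ := sing_eq (m + 1)
  rw [singHead_succ_succ] at k₁
  refine ⟨(fibMorphism^[m + 2] [Letter.a]).length, h.trans ?_⟩
  · rw [← iterate_fibMorphism_eq_prefixOf, fibMorphism_iterate_succ, k₁, k₀, h₀]
    exact ⟨g₁, [singHead (m + 1)], by simp⟩

theorem exists_isInfix_sing_of_isFactor {u : List Letter} (h : IsFactor u fibWord) :
    ∃ m, u <:+: sing m := by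
  rw [isFactor_iff_isInfix] at h
  obtain ⟨n, h⟩ := h
  obtain ⟨g, h₁, k₁⟩ := sing_eq n
  refine ⟨n, h.trans ?_⟩
  have hl := lt_length_iterate_fibMorphism n
  have h1 : prefixOf fibWord n <+: fibMorphism^[n] [Letter.a] := by
    rw [iterate_fibMorphism_eq_prefixOf n]
    exact prefixOf_prefix _ hl.le
  rw [k₁] at h1 hl
  have h2 : prefixOf fibWord n <+: g := by
    refine List.prefix_of_prefix_length_le h1 (List.prefix_append _ _) ?_
    simp only [List.length_append, List.length_singleton] at hl
    simp only [prefixOf, List.length_map, List.length_range]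
    omega
  rw [h₁]
  exact h2.isInfix.trans (List.suffix_cons _ _).isInfix

/-! ### The slope -/

/-- The frequency of the letter `a` in the Fibonacci word. -/
noncomputable abbrev fibSlope : ℝ := 1 / Real.goldenRatio

theorem fibSlope_pos : 0 < fibSlope := one_div_pos.2 Real.goldenRatio_pos

theorem fibSlope_lt_one : fibSlope < 1 := (div_lt_one Real.goldenRatio_pos).2 Real.one_lt_goldenRatio

theorem goldenRatio_eq : Real.goldenRatio = fibSlope + 1 := by
  have h := Real.goldenRatio_sq
  have h0 := Real.goldenRatio_ne_zero
  rw [fibSlope, div_add_one h0, add_comm, ← h, sq, mul_div_assoc, div_self h0, mul_one]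

theorem fibSlope_sq : fibSlope ^ 2 = 1 - fibSlope := by
  have h := Real.goldenRatio_sq
  rw [goldenRatio_eq] at h
  linarith

theorem irrational_fibSlope : Irrational fibSlope := by
  rw [fibSlope, one_div, irrational_inv_iff]
  exact Real.goldenRatio_irrational

/-! ### Mechanical words -/

/-- `H` counts the letters `a` of the word `w`. -/
def IsHeight (w : ℤ → Letter) (H : ℤ → ℤ) : Prop :=
  ∀ n, H (n + 1) = H n + if w n = .a then 1 else 0

theorem IsHeight.count {w : ℤ → Letter} {H : ℤ → ℤ} (hH : IsHeight w H) {y : ℤ} {u : List Letter}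
    (h : ReadAt w y u) : H (y + u.length) = H y + u.count .a := by
  induction u generalizing y with
  | nil => simp
  | cons l u ih =>
    have h0 : w y = l := by
      have := h 0 (by simp)
      simpa using this
    have h1 : ReadAt w (y + 1) u := by
      intro i hi
      have := h (i + 1) (by simpa using hi)
      rw [List.getElem_cons_succ] at this
      rw [← this]
      congr 1
      push_cast
      ring
    have := ih h1
    have e : y + ((l :: u).length : ℤ) = y + 1 + u.length := by
      push_cast [List.length_cons]
      ring
    rw [e, this, hH y, h0, List.count_cons]
    cases l <;> simp [add_comm, add_left_comm]

theorem exists_isHeight (w : ℤ → Letter) : ∃ H, IsHeight w H := by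
  let c : ℤ → ℤ := fun n => if w n = .a then 1 else 0
  refine ⟨fun n => ∑ i ∈ Finset.range n.toNat, c i - ∑ i ∈ Finset.range (-n).toNat, c (-1 - i), ?_⟩
  intro n
  show _ = _ + c n
  rcases le_or_gt 0 n with h | h
  · have e1 : (n + 1).toNat = n.toNat + 1 := by omega
    have e2 : (-(n + 1)).toNat = 0 := by omega
    have e3 : (-n).toNat = 0 := by omega
    simp only [e1, e2, e3, Finset.sum_range_succ, Finset.range_zero, Finset.sum_empty]
    rw [show ((n.toNat : ℕ) : ℤ) = n by omega]
    ring
  · have e1 : (n + 1).toNat = 0 := by omega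
    have e2 : (-n).toNat = (-(n + 1)).toNat + 1 := by omega
    have e3 : n.toNat = 0 := by omega
    simp only [e1, e2, e3, Finset.sum_range_succ, Finset.range_zero, Finset.sum_empty]
    rw [show -1 - (((-(n + 1)).toNat : ℕ) : ℤ) = n by omega]
    ring

section

variable {α ρ : ℝ}

theorem isHeight_floor (h0 : 0 < α) (h1 : α < 1) :
    IsHeight (lowerMechanical α ρ) fun n => ⌊α * n + ρ⌋ := by
  intro n
  have a : ⌊α * n + ρ⌋ ≤ ⌊α * (n + 1) + ρ⌋ := Int.floor_mono (by nlinarith)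
  have b : ⌊α * (n + 1) + ρ⌋ ≤ ⌊α * n + ρ⌋ + 1 := by
    rw [← Int.floor_add_one]
    exact Int.floor_mono (by nlinarith)
  simp only [lowerMechanical]
  push_cast
  split_ifs <;> simp_all <;> omega

theorem isHeight_ceil (h0 : 0 < α) (h1 : α < 1) :
    IsHeight (upperMechanical α ρ) fun n => ⌈α * n + ρ⌉ := by
  intro n
  have a : ⌈α * n + ρ⌉ ≤ ⌈α * (n + 1) + ρ⌉ := Int.ceil_mono (by nlinarith)
  have b : ⌈α * (n + 1) + ρ⌉ ≤ ⌈α * n + ρ⌉ + 1 := by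
    rw [← Int.ceil_add_one]
    exact Int.ceil_mono (by nlinarith)
  simp only [upperMechanical]
  push_cast
  split_ifs <;> simp_all <;> omega

theorem IsHeight.eq_lowerMechanical {w : ℤ → Letter} {H : ℤ → ℤ} (hH : IsHeight w H)
    (h : ∀ n : ℤ, ⌊α * n + ρ⌋ = H n) (n : ℤ) : w n = lowerMechanical α ρ n := by
  have e := h (n + 1)
  push_cast at e
  rw [lowerMechanical, e, h, hH n]
  cases w n <;> simp

theorem IsHeight.eq_upperMechanical {w : ℤ → Letter} {H : ℤ → ℤ} (hH : IsHeight w H)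
    (h : ∀ n : ℤ, ⌈α * n + ρ⌉ = H n) (n : ℤ) : w n = upperMechanical α ρ n := by
  have e := h (n + 1)
  push_cast at e
  rw [upperMechanical, e, h, hH n]
  cases w n <;> simp

theorem abs_count_sub_lt_of_lowerMechanical (h0 : 0 < α) (h1 : α < 1) {y : ℤ} {u : List Letter}
    (h : ReadAt (lowerMechanical α ρ) y u) : |(u.count .a : ℝ) - α * u.length| < 1 := by
  have e := (isHeight_floor (ρ := ρ) h0 h1).count h
  have e' : ((⌊α * ((y + u.length : ℤ) : ℝ) + ρ⌋ : ℤ) : ℝ) = ⌊α * y + ρ⌋ + u.count .a := by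
    exact_mod_cast e
  push_cast at e'
  have a1 := Int.floor_le (α * (y + u.length) + ρ)
  have a2 := Int.lt_floor_add_one (α * (y + u.length) + ρ)
  have a3 := Int.floor_le (α * y + ρ)
  have a4 := Int.lt_floor_add_one (α * y + ρ)
  rw [abs_lt]
  constructor <;> linarith

/-- A word whose factors are balanced with respect to `α` is mechanical. -/
theorem exists_mechanical_of_balanced {w : ℤ → Letter}
    (h : ∀ y u, ReadAt w y u → |(u.count .a : ℝ) - α * u.length| < 1) :
    ∃ ρ : ℝ, (∀ n, w n = lowerMechanical α ρ n) ∨ (∀ n, w n = upperMechanical α ρ n) := by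
  obtain ⟨H, hH⟩ := exists_isHeight w
  have key : ∀ m n : ℤ, m ≤ n → |((H n : ℝ) - α * n) - (H m - α * m)| < 1 := by
    intro m n hmn
    let u : List Letter := (List.range (n - m).toNat).map fun i : ℕ => w (m + i)
    have hu : ReadAt w m u := by
      intro i hi
      simp [u]
    have hl : (u.length : ℤ) = n - m := by
      simp only [u, List.length_map, List.length_range]
      omega
    have e := hH.count hu
    rw [hl, add_sub_cancel] at e
    have h2 := h m u hu
    have hl' : (u.length : ℝ) = n - m := by exact_mod_cast hl
    rw [hl'] at h2
    rw [e]
    push_cast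
    convert h2 using 2
    ring
  have key' : ∀ m n : ℤ, (H m : ℝ) - α * m < H n - α * n + 1 := by
    intro m n
    rcases le_total m n with hmn | hmn
    · have := abs_lt.1 (key m n hmn)
      linarith
    · have := abs_lt.1 (key n m hmn)
      linarith
  have hb : BddAbove (Set.range fun n : ℤ => (H n : ℝ) - α * n) :=
    ⟨_, by rintro _ ⟨n, rfl⟩; exact (key' n 0).le⟩
  have le_sup : ∀ n : ℤ, (H n : ℝ) - α * n ≤ ⨆ n : ℤ, ((H n : ℝ) - α * n) := fun n =>
    le_ciSup hb n
  have sup_le : ∀ n : ℤ, ⨆ n : ℤ, ((H n : ℝ) - α * n) ≤ H n - α * n + 1 := fun n =>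
    ciSup_le fun m => (key' m n).le
  generalize (⨆ n : ℤ, ((H n : ℝ) - α * n)) = ρ at le_sup sup_le
  by_cases hc : ∃ n₀ : ℤ, ρ = H n₀ - α * n₀ + 1
  · obtain ⟨n₀, rfl⟩ := hc
    refine ⟨H n₀ - α * n₀, Or.inr (hH.eq_upperMechanical fun n => ?_)⟩
    rw [Int.ceil_eq_iff]
    have := sup_le n
    have := key' n n₀
    constructor <;> linarith
  · push Not at hc
    refine ⟨ρ, Or.inl (hH.eq_lowerMechanical fun n => ?_)⟩
    rw [Int.floor_eq_iff]
    have := le_sup n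
    have := lt_of_le_of_ne (sup_le n) (hc n)
    constructor <;> linarith

end

/-! ### The Fibonacci word is mechanical -/

theorem fibSlope_mul_int_ne {m k : ℤ} (hm : m ≠ 0) : fibSlope * m ≠ k := by
  have := irrational_fibSlope.mul_intCast hm
  exact this.ne_int k

theorem lowerMechanical_fibSlope_eq_a {N k : ℤ} (h1 : k - fibSlope ≤ fibSlope * (N + 1))
    (h2 : fibSlope * (N + 1) < k) : lowerMechanical fibSlope fibSlope N = .a := by
  have p := fibSlope_pos
  have p1 := fibSlope_lt_one
  have e1 : ⌊fibSlope * (N + 1) + fibSlope⌋ = k := by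
    rw [Int.floor_eq_iff]
    constructor <;> linarith
  have e2 : ⌊fibSlope * N + fibSlope⌋ = k - 1 := by
    rw [Int.floor_eq_iff]
    push_cast
    constructor <;> linarith
  rw [lowerMechanical, e1, e2]
  simp

theorem lowerMechanical_fibSlope_eq_b {N k : ℤ} (h1 : k ≤ fibSlope * (N + 1))
    (h2 : fibSlope * (N + 1) < k + 1 - fibSlope) : lowerMechanical fibSlope fibSlope N = .b := by
  have p := fibSlope_pos
  have p1 := fibSlope_lt_one
  have e1 : ⌊fibSlope * (N + 1) + fibSlope⌋ = k := by
    rw [Int.floor_eq_iff]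
    constructor <;> linarith
  have e2 : ⌊fibSlope * N + fibSlope⌋ = k := by
    rw [Int.floor_eq_iff]
    constructor <;> linarith
  rw [lowerMechanical, e1, e2]
  simp

theorem lowerMechanical_fibSlope_image (n : ℕ) :
    lowerMechanical fibSlope fibSlope (n + ⌊fibSlope * (n + 1)⌋) = .a ∧
      (lowerMechanical fibSlope fibSlope n = .a →
        lowerMechanical fibSlope fibSlope (n + ⌊fibSlope * (n + 1)⌋ + 1) = .b) := by
  have p := fibSlope_pos
  have p1 := fibSlope_lt_one
  have sq := fibSlope_sq
  obtain ⟨k, hk⟩ : ∃ k, k = ⌊fibSlope * (n + 1)⌋ := ⟨_, rfl⟩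
  rw [← hk]
  have a1 := Int.floor_le (fibSlope * (n + 1))
  have a2 := Int.lt_floor_add_one (fibSlope * (n + 1))
  rw [← hk] at a1 a2
  have e : fibSlope * (n + k + 1) = (n + 1) - fibSlope * (fibSlope * (n + 1) - k) := by
    linear_combination (n + 1 : ℝ) * sq
  have hlt : (k : ℝ) < fibSlope * (n + 1) := by
    refine lt_of_le_of_ne a1 fun h => fibSlope_mul_int_ne (m := n + 1) (k := k) (by omega) ?_
    push_cast
    exact h.symm
  refine ⟨lowerMechanical_fibSlope_eq_a (k := n + 1) ?_ ?_, fun hn => ?_⟩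
  · push_cast
    rw [e]
    nlinarith
  · push_cast
    rw [e]
    nlinarith
  · have h3 : (k : ℝ) + 1 - fibSlope < fibSlope * (n + 1) := by
      by_contra hc
      push Not at hc
      rcases hc.lt_or_eq with hc | hc
      · rw [lowerMechanical_fibSlope_eq_b (k := k) (by exact_mod_cast a1) (by exact_mod_cast hc)]
          at hn
        simp at hn
      · refine fibSlope_mul_int_ne (m := n + 2) (k := k + 1) (by omega) ?_
        push_cast
        linarith
    refine lowerMechanical_fibSlope_eq_b (k := n + 1) ?_ ?_
    · push_cast
      nlinarith
    · push_cast
      nlinarith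

theorem prefixOf_succ (s : ℕ → Letter) (n : ℕ) : prefixOf s (n + 1) = prefixOf s n ++ [s n] := by
  simp [prefixOf, List.range_succ]

theorem fibWord_eq (n : ℕ) : fibWord n = lowerMechanical fibSlope fibSlope n := by
  have p := fibSlope_pos
  have p1 := fibSlope_lt_one
  let s : ℕ → Letter := fun n => lowerMechanical fibSlope fibSlope n
  have hs : IsFibFixedPoint s := by
    have key : ∀ n : ℕ, ∃ k : ℕ, (k : ℤ) = n + ⌊fibSlope * n + fibSlope⌋ ∧
        fibMorphism (prefixOf s n) = prefixOf s k := by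
      intro n
      induction n with
      | zero =>
        refine ⟨0, ?_, rfl⟩
        rw [eq_comm]
        simp only [Nat.cast_zero, mul_zero, zero_add, Int.floor_eq_zero_iff]
        exact ⟨p.le, p1⟩
      | succ n ih =>
        obtain ⟨k, hk, h⟩ := ih
        have e : fibSlope * (n : ℝ) + fibSlope = fibSlope * (n + 1) := by ring
        rw [e] at hk
        obtain ⟨h1, h2⟩ := lowerMechanical_fibSlope_image n
        have hh := isHeight_floor (ρ := fibSlope) p p1 n
        push_cast at hh
        rw [e] at hh
        rw [← hk] at h1 h2
        rw [prefixOf_succ, fibMorphism_append, h]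
        by_cases hn : lowerMechanical fibSlope fibSlope n = .a
        · refine ⟨k + 2, ?_, ?_⟩
          · rw [if_pos hn] at hh
            push_cast
            rw [hh, hk]
            ring
          · have hb : s (k + 1) = .b := by
              have := h2 hn
              simp only [s]
              push_cast
              exact this
            rw [prefixOf_succ, prefixOf_succ, hb, show s k = .a from h1, show s n = .a from hn]
            simp [fibMorphism]
        · refine ⟨k + 1, ?_, ?_⟩
          · rw [if_neg hn] at hh
            push_cast
            rw [hh, hk]
            ring
          · have hb : s n = .b := by
              show lowerMechanical fibSlope fibSlope n = .b
              cases h' : lowerMechanical fibSlope fibSlope n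
              · exact absurd h' hn
              · rfl
            rw [prefixOf_succ, show s k = .a from h1, hb]
            simp [fibMorphism]
    intro n
    obtain ⟨k, -, hk⟩ := key n
    rw [hk]
    simp [prefixOf]
  rw [← hs.eq_fibWord]

theorem isFactor_fibWord_iff {u : List Letter} :
    IsFactor u fibWord ↔ ∃ n : ℕ, ReadAt (lowerMechanical fibSlope fibSlope) n u := by
  refine exists_congr fun n => forall_congr' fun i => forall_congr' fun hi => ?_
  rw [fibWord_eq, eq_comm]
  push_cast
  exact Iff.rfl

/-! ### Factors of the mechanical words -/

theorem exists_nat_fibSlope_mem_Ioo {a b : ℝ} (h : a < b) :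
    ∃ (n : ℕ) (p : ℤ), 0 < n ∧ fibSlope * n + p ∈ Set.Ioo a b := by
  have hd : Dense (AddSubgroup.closure {fibSlope, 1} : Set ℝ) := by
    rw [dense_addSubgroupClosure_pair_iff, div_one]
    exact irrational_fibSlope
  obtain ⟨x, hx, h1, h2⟩ := hd.exists_between h
  rw [SetLike.mem_coe, AddSubgroup.mem_closure_pair] at hx
  obtain ⟨m, p, rfl⟩ := hx
  simp only [zsmul_eq_mul, mul_one] at h1 h2
  have hψ : Filter.Tendsto (fun n : ℕ => Real.goldenConj ^ n) Filter.atTop (nhds 0) := by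
    refine tendsto_pow_atTop_nhds_zero_of_abs_lt_one ?_
    rw [abs_lt]
    exact ⟨Real.neg_one_lt_goldenConj, Real.goldenConj_neg.trans one_pos⟩
  have e1 := hψ.eventually (Metric.ball_mem_nhds (0 : ℝ) (sub_pos.2 h1))
  have e2 := hψ.eventually (Metric.ball_mem_nhds (0 : ℝ) (sub_pos.2 h2))
  obtain ⟨n, h3, h4, h5⟩ := (e1.and (e2.and (Filter.eventually_ge_atTop (m.natAbs + 5)))).exists
  rw [dist_zero_right, Real.norm_eq_abs, abs_lt] at h3 h4
  have hf := Nat.le_fib_self (n := n) (by omega)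
  refine ⟨(Nat.fib n + m).toNat, p + Nat.fib n - Nat.fib (n + 1), by omega, ?_⟩
  have e : (((Nat.fib n + m).toNat : ℕ) : ℝ) = Nat.fib n + m := by
    have : (((Nat.fib n + m).toNat : ℕ) : ℤ) = Nat.fib n + m := by omega
    exact_mod_cast this
  have hb := Real.fib_succ_sub_goldenRatio_mul_fib n
  rw [goldenRatio_eq] at hb
  rw [e]
  push_cast
  constructor <;> linarith

/-- A word which is obtained from an open interval of intercepts is a factor of the Fibonacci
word. -/
theorem isFactor_fibWord_of_height {w : ℤ → Letter} {H : ℤ → ℤ} (hH : IsHeight w H) {y : ℤ}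
    {u : List Letter} (hu : ReadAt w y u) {a b : ℝ} (hab : a < b)
    (h : ∀ θ ∈ Set.Ioo a b, ∀ i ∈ Finset.range (u.length + 1),
      ⌊fibSlope * ((y + i : ℤ) : ℝ) + θ⌋ = H (y + i)) : IsFactor u fibWord := by
  obtain ⟨n, p, hn, h1, h2⟩ := exists_nat_fibSlope_mem_Ioo
    (show a + fibSlope * y < b + fibSlope * y by linarith)
  rw [isFactor_fibWord_iff]
  refine ⟨n - 1, fun i hi => ?_⟩
  have key : ∀ i ∈ Finset.range (u.length + 1),
      ⌊fibSlope * (((n - 1 : ℕ) : ℝ) + i) + fibSlope⌋ = H (y + i) - p := by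
    intro i hi
    rw [← h (fibSlope * n + p - fibSlope * y) ⟨by linarith, by linarith⟩ i hi, ← Int.floor_sub_intCast,
      Nat.cast_sub hn]
    congr 1
    push_cast
    ring
  have k1 := key i (by simp; omega)
  have k2 := key (i + 1) (by simp; omega)
  rw [← hu i hi, lowerMechanical]
  have e2 : fibSlope * ((((((n - 1 : ℕ) : ℤ) + i : ℤ) : ℝ)) + 1) + fibSlope =
    fibSlope * (((n - 1 : ℕ) : ℝ) + ((i + 1 : ℕ) : ℝ)) + fibSlope := by push_cast; ring
  have e1 : fibSlope * (((((n - 1 : ℕ) : ℤ) + i : ℤ) : ℝ)) + fibSlope =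
    fibSlope * (((n - 1 : ℕ) : ℝ) + (i : ℝ)) + fibSlope := by push_cast; ring
  rw [e1, e2, k1, k2]
  have := hH (y + i)
  push_cast
  rw [← add_assoc, this]
  cases w (y + i) <;> simp

theorem isFactor_fibWord_of_lowerMechanical {ρ : ℝ} {y : ℤ} {u : List Letter}
    (hu : ReadAt (lowerMechanical fibSlope ρ) y u) : IsFactor u fibWord := by
  have hev : ∀ᶠ θ in nhdsWithin ρ (Set.Ioi ρ), ∀ i ∈ Finset.range (u.length + 1),
      ⌊fibSlope * ((y + i : ℤ) : ℝ) + θ⌋ = ⌊fibSlope * ((y + i : ℤ) : ℝ) + ρ⌋ := by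
    rw [Filter.eventually_all_finset]
    intro i _
    have h1 := Int.floor_le (fibSlope * ((y + i : ℤ) : ℝ) + ρ)
    have h2 := Int.lt_floor_add_one (fibSlope * ((y + i : ℤ) : ℝ) + ρ)
    filter_upwards [Ioo_mem_nhdsGT (show ρ < ρ + (⌊fibSlope * ((y + i : ℤ) : ℝ) + ρ⌋ + 1 -
      (fibSlope * ((y + i : ℤ) : ℝ) + ρ)) by linarith)] with θ hθ
    rw [Int.floor_eq_iff]
    constructor <;> linarith [hθ.1, hθ.2]
  obtain ⟨b, hb, h⟩ := (mem_nhdsGT_iff_exists_Ioo_subset).1 hev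
  exact isFactor_fibWord_of_height (isHeight_floor fibSlope_pos fibSlope_lt_one) hu hb
    fun θ hθ => h hθ

theorem isFactor_fibWord_of_upperMechanical {ρ : ℝ} {y : ℤ} {u : List Letter}
    (hu : ReadAt (upperMechanical fibSlope ρ) y u) : IsFactor u fibWord := by
  have hev : ∀ᶠ θ in nhdsWithin ρ (Set.Iio ρ), ∀ i ∈ Finset.range (u.length + 1),
      ⌊fibSlope * ((y + i : ℤ) : ℝ) + θ⌋ = ⌈fibSlope * ((y + i : ℤ) : ℝ) + ρ⌉ - 1 := by
    rw [Filter.eventually_all_finset]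
    intro i _
    have h1 := Int.le_ceil (fibSlope * ((y + i : ℤ) : ℝ) + ρ)
    have h2 := Int.ceil_lt_add_one (fibSlope * ((y + i : ℤ) : ℝ) + ρ)
    filter_upwards [Ioo_mem_nhdsLT (show ρ + (⌈fibSlope * ((y + i : ℤ) : ℝ) + ρ⌉ - 1 -
      (fibSlope * ((y + i : ℤ) : ℝ) + ρ)) < ρ by linarith)] with θ hθ
    rw [Int.floor_eq_iff, Int.cast_sub, Int.cast_one]
    constructor <;> linarith [hθ.1, hθ.2]
  obtain ⟨a, ha, h⟩ := (mem_nhdsLT_iff_exists_Ioo_subset).1 hev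
  have hH := isHeight_ceil (ρ := ρ) fibSlope_pos fibSlope_lt_one
  refine isFactor_fibWord_of_height (H := fun n => ⌈fibSlope * n + ρ⌉ - 1) (fun n => ?_) hu ha
    fun θ hθ => h hθ
  have := hH n
  simp only at this ⊢
  rw [this]
  ring

theorem IsBiSturmian.isFactor {w : ℤ → Letter} (hw : IsBiSturmian fibSlope w) {y : ℤ}
    {u : List Letter} (hu : ReadAt w y u) : IsFactor u fibWord := by
  obtain ⟨-, -, -, ρ, h | h⟩ := hw
  · rw [show w = lowerMechanical fibSlope ρ from funext h] at hu
    exact isFactor_fibWord_of_lowerMechanical hu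
  · rw [show w = upperMechanical fibSlope ρ from funext h] at hu
    exact isFactor_fibWord_of_upperMechanical hu

theorem isBiSturmian_of_isFactor {w : ℤ → Letter}
    (h : ∀ y u, ReadAt w y u → IsFactor u fibWord) : IsBiSturmian fibSlope w := by
  refine ⟨irrational_fibSlope, fibSlope_pos, fibSlope_lt_one,
    exists_mechanical_of_balanced fun y u hu => ?_⟩
  obtain ⟨n, hn⟩ := isFactor_fibWord_iff.1 (h y u hu)
  exact abs_count_sub_lt_of_lowerMechanical fibSlope_pos fibSlope_lt_one hn

theorem isSturmian_fibWord : IsSturmian fibSlope fibWord :=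
  ⟨irrational_fibSlope, fibSlope_pos, fibSlope_lt_one, fibSlope, Or.inl fibWord_eq⟩

theorem IsSturmian.isFactor {s : ℕ → Letter} (hs : IsSturmian fibSlope s) {u : List Letter}
    (hu : IsFactor u s) : IsFactor u fibWord := by
  obtain ⟨-, -, -, ρ, h⟩ := hs
  obtain ⟨k, hk⟩ := hu
  rcases h with h | h
  · refine isFactor_fibWord_of_lowerMechanical (ρ := ρ) (y := k) fun i hi => ?_
    rw [hk i hi, h]
    push_cast
    rfl
  · refine isFactor_fibWord_of_upperMechanical (ρ := ρ) (y := k) fun i hi => ?_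
    rw [hk i hi, h]
    push_cast
    rfl

theorem IsBiSturmian.not_periodic {α : ℝ} {w : ℤ → Letter} (hw : IsBiSturmian α w) {v : ℤ}
    (hv : 0 < v) (h : ∀ n, w (n + v) = w n) : False := by
  obtain ⟨hα, h0, h1, ρ, hρ⟩ := hw
  obtain ⟨H, hH, hb⟩ : ∃ H, IsHeight w H ∧ ∀ n : ℤ, |(H n : ℝ) - (α * n + ρ)| ≤ 1 := by
    rcases hρ with hρ | hρ
    · rw [show w = _ from funext hρ]
      refine ⟨_, isHeight_floor h0 h1 (ρ := ρ), fun n => ?_⟩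
      have a1 := Int.floor_le (α * n + ρ)
      have a2 := Int.lt_floor_add_one (α * n + ρ)
      rw [abs_le]
      constructor <;> linarith
    · rw [show w = _ from funext hρ]
      refine ⟨_, isHeight_ceil h0 h1 (ρ := ρ), fun n => ?_⟩
      have a1 := Int.le_ceil (α * n + ρ)
      have a2 := Int.ceil_lt_add_one (α * n + ρ)
      rw [abs_le]
      constructor <;> linarith
  have step : ∀ n, H (n + v) - H n = H v - H 0 := by
    intro n
    induction n using Int.induction_on with
    | zero => simp
    | succ n ih =>
      have := hH n
      have := hH (n + v)
      rw [h n, show (n : ℤ) + v + 1 = n + 1 + v by ring] at this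
      omega
    | pred n ih =>
      have a := hH (-n - 1)
      have b := hH (-n - 1 + v)
      rw [h, show -(n : ℤ) - 1 + v + 1 = -n + v by ring] at b
      rw [show -(n : ℤ) - 1 + 1 = -n by ring] at a
      omega
  have mult : ∀ k : ℕ, H (k * v) = H 0 + k * (H v - H 0) := by
    intro k
    induction k with
    | zero => simp
    | succ k ih =>
      have := step (k * v)
      rw [show (((k + 1 : ℕ) : ℤ)) * v = k * v + v by push_cast; ring]
      push_cast
      linarith
  have hne : α * v ≠ ((H v - H 0 : ℤ) : ℝ) := (hα.mul_intCast hv.ne').ne_int _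
  have hpos : 0 < |((H v - H 0 : ℤ) : ℝ) - α * v| := abs_pos.2 (sub_ne_zero.2 hne.symm)
  obtain ⟨k, hk⟩ := exists_nat_gt (2 / |((H v - H 0 : ℤ) : ℝ) - α * v|)
  rw [div_lt_iff₀ hpos] at hk
  have b0 := hb 0
  have bk := hb (k * v)
  rw [mult] at bk
  have e : (k : ℝ) * (((H v - H 0 : ℤ) : ℝ) - α * v) =
      (((H 0 + k * (H v - H 0) : ℤ) : ℝ) - (α * ((k * v : ℤ) : ℝ) + ρ)) -
        ((H 0 : ℝ) - (α * ((0 : ℤ) : ℝ) + ρ)) := by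
    push_cast
    ring
  have h3 : |(k : ℝ) * (((H v - H 0 : ℤ) : ℝ) - α * v)| ≤ 2 := by
    rw [e]
    exact (abs_sub _ _).trans (by linarith)
  rw [abs_mul, Nat.abs_cast] at h3
  linarith

/-! ### Tilings -/

theorem Chain.exists_rows {u : List Letter} {x z : ℤ → Fin 2} (h : Chain u x z) :
    ∃ r : ℕ → ℤ → Fin 2, r 0 = x ∧ ∀ (i : ℕ) (hi : i < u.length), RowRel u[i] (r i) (r (i + 1)) := by
  induction u generalizing x with
  | nil => exact ⟨fun _ => x, rfl, fun i hi => by simp at hi⟩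
  | cons l u ih =>
    obtain ⟨y, h1, h2⟩ := h
    obtain ⟨r, rfl, hr⟩ := ih h2
    refine ⟨fun i => i.casesOn x r, rfl, fun i hi => ?_⟩
    cases i with
    | zero => exact h1
    | succ i => exact hr i (by simpa using hi)

theorem exists_rows_of_isFactor {u : List Letter} (h : IsFactor u fibWord) :
    ∃ r : ℕ → ℤ → Fin 2, ∀ (i : ℕ) (hi : i < u.length), RowRel u[i] (r i) (r (i + 1)) := by
  obtain ⟨m, v, v', hv⟩ := exists_isInfix_sing_of_isFactor h
  have hc := Run.chain m (scaleL m) (scaleS m) Run.periodic rfl rfl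
  obtain ⟨r, -, hr⟩ := hc.exists_rows
  refine ⟨fun i => r (v.length + i), fun i hi => ?_⟩
  have hl := congrArg List.length hv
  simp only [List.length_append] at hl
  have h1 := hr (v.length + i) (by omega)
  have e : (sing m)[v.length + i]'(by omega) = u[i] := by
    simp only [← hv]
    rw [List.getElem_append_left (by simp; omega), List.getElem_append_right (by omega)]
    simp
  rw [e] at h1
  exact h1

/-- A bi-infinite word whose factors are factors of the Fibonacci word is the word of components
of a tiling. -/
theorem exists_isStack {w : ℤ → Letter} (hw : ∀ y u, ReadAt w y u → IsFactor u fibWord) :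
    ∃ r, IsStack w r := by
  have key : ∀ N : ℕ, ∃ (q : ℤ → ℤ → ℕ) (r : ℤ → ℤ → Fin 2), ∀ y : ℤ, -N ≤ y → y < N →
      IsPath (edges (w y)) (q y) (r y) (r (y + 1)) := by
    intro N
    let u : List Letter := (List.range (2 * N)).map fun i : ℕ => w (-N + i)
    obtain ⟨r, hr⟩ := exists_rows_of_isFactor (u := u) (hw (-N) u fun i hi => by simp [u])
    have hr' : ∀ y : ℤ, ∃ q, -N ≤ y → y < N →
        IsPath (edges (w y)) q (r (y + N).toNat) (r (y + 1 + N).toNat) := by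
      intro y
      by_cases hy : -N ≤ y ∧ y < N
      · obtain ⟨q, hq⟩ := hr (y + N).toNat (by simp [u]; omega)
        refine ⟨q, fun _ _ => ?_⟩
        have e1 : u[(y + N).toNat]'(by simp [u]; omega) = w y := by
          simp only [u, List.getElem_map, List.getElem_range]
          congr 1
          omega
        rw [e1] at hq
        rw [show (y + 1 + N).toNat = (y + N).toNat + 1 by omega]
        exact hq
      · exact ⟨fun _ => 0, fun h1 h2 => absurd ⟨h1, h2⟩ hy⟩
    choose q hq using hr'
    exact ⟨q, fun y => r (y + N).toNat, hq⟩
  choose q r hqr using key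
  let U := Filter.hyperfilter ℕ
  have hU : ∀ n : ℕ, ∀ᶠ N in (U : Filter ℕ), n ≤ N := fun n =>
    Nat.hyperfilter_le_atTop (Filter.eventually_ge_atTop n)
  let e : ℕ → ℤ → ℤ → Edge := fun N y t => (q N y t, q N y (t + 1), r N y t, r N (y + 1) t)
  have hlim : ∀ y t, ∃ a ∈ edges (w y), ∀ᶠ N in (U : Filter ℕ), e N y t = a := by
    intro y t
    have h1 : (⋃ a ∈ {a | a ∈ edges (w y)}, {N | e N y t = a}) ∈ U := by
      filter_upwards [hU (y.natAbs + 1)] with N hN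
      simp only [Set.mem_iUnion, Set.mem_ofPred_eq]
      exact ⟨_, hqr N y (by omega) (by omega) t, rfl⟩
    exact (Ultrafilter.finite_biUnion_mem_iff (List.finite_toSet _)).1 h1
  choose a ha hla using hlim
  refine ⟨fun y t => (a y t).2.2.1, fun y => ⟨fun t => (a y t).1, fun t => ?_⟩⟩
  obtain ⟨N, h1, h2, h3⟩ := ((hla y t).and ((hla y (t + 1)).and (hla (y + 1) t))).exists
  have k := ha y t
  show ((a y t).1, (a y (t + 1)).1, (a y t).2.2.1, (a (y + 1) t).2.2.1) ∈ edges (w y)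
  rw [← h1] at k
  rw [← h1, ← h2, ← h3]
  exact k

theorem component_subset (l : Letter) : component l ⊆ transducerD := by
  cases l
  · exact Set.subset_union_left
  · exact Set.subset_union_right

theorem exists_component {t : WangTile (StateA ⊕ StateB) (Fin 2)} (h : t ∈ transducerD) :
    ∃ l, t ∈ component l := by
  rcases h with h | h
  · exact ⟨.a, h⟩
  · exact ⟨.b, h⟩

theorem component_unique {t t' : WangTile (StateA ⊕ StateB) (Fin 2)} {l l' : Letter}
    (h : t ∈ component l) (h' : t' ∈ component l') (e : t.w = t'.w ∨ t.e = t'.w) : l = l' := by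
  cases l <;> cases l' <;> try rfl
  · obtain ⟨a, -, rfl⟩ := h
    obtain ⟨b, -, rfl⟩ := h'
    simp [WangTile.rename] at e
  · obtain ⟨a, -, rfl⟩ := h
    obtain ⟨b, -, rfl⟩ := h'
    simp [WangTile.rename] at e

/-- The number of a state. -/
def stateCode : StateA ⊕ StateB → ℕ := Sum.elim StateA.code StateB.code

/-- The state of the component `l` with number `k`. -/
def stateOf (l : Letter) (k : ℕ) : StateA ⊕ StateB :=
  match l with
  | .a => .inl (.ofCode k)
  | .b => .inr (.ofCode k)

theorem mem_edges_of_mem {l : Letter} {t : WangTile (StateA ⊕ StateB) (Fin 2)}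
    (h : t ∈ component l) : (stateCode t.w, stateCode t.e, t.s, t.n) ∈ edges l := by
  cases l
  · obtain ⟨a, ha, rfl⟩ := h
    exact mem_edgesA_of_mem ha
  · obtain ⟨a, ha, rfl⟩ := h
    exact mem_edgesB_of_mem ha

theorem mem_component_of_mem {l : Letter} {e : Edge} (h : e ∈ edges l) :
    (⟨stateOf l e.1, stateOf l e.2.1, e.2.2.1, e.2.2.2⟩ : WangTile (StateA ⊕ StateB) (Fin 2)) ∈
      component l := by
  cases l
  · exact ⟨_, mem_transducerA_of_mem h, rfl⟩
  · exact ⟨_, mem_transducerB_of_mem h, rfl⟩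

theorem exists_components {f : ℤ → ℤ → WangTile (StateA ⊕ StateB) (Fin 2)}
    (hf : transducerD.IsTiling f) : ∃ w : ℤ → Letter, ∀ x y, f x y ∈ component (w y) := by
  choose l hl using fun x y => exists_component (hf.1 x y)
  refine ⟨l 0, fun x y => ?_⟩
  have step : ∀ x, l x y = l (x + 1) y := fun x =>
    component_unique (hl x y) (hl (x + 1) y) (Or.inr (hf.2.1 x y))
  have : l x y = l 0 y := by
    induction x using Int.induction_on with
    | zero => rfl
    | succ n ih => rw [← step, ih]
    | pred n ih => rw [step, sub_add_cancel, ih]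
  rw [← this]
  exact hl x y

theorem isStack_of_isTiling {f : ℤ → ℤ → WangTile (StateA ⊕ StateB) (Fin 2)}
    (hf : transducerD.IsTiling f) {w : ℤ → Letter} (hw : ∀ x y, f x y ∈ component (w y)) :
    IsStack w fun y x => (f x y).s := by
  refine fun y => ⟨fun x => stateCode (f x y).w, fun x => ?_⟩
  have := mem_edges_of_mem (hw x y)
  rw [hf.2.1 x y, hf.2.2 x y] at this
  exact this

theorem IsStack.representsTiling {w : ℤ → Letter} {r : ℤ → ℤ → Fin 2} (hr : IsStack w r) :
    RepresentsTiling w := by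
  choose q hq using hr
  have hc := fun x y => mem_component_of_mem (hq y x)
  exact ⟨fun x y => ⟨stateOf (w y) (q y x), stateOf (w y) (q y (x + 1)), r y x, r (y + 1) x⟩,
    ⟨fun x y => component_subset _ (hc x y), fun x y => rfl, fun x y => rfl⟩, hc⟩

theorem IsStack.isBiSturmian {w : ℤ → Letter} {r : ℤ → ℤ → Fin 2} (hr : IsStack w r) :
    IsBiSturmian fibSlope w :=
  isBiSturmian_of_isFactor fun _ _ hu =>
    let ⟨_, h⟩ := hr.exists_isInfix_sing hu
    isFactor_fibWord_of_isInfix_sing h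

theorem representsTiling_iff {w : ℤ → Letter} : RepresentsTiling w ↔ IsBiSturmian fibSlope w := by
  constructor
  · rintro ⟨f, hf, hw⟩
    exact (isStack_of_isTiling hf hw).isBiSturmian
  · intro hw
    obtain ⟨r, hr⟩ := exists_isStack fun _ _ hu => hw.isFactor hu
    exact hr.representsTiling

theorem isBiSturmian_lowerMechanical :
    IsBiSturmian fibSlope (lowerMechanical fibSlope fibSlope) :=
  ⟨irrational_fibSlope, fibSlope_pos, fibSlope_lt_one, fibSlope, Or.inl fun _ => rfl⟩

theorem appearsInTiling_iff {u : List Letter} : AppearsInTiling u ↔ IsFactor u fibWord := by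
  constructor
  · rintro ⟨f, hf, y, hy⟩
    obtain ⟨w, hw⟩ := exists_components hf
    have hu : ReadAt w y u := fun i hi => component_unique (hw 0 _) (hy i hi 0) (Or.inl rfl)
    obtain ⟨m, hm⟩ := (isStack_of_isTiling hf hw).exists_isInfix_sing hu
    exact isFactor_fibWord_of_isInfix_sing hm
  · intro hu
    obtain ⟨n, hn⟩ := isFactor_fibWord_iff.1 hu
    obtain ⟨f, hf, hw⟩ := representsTiling_iff.2 isBiSturmian_lowerMechanical
    refine ⟨f, hf, n, fun i hi x => ?_⟩
    rw [← hn i hi]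
    exact hw x _

/-! ### Aperiodicity -/

/-- If all the rows have a common horizontal period, two of them are equal. -/
theorem exists_rows_eq {r : ℤ → ℤ → Fin 2} {u : ℤ} (hu : 0 < u) (h : ∀ y x, r y (x + u) = r y x) :
    ∃ y y', y < y' ∧ r y = r y' := by
  obtain ⟨y, y', hne, he⟩ := Finite.exists_ne_map_eq_of_infinite
    fun (y : ℤ) (i : Fin u.toNat) => r y (i : ℕ)
  have hmod : ∀ y x, r y x = r y (x % u) := by
    have hk : ∀ y x, ∀ k : ℤ, r y (x + k * u) = r y x := by
      intro y x k
      induction k using Int.induction_on with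
      | zero => simp
      | succ k ih => rw [← ih, ← h y (x + k * u)]; congr 1; ring
      | pred k ih => rw [← ih, ← h y (x + (-k - 1) * u)]; congr 1; ring
    intro y x
    rw [← hk y (x % u) (x / u), mul_comm, Int.emod_add_mul_ediv]
  have hr : r y = r y' := by
    funext x
    rw [hmod y, hmod y']
    have h1 := Int.emod_nonneg x hu.ne'
    have h2 := Int.emod_lt_of_pos x hu
    have := congrFun he ⟨(x % u).toNat, by omega⟩
    simpa only [Int.toNat_of_nonneg h1] using this
  rcases lt_or_gt_of_ne hne with hlt | hlt
  · exact ⟨y, y', hlt, hr⟩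
  · exact ⟨y', y, hlt, hr.symm⟩

theorem IsStack.rows_injective {w : ℤ → Letter} {r : ℤ → ℤ → Fin 2} (hr : IsStack w r) {y y' : ℤ}
    (hlt : y < y') (h : r y = r y') : False := by
  obtain ⟨v, hv⟩ : ∃ v, v = y' - y := ⟨_, rfl⟩
  have hpos : 0 < v := by omega
  have hstack : IsStack (fun z => w (y + z % v)) fun z => r (y + z % v) := by
    intro z
    have h1 := Int.emod_nonneg z hpos.ne'
    have h2 := Int.emod_lt_of_pos z hpos
    have hz := hr (y + z % v)
    by_cases hc : z % v + 1 = v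
    · have e : (z + 1) % v = 0 := by
        rw [← Int.emod_add_emod, hc, Int.emod_self]
      show RowRel _ _ (r (y + (z + 1) % v))
      rw [e, add_zero, h, show y' = y + z % v + 1 by omega]
      exact hz
    · have e : (z + 1) % v = z % v + 1 := by
        rw [← Int.emod_add_emod, Int.emod_eq_of_lt (by omega) (by omega)]
      show RowRel _ _ (r (y + (z + 1) % v))
      rw [e, ← add_assoc]
      exact hz
  exact hstack.isBiSturmian.not_periodic hpos fun n => by simp

theorem not_isPeriodicTiling {f : ℤ → ℤ → WangTile (StateA ⊕ StateB) (Fin 2)}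
    (hf : transducerD.IsTiling f) : ¬ IsPeriodicTiling f := by
  rintro ⟨u, v, hne, hp⟩
  obtain ⟨w, hw⟩ := exists_components hf
  have hr := isStack_of_isTiling hf hw
  wlog hpos : 0 < v ∨ (v = 0 ∧ 0 < u) generalizing u v
  · refine this (-u) (-v) ?_ (fun x y => ?_) ?_
    · simpa using hne
    · rw [hp (x + -u)]
      simp
    · simp only [ne_eq, Prod.mk.injEq, not_and] at hne
      omega
  rcases hpos with hv | ⟨rfl, hu⟩
  · refine hr.isBiSturmian.not_periodic hv fun n => ?_
    refine component_unique (hw (0 + u) (n + v)) (hw 0 n) (Or.inl ?_)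
    rw [← hp]
  · obtain ⟨y, y', hlt, he⟩ := exists_rows_eq (r := fun y x => (f x y).s) hu fun y x => by
      have := hp x y
      rw [add_zero] at this
      simp only [← this]
    exact hr.rows_injective hlt he

theorem mainTheorem5 :
    transducerD.IsAperiodic ∧
    {u : List Letter | AppearsInTiling u} = {u | IsFactor u fibWord} ∧
    {u : List Letter | IsFactor u fibWord} =
      {u | ∃ s : ℕ → Letter, IsSturmian (1 / Real.goldenRatio) s ∧ IsFactor u s} ∧
    {w : ℤ → Letter | RepresentsTiling w} =
      {w | IsBiSturmian (1 / Real.goldenRatio) w} := by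
  refine ⟨⟨?_, fun f hf => not_isPeriodicTiling hf⟩, ?_, ?_, ?_⟩
  · obtain ⟨f, hf, -⟩ := representsTiling_iff.2 isBiSturmian_lowerMechanical
    exact ⟨f, hf⟩
  · ext u
    exact appearsInTiling_iff
  · ext u
    exact ⟨fun h => ⟨fibWord, isSturmian_fibWord, h⟩, fun ⟨_, hs, h⟩ => hs.isFactor h⟩
  · ext w
    exact representsTiling_iff
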